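/- **Setting.** A *quantum filtering model* consists of the following data. For von Neumann algebras $\mathfrak A_0\subset\mathfrak A$ and a state $\Phi$ on $\mathfrak A$, a *conditional expectation* $\Phi(\,\cdot\,|\mathfrak A_0)$ is a linear map $E:\mathfrak A\to\mathfrak A_0$ with $E(I)=I$, $E(X^*X)\ge 0$, $E(X^*)=E(X)^*$, $E(XYZ)=XE(Y)Z$ for $Y\in\mathfrak A$ and $X,Z\in\mathfrak A_0$, and $\Phi(E(X))=\Phi(X)$; it is unique up to $\Phi$-indistinguishability ($\Phi(|E(X)-E'(X)|^2)=0$), and equalities of conditional expectations are understood in this sense. * $\mathcal A$ is a unital $C^*$-algebra with state space $\mathcal S$, and $(P_t)_{t\ge0}$ is a semigroup of contractive, completely positive linear maps on $\mathcal A$ with $P_0=\mathrm{id}$ and $P_t[I]=I$. * $\mathfrak M$ is a von Neumann algebra on a complex Hilbert space, with an increasing family $(\mathfrak M_{t]})_{t\ge 0}$ of von Neumann subalgebras such that $(\bigcup_t\mathfrak M_{t]})''=\mathfrak M$; $(\Phi_\rho)_{\rho\in\mathcal S}$ is a family of normal states on $\mathfrak M$ for which the conditional expectations $\Phi_\rho(\,\cdot\,|\mathfrak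 M_{t]}):\mathfrak M\to\mathfrak M_{t]}$ exist for all $t\ge 0$ and $\rho\in\mathcal S$. * $j_t:\mathcal A\to\mathfrak M_{t]}$, $t\ge0$, are injective $^*$-homomorphisms with $\Phi_\rho(j_{t+s}(X)|\mathfrak M_{s]})=j_s(P_t[X])$ and $\Phi_\rho(j_0(X))=\rho(X)$ for all $s,t\ge 0$, $X\in\mathcal A$, $\rho\in\mathcal S$. Moreover $j_0(\mathcal A)''=\mathfrak M_{0]}$, and $\mathfrak M_{0]}\simeq\mathcal A^{**}$ is, via $j_0$, the enveloping von Neumann algebra of $\mathcal A$. * $Y_t^k$ ($t\ge0$, $k=1,\dots,n$) are (possibly unbounded) self-adjoint operators affiliated to $\mathfrak M_{t]}$, with $Y_0^k=0$. The von Neumann algebra $\mathfrak Y_{t]}$ generated by $\{Y_s^k: s\le t,\ k\le n\}$ is commutative, and $j_t(X)\in\mathfrak Y_{t]}'$ for all $t\ge 0$ and $X\in\mathcal A$. Put $\mathfrak Y=(\bigcup_t\mathfrak Y_{t]})''$. * For all $t_1,\dots,t_m>0$, indices $k_1,\dots,k_m\in\{1,\dots,n\}$ and bounded continuous $f_1,\dots,f_m:\mathbb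 R\to\mathbb R$ there is a $Z\in\mathcal A$, independent of $\rho$ and $s$, such that for all $\rho\in\mathcal S$ and $s\ge0$ $$\Phi_\rho\big(f_1(Y^{k_1}_{t_1})\cdots f_m(Y^{k_m}_{t_m})\,\big|\,\mathfrak M_{0]}\big)=j_0(Z),\qquad \Phi_\rho\big(f_1(Y^{k_1}_{s+t_1}-Y^{k_1}_s)\cdots f_m(Y^{k_m}_{s+t_m}-Y^{k_m}_s)\,\big|\,\mathfrak M_{s]}\big)=j_s(Z),$$ where the differences denote the closures of the operator differences. For $\rho\in\mathcal S$ the *filter* is $\pi^\rho_t(X)=\Phi_\rho(j_t(X)|\mathfrak Y_{t]})$, $X\in\mathcal A$, where $\Phi_\rho(\,\cdot\,|\mathfrak Y_{t]})$ is any conditional expectation from $\mathfrak Y_{t]}'\cap\mathfrak M$ onto $\mathfrak Y_{t]}$ with respect to $\Phi_\rho$. The *observable space* is $$\mathcal O=\{X\in\mathcal A:\ \rho(X)=\rho'(X)\text{ for all }\rho,\rho'\in\mathcal S\text{ such that }\Phi_{\rho}(Y)=\Phi_{\rho'}(Y)\text{ for every }Y\in\mathfrak Y\}.$$ **Corollary.**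 Let $\rho_1,\rho_2\in\mathcal S$ and suppose that the law of the observations under $\Phi_{\rho_1}$ is absolutely continuous with respect to the law of the observations under $\Phi_{\rho_2}$, i.e. $\Phi_{\rho_2}(P)=0$ implies $\Phi_{\rho_1}(P)=0$ for every projection $P\in\mathfrak Y$. Then $$\Phi_{\rho_1}\big(|\pi^{\rho_1}_t(X)-\pi^{\rho_2}_t(X)|\big)\xrightarrow{t\to\infty}0\qquad\text{for every }X\in\mathcal O .$$ -/

import Mathlib

noncomputable section QuantumFiltering

open scoped NNReal ComplexOrder InnerProductSpace BoundedContinuousFunction CStarAlgebra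

namespace QFilter

/-! ### States on unital star algebras -/

/-- A state: a linear functional that is positive and maps the unit to `1`. -/
def IsState {B : Type*} [Ring B] [StarRing B] [Module ℂ B] (φ : B →ₗ[ℂ] ℂ) : Prop :=
  (∀ X : B, 0 ≤ φ (star X * X)) ∧ φ 1 = 1

/-- The state space of a unital C*-algebra. -/
abbrev StateSpace (A : Type*) [CStarAlgebra A] : Type _ := {ρ : A →ₗ[ℂ] ℂ // IsState ρ}

/-! ### Von Neumann algebras on a Hilbert space -/

section VonNeumann

variable {H : Type*} [NormedAddCommGroup H] [InnerProductSpace ℂ H] [CompleteSpace H]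

/-- The elements of a von Neumann algebra, as a type. -/
abbrev Elem (M : VonNeumannAlgebra H) : Type _ := M.toStarSubalgebra

/-- The commutant of the self-adjoint set `S ∪ star S`, which is always a von Neumann algebra. -/
def vnCommutant (S : Set (H →L[ℂ] H)) : VonNeumannAlgebra H where
  toStarSubalgebra := StarSubalgebra.centralizer ℂ S
  centralizer_centralizer' := by
    change Set.centralizer (Set.centralizer
      (StarSubalgebra.centralizer ℂ S : Set (H →L[ℂ] H))) = _
    rw [StarSubalgebra.coe_centralizer, Set.centralizer_centralizer_centralizer]
    rfl

/-- The bicommutant `(S ∪ star S)''`: the von Neumann algebra generated by a set of bounded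
operators. It is `S''` if `S` is closed under adjoints. -/
def vnBicommutant (S : Set (H →L[ℂ] H)) : VonNeumannAlgebra H :=
  (vnCommutant S).commutant

/-- The relative commutant `N' ∩ M`. -/
def relCommutant (N M : VonNeumannAlgebra H) : VonNeumannAlgebra H :=
  vnCommutant ((N : Set (H →L[ℂ] H)) ∪ (M.commutant : Set (H →L[ℂ] H)))

theorem mem_vnCommutant_iff {S : Set (H →L[ℂ] H)} (hS : ∀ x ∈ S, star x ∈ S)
    {x : H →L[ℂ] H} : x ∈ vnCommutant S ↔ ∀ g ∈ S, g * x = x * g := by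
  change x ∈ StarSubalgebra.centralizer ℂ S ↔ _
  rw [StarSubalgebra.mem_centralizer_iff]
  exact ⟨fun h g hg => (h g hg).1, fun h g hg => ⟨h g hg, h _ (hS g hg)⟩⟩

theorem mem_relCommutant_iff {N M : VonNeumannAlgebra H} {x : H →L[ℂ] H} :
    x ∈ relCommutant N M ↔ x ∈ N.commutant ∧ x ∈ M := by
  have hM : x ∈ M ↔ x ∈ M.commutant.commutant := by rw [M.commutant_commutant]
  rw [relCommutant, mem_vnCommutant_iff, hM, VonNeumannAlgebra.mem_commutant_iff,
    VonNeumannAlgebra.mem_commutant_iff]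
  · constructor
    · exact fun h => ⟨fun g hg => h g (Or.inl hg), fun g hg => h g (Or.inr hg)⟩
    · rintro ⟨h1, h2⟩ g (hg | hg)
      · exact h1 g hg
      · exact h2 g hg
  · rintro y (hy | hy)
    · exact Or.inl (star_mem (S := VonNeumannAlgebra H) hy)
    · exact Or.inr (star_mem (S := VonNeumannAlgebra H) hy)

/-- A linear functional on a von Neumann algebra is normal if it is continuous for the
σ-weak (ultraweak) topology, i.e. of the form `X ↦ ∑ₙ ⟪ξₙ, X ηₙ⟫` with square-summable
sequences of vectors `ξ`, `η`. -/
def IsNormal {M : VonNeumannAlgebra H} (φ : Elem M →ₗ[ℂ] ℂ) : Prop :=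
  ∃ ξ η : ℕ → H, Summable (fun n => ‖ξ n‖ ^ 2) ∧ Summable (fun n => ‖η n‖ ^ 2) ∧
    ∀ X : Elem M, HasSum (fun n => ⟪ξ n, (X : H →L[ℂ] H) (η n)⟫_ℂ) (φ X)

/-- The absolute value `|X| = (X* X)^{1/2}` of an element of a von Neumann algebra. -/
def absElem {M : VonNeumannAlgebra H} (X : Elem M) : Elem M :=
  ⟨CFC.abs (X : H →L[ℂ] H), by
    have h : CFC.abs (X : H →L[ℂ] H) ∈ M.commutant.commutant := by
      rw [VonNeumannAlgebra.mem_commutant_iff]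
      intro B hB
      rw [VonNeumannAlgebra.mem_commutant_iff] at hB
      have h1 : Commute (X : H →L[ℂ] H) B := hB _ X.2
      have h2 : Commute (X : H →L[ℂ] H) (star B) := by
        have h3 : star (X : H →L[ℂ] H) * B = B * star (X : H →L[ℂ] H) :=
          hB _ (star X).2
        have h4 := congrArg star h3
        simp only [star_mul, star_star] at h4
        exact h4.symm
      exact (h1.cfcAbs_left h2).eq.symm
    rw [M.commutant_commutant] at h
    exact h⟩

/-- `E` is a conditional expectation from the von Neumann algebra `M` onto its von Neumann
subalgebra `M₀` with respect to the state `φ` on `M`. -/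
structure IsCondExp (M M₀ : VonNeumannAlgebra H) (φ : Elem M →ₗ[ℂ] ℂ)
    (E : Elem M →ₗ[ℂ] Elem M) : Prop where
  le : M₀ ≤ M
  mem : ∀ X, (E X : H →L[ℂ] H) ∈ M₀
  one : E 1 = 1
  nonneg : ∀ X, (E (star X * X) : H →L[ℂ] H).IsPositive
  star : ∀ X, E (star X) = star (E X)
  module : ∀ X Y Z : Elem M, (X : H →L[ℂ] H) ∈ M₀ → (Z : H →L[ℂ] H) ∈ M₀ →
    E (X * Y * Z) = X * E Y * Z
  state : ∀ X, φ (E X) = φ X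

/-- `φ`-indistinguishability: `φ(|X - Y|²) = 0`. Conditional expectations with respect to `φ`
are unique in this sense. -/
def Indist {M : VonNeumannAlgebra H} (φ : Elem M →ₗ[ℂ] ℂ) (X Y : Elem M) : Prop :=
  φ (star (X - Y) * (X - Y)) = 0

/-- `Φ(W | M₀) = V`: conditional expectations from `M` onto `M₀` with respect to `φ` exist, and
`V` is the conditional expectation of `W`, up to `φ`-indistinguishability. -/
def CondExpEq (M M₀ : VonNeumannAlgebra H) (φ : Elem M →ₗ[ℂ] ℂ) (W V : Elem M) : Prop :=
  (∃ E, IsCondExp M M₀ φ E) ∧ ∀ E, IsCondExp M M₀ φ E → Indist φ (E W) V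

/-- `j : A → M` exhibits the von Neumann subalgebra `M₀` of `M` as the enveloping von Neumann
algebra `A**`: the image of `j` generates `M₀`, and every continuous linear functional on `A` is
the restriction along `j` of a (necessarily unique) normal functional on `M₀`, so that the
predual of `M₀` is identified with the dual of `A`. -/
def IsEnveloping {A : Type*} [CStarAlgebra A] (M₀ : VonNeumannAlgebra H)
    (j : A → H →L[ℂ] H) : Prop :=
  Set.centralizer (Set.centralizer (Set.range j)) = (M₀ : Set (H →L[ℂ] H)) ∧
    ∀ ψ : A →L[ℂ] ℂ, ∃ φ : Elem M₀ →ₗ[ℂ] ℂ, IsNormal φ ∧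
      ∀ (X : A) (V : Elem M₀), (V : H →L[ℂ] H) = j X → φ V = ψ X

/-! ### Unbounded operators -/

/-- The bounded operator `B` commutes with the unbounded operator `T`, i.e. `B T ⊆ T B`. -/
def CommutesWith (B : H →L[ℂ] H) (T : H →ₗ.[ℂ] H) : Prop :=
  ∀ x y : H, (x, y) ∈ T.graph → (B x, B y) ∈ T.graph

/-- `T` is affiliated to `M`: it commutes with every element of `M'`. -/
def IsAffiliated (T : H →ₗ.[ℂ] H) (M : VonNeumannAlgebra H) : Prop :=
  ∀ B ∈ M.commutant, CommutesWith B T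

/-- The von Neumann algebra generated by a set of (unbounded) self-adjoint operators: the
commutant of the set of all bounded operators that, with their adjoints, commute with all of
them. -/
def vnGenerated (𝒯 : Set (H →ₗ.[ℂ] H)) : VonNeumannAlgebra H :=
  vnCommutant {B | ∀ T ∈ 𝒯, CommutesWith B T ∧ CommutesWith (star B) T}

theorem norm_resolvent_le (x : ℝ) : ‖((x : ℂ) + Complex.I)⁻¹‖ ≤ 1 := by
  rw [norm_inv]
  refine inv_le_one_of_one_le₀ ?_
  have h := Complex.abs_im_le_norm ((x : ℂ) + Complex.I)
  simpa using h

theorem resolvent_ne (x : ℝ) : (x : ℂ) + Complex.I ≠ 0 := by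
  intro h
  have h1 := congrArg Complex.im h
  simp at h1

/-- The bounded continuous function `x ↦ 1 / (x + i)` on the real line. -/
def resolventFun : ℝ →ᵇ ℂ :=
  BoundedContinuousFunction.ofNormedAddCommGroup (fun x : ℝ => ((x : ℂ) + Complex.I)⁻¹)
    (Continuous.inv₀ (by fun_prop) resolvent_ne) 1 norm_resolvent_le

/-- `Θ` is the bounded continuous functional calculus `f ↦ f(T)` of the self-adjoint operator
`T`: a unital *-homomorphism on bounded continuous functions which maps `x ↦ 1 / (x + i)` to
`(T + i)⁻¹`. The latter is expressed by: `T x = y` if and only if `(T + i)⁻¹ (y + i x) = x`.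
For self-adjoint `T` there is exactly one such `Θ`: the values on functions vanishing at infinity
are forced by the Stone-Weierstrass theorem, and then those on all bounded continuous functions
by `f(T) g(T) = (f g)(T)` for `g(x) = 1 / (x + i)`, as `g(T)` has dense range. -/
def IsFunctionalCalculus (T : H →ₗ.[ℂ] H) (Θ : (ℝ →ᵇ ℂ) →⋆ₐ[ℂ] (H →L[ℂ] H)) : Prop :=
  ∀ x y : H, (x, y) ∈ T.graph ↔ Θ resolventFun (y + Complex.I • x) = x

/-- A real bounded continuous function, seen as a complex one. -/
def toComplex (f : ℝ →ᵇ ℝ) : ℝ →ᵇ ℂ :=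
  BoundedContinuousFunction.ofNormedAddCommGroup (fun x => (f x : ℂ))
    (Complex.continuous_ofReal.comp f.continuous) ‖f‖
    (fun x => by simpa using f.norm_coe_le_norm x)

open Classical in
/-- The bounded operator `f(T)`, for a self-adjoint operator `T` and a bounded continuous
`f : ℝ → ℝ`. -/
def funCalc (T : H →ₗ.[ℂ] H) (f : ℝ →ᵇ ℝ) : H →L[ℂ] H :=
  if h : ∃ Θ, IsFunctionalCalculus T Θ then h.choose (toComplex f) else 0

/-- The algebra generated by the observations up to time `t`. -/
def obsAlg {n : ℕ} (Y : ℝ≥0 → Fin n → H →ₗ.[ℂ] H) (t : ℝ≥0) : VonNeumannAlgebra H :=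
  vnGenerated {T | ∃ s ≤ t, ∃ k, T = Y s k}

/-- The product `f₁(T₁) ⋯ fₘ(Tₘ)`. -/
def funCalcProd {m : ℕ} (T : Fin m → H →ₗ.[ℂ] H) (f : Fin m → ℝ →ᵇ ℝ) : H →L[ℂ] H :=
  (List.ofFn fun i => funCalc (T i) (f i)).prod

end VonNeumann

/-! ### The quantum filtering model -/

/-- A quantum filtering model with initial system `A`, universal algebra acting on `H`, and
`n`-dimensional observations. -/
structure Model (A : Type*) [CStarAlgebra A] [PartialOrder A] [StarOrderedRing A]
    (H : Type*) [NormedAddCommGroup H] [InnerProductSpace ℂ H] [CompleteSpace H] (n : ℕ) where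
  /-- the quantum Markov semigroup -/
  P : ℝ≥0 → A →CP A
  P_contractive : ∀ t X, ‖P t X‖ ≤ ‖X‖
  P_zero : ∀ X, P 0 X = X
  P_add : ∀ s t X, P (s + t) X = P s (P t X)
  P_one : ∀ t, P t 1 = 1
  /-- the universal algebra -/
  M : VonNeumannAlgebra H
  /-- the filtration -/
  Mt : ℝ≥0 → VonNeumannAlgebra H
  Mt_mono : Monotone Mt
  Mt_le : ∀ t, Mt t ≤ M
  Mt_generates :
    Set.centralizer (Set.centralizer (⋃ t, (Mt t : Set (H →L[ℂ] H)))) = (M : Set (H →L[ℂ] H))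
  /-- the family of normal states, indexed by the initial states -/
  Φ : StateSpace A → Elem M →ₗ[ℂ] ℂ
  Φ_state : ∀ ρ, IsState (Φ ρ)
  Φ_normal : ∀ ρ, IsNormal (Φ ρ)
  condExp_exists : ∀ ρ t, ∃ E, IsCondExp M (Mt t) (Φ ρ) E
  /-- the quantum Markov process -/
  j : ℝ≥0 → A →⋆ₙₐ[ℂ] Elem M
  j_injective : ∀ t, Function.Injective (j t)
  j_mem : ∀ t X, (j t X : H →L[ℂ] H) ∈ Mt t
  markov : ∀ ρ t s X, CondExpEq M (Mt s) (Φ ρ) (j (t + s) X) (j s (P t X))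
  /-- `M₀` is the enveloping algebra of `A`, and is generated by `j₀(A)` -/
  enveloping : IsEnveloping (Mt 0) (fun X : A => (j 0 X : H →L[ℂ] H))
  initial : ∀ ρ X, Φ ρ (j 0 X) = ρ.1 X
  /-- the observation process -/
  Y : ℝ≥0 → Fin n → H →ₗ.[ℂ] H
  Y_selfAdjoint : ∀ t k, IsSelfAdjoint (Y t k)
  Y_affiliated : ∀ t k, IsAffiliated (Y t k) (Mt t)
  Y_zero : ∀ k, Y 0 k = 0
  selfNondemolition : ∀ t, ∀ B ∈ obsAlg Y t, ∀ C ∈ obsAlg Y t, B * C = C * B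
  nondemolition : ∀ t X, (j t X : H →L[ℂ] H) ∈ (obsAlg Y t).commutant
  /-- the Feller-type assumption; the increments are the closures of the operator differences -/
  feller : ∀ (m : ℕ) (t : Fin m → ℝ≥0) (k : Fin m → Fin n) (f : Fin m → ℝ →ᵇ ℝ),
    (∀ i, 0 < t i) → ∃ Z : A, ∀ ρ,
      (∀ W : Elem M, (W : H →L[ℂ] H) = funCalcProd (fun i => Y (t i) (k i)) f →
        CondExpEq M (Mt 0) (Φ ρ) W (j 0 Z)) ∧
      ∀ s, ∀ W : Elem M,
        (W : H →L[ℂ] H) = funCalcProd (fun i => (Y (s + t i) (k i) - Y s (k i)).closure) f →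
        CondExpEq M (Mt s) (Φ ρ) W (j s Z)

namespace Model

variable {A : Type*} [CStarAlgebra A] [PartialOrder A] [StarOrderedRing A]
  {H : Type*} [NormedAddCommGroup H] [InnerProductSpace ℂ H] [CompleteSpace H] {n : ℕ}
  (𝔉 : Model A H n)

/-- The algebra generated by the observations up to time `t`. -/
def Yt (t : ℝ≥0) : VonNeumannAlgebra H := obsAlg 𝔉.Y t

/-- The algebra generated by all observations. -/
def Yinf : VonNeumannAlgebra H := vnBicommutant (⋃ t, (𝔉.Yt t : Set (H →L[ℂ] H)))

/-- The algebra `Yₜ' ∩ M` on which conditional expectations given the observations up to time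
`t` are defined. -/
def filterDomain (t : ℝ≥0) : VonNeumannAlgebra H := relCommutant (𝔉.Yt t) 𝔉.M

theorem filterDomain_le (t : ℝ≥0) : (𝔉.filterDomain t).toStarSubalgebra ≤ 𝔉.M.toStarSubalgebra :=
  fun _ hx => (mem_relCommutant_iff.1 hx).2

theorem j_mem_filterDomain (t : ℝ≥0) (X : A) :
    (𝔉.j t X : H →L[ℂ] H) ∈ (𝔉.filterDomain t).toStarSubalgebra :=
  mem_relCommutant_iff.2 ⟨𝔉.nondemolition t X, (𝔉.j t X).2⟩

/-- The state `Φ_ρ` restricted to `Yₜ' ∩ M`. -/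
def stateOn (ρ : StateSpace A) (t : ℝ≥0) : Elem (𝔉.filterDomain t) →ₗ[ℂ] ℂ :=
  (𝔉.Φ ρ).comp
    (StarSubalgebra.inclusion (𝔉.filterDomain_le t)).toAlgHom.toLinearMap

/-- `π` is (a version of) the filter `X ↦ Φ_ρ(jₜ(X) | Yₜ)` at time `t` for the initial
state `ρ`. -/
def IsFilter (ρ : StateSpace A) (t : ℝ≥0) (π : A → Elem 𝔉.M) : Prop :=
  ∃ E, IsCondExp (𝔉.filterDomain t) (𝔉.Yt t) (𝔉.stateOn ρ t) E ∧
    ∀ X, (π X : H →L[ℂ] H) = E ⟨𝔉.j t X, 𝔉.j_mem_filterDomain t X⟩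

/-- Two initial states give rise to the same law of the observations. -/
def ObsEquiv (ρ₁ ρ₂ : StateSpace A) : Prop :=
  ∀ B : Elem 𝔉.M, (B : H →L[ℂ] H) ∈ 𝔉.Yinf → 𝔉.Φ ρ₁ B = 𝔉.Φ ρ₂ B

/-- The observable space of the model. -/
def observableSpace : Submodule ℂ A where
  carrier := {X | ∀ ρ₁ ρ₂ : StateSpace A, 𝔉.ObsEquiv ρ₁ ρ₂ → ρ₁.1 X = ρ₂.1 X}
  zero_mem' := fun ρ₁ ρ₂ _ => by simp
  add_mem' := fun hX hY ρ₁ ρ₂ h => by rw [map_add, map_add, hX ρ₁ ρ₂ h, hY ρ₁ ρ₂ h]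
  smul_mem' := fun c X hX ρ₁ ρ₂ h => by rw [map_smul, map_smul, hX ρ₁ ρ₂ h]

/-- The law of the observations under `Φ_ρ₁` is absolutely continuous with respect to the law
under `Φ_ρ₂`. -/
def ObsAbsCont (ρ₁ ρ₂ : StateSpace A) : Prop :=
  ∀ p : Elem 𝔉.M, (p : H →L[ℂ] H) ∈ 𝔉.Yinf → IsStarProjection p →
    𝔉.Φ ρ₂ p = 0 → 𝔉.Φ ρ₁ p = 0

end Model

end QFilter

end QuantumFiltering

/-! The argument is a noncommutative version of the Blackwell-Dubins theorem on merging of opinions.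
Write `φᵢ` for a σ-weakly continuous extension of `Φ ρᵢ` to all bounded operators, and `d t` for the
difference of the two filters.

Merging on increments. Let `Z` represent the conditional expectation of a function `W` of the
increments after `t`. For `B` in `Yt t`, the filter and Markov properties give `φ₁ (B π₁(Z)) = φ₁ (B
W)` and, for every `D` in `Yt t`, `φ₂ (D B π₂(Z)) = φ₂ (D B W)`. Absolute continuity provides a `D`,
measurable at some finite time `T`, such that `φ₁` is close in norm to `φ₂ (D ·)` on the commutative
algebra `Yinf` (`exists_density`). Hence for `t ≥ T` the element `π₂(Z)` nearly satisfies the first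
identity too, and `φ₁ (B * d t Z)` is small uniformly over the unit ball of `Yt t`
(`mem_asymptoticKernel_of_mem_fellerSet`). No exact Radon-Nikodym derivative is needed: a nearly
optimal quadratic test `k` between the states suffices, with `D = k / (1 - k + δ)`.

From increments to the observable space. The elements with this asymptotic property form a closed
star-invariant subspace. If a functional annihilates such a subspace containing `fellerSet`, its
hermitian part is, by a Jordan decomposition, a multiple of a difference of two states that agree on
`fellerSet`. Such states give the same law of the observations (`obsEquiv_of_eqOn`), so they agree
on `observableSpace`. Hahn-Banach then puts the observable space inside the subspace
(`observableSpace_le`).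

Conclusion. Testing against an approximate polar part of `d t X` turns uniform smallness of `φ₁ (B *
d t X)` into smallness of `φ₁ |d t X|` (`IsStateOn.norm_abs_le`). -/

noncomputable section

open scoped NNReal ComplexOrder InnerProductSpace BoundedContinuousFunction CStarAlgebra Topology
open Filter

set_option linter.unusedSectionVars false

namespace QFilter

/-! ### Amplifications, the σ-strong double commutant theorem, and normal functionals. -/

section Amplification

variable {H : Type*} [NormedAddCommGroup H] [InnerProductSpace ℂ H] [CompleteSpace H]

/-- The Hilbert space of square-summable families of vectors. -/
abbrev Amp (ι : Type*) (H : Type*) [NormedAddCommGroup H] : Type _ := lp (fun _ : ι => H) 2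

theorem summable_norm_sq {ι : Type*} (v : Amp ι H) : Summable fun i => ‖v i‖ ^ 2 := by
  have h := (lp.memℓp v).summable (by norm_num)
  simpa using h

theorem memℓp_two {ι : Type*} {f : ι → H} (h : Summable fun i => ‖f i‖ ^ 2) : Memℓp f 2 :=
  memℓp_gen (by simpa using h)

theorem norm_sq_eq_tsum {ι : Type*} (v : Amp ι H) : ‖v‖ ^ 2 = ∑' i, ‖v i‖ ^ 2 := by
  have h := lp.norm_rpow_eq_tsum (p := 2) (by norm_num) v
  simpa using h

/-- The diagonal action of a bounded operator on square-summable families. -/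
def amplify (ι : Type*) (x : H →L[ℂ] H) : Amp ι H →L[ℂ] Amp ι H :=
  LinearMap.mkContinuous
    { toFun := fun v => ⟨fun i => x (v i), memℓp_two <| by
        refine Summable.of_nonneg_of_le (fun _ => by positivity) (fun i => ?_)
          ((summable_norm_sq v).mul_left (‖x‖ ^ 2))
        rw [← mul_pow]
        gcongr
        exact x.le_opNorm _⟩
      map_add' := fun v w => by ext i; exact map_add x _ _
      map_smul' := fun c v => by ext i; exact map_smul x _ _ } ‖x‖ <| fun v => by
    refine le_of_sq_le_sq ?_ (by positivity)
    rw [norm_sq_eq_tsum, mul_pow, norm_sq_eq_tsum, ← tsum_mul_left]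
    refine Summable.tsum_le_tsum (fun i => ?_) (summable_norm_sq _)
      ((summable_norm_sq v).mul_left _)
    rw [← mul_pow]
    change ‖x (v i)‖ ^ 2 ≤ _
    gcongr
    exact x.le_opNorm _

@[simp]
theorem amplify_apply {ι : Type*} (x : H →L[ℂ] H) (v : Amp ι H) (i : ι) :
    amplify ι x v i = x (v i) := rfl

theorem amplify_add {ι : Type*} (x y : H →L[ℂ] H) :
    amplify ι (x + y) = amplify ι x + amplify ι y := by ext v i; rfl

theorem amplify_sub {ι : Type*} (x y : H →L[ℂ] H) :
    amplify ι (x - y) = amplify ι x - amplify ι y := by ext v i; rfl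

theorem amplify_smul {ι : Type*} (c : ℂ) (x : H →L[ℂ] H) :
    amplify ι (c • x) = c • amplify ι x := by ext v i; rfl

theorem amplify_mul {ι : Type*} (x y : H →L[ℂ] H) (v : Amp ι H) :
    amplify ι (x * y) v = amplify ι x (amplify ι y v) := rfl

theorem inner_amplify_left {ι : Type*} (x : H →L[ℂ] H) (v w : Amp ι H) :
    ⟪amplify ι x v, w⟫_ℂ = ⟪v, amplify ι (star x) w⟫_ℂ := by
  rw [lp.inner_eq_tsum, lp.inner_eq_tsum]
  refine tsum_congr fun i => ?_
  rw [amplify_apply, amplify_apply, ContinuousLinearMap.star_eq_adjoint,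
    ContinuousLinearMap.adjoint_inner_right]

theorem inner_amplify_right {ι : Type*} (x : H →L[ℂ] H) (v w : Amp ι H) :
    ⟪v, amplify ι x w⟫_ℂ = ⟪amplify ι (star x) v, w⟫_ℂ := by
  rw [inner_amplify_left, star_star]

/-- The map picking out the components indexed by the image of an injection. -/
def reindex {ι κ : Type*} (e : κ ↪ ι) : Amp ι H →L[ℂ] Amp κ H :=
  LinearMap.mkContinuous
    { toFun := fun v => ⟨fun i => v (e i), memℓp_two ((summable_norm_sq v).comp_injective e.2)⟩
      map_add' := fun v w => by ext i; rfl
      map_smul' := fun c v => by ext i; rfl } 1 <| fun v => by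
    refine le_of_sq_le_sq ?_ (by positivity)
    rw [one_mul, norm_sq_eq_tsum, norm_sq_eq_tsum]
    exact tsum_comp_le_tsum_of_inj (summable_norm_sq v) (fun _ => by positivity) e.2

/-- An operator which leaves a closed subspace invariant, together with its adjoint, commutes with
the projection onto that subspace. -/
theorem starProjection_commute {K : Type*} [NormedAddCommGroup K] [InnerProductSpace ℂ K]
    (L : Submodule ℂ K) [L.HasOrthogonalProjection] (g g' : K →L[ℂ] K)
    (hadj : ∀ v w, ⟪g' v, w⟫_ℂ = ⟪v, g w⟫_ℂ) (h : ∀ v ∈ L, g v ∈ L) (h' : ∀ v ∈ L, g' v ∈ L)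
    (w : K) : L.starProjection (g w) = g (L.starProjection w) := by
  have h1 : g (L.starProjection w) ∈ L := h _ (L.starProjection_apply_mem w)
  have h2 : L.starProjection (g (w - L.starProjection w)) = 0 := by
    rw [Submodule.starProjection_apply_eq_zero_iff, Submodule.mem_orthogonal]
    intro u hu
    rw [← hadj]
    exact (Submodule.mem_orthogonal _ _).1 (L.sub_starProjection_mem_orthogonal w) _ (h' u hu)
  rw [map_sub, map_sub, sub_eq_zero] at h2
  rw [h2]
  exact Submodule.starProjection_eq_self_iff.2 h1

/-- The σ-strong form of the double commutant theorem, for a single square-summable family. -/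
theorem amplify_mem_closure {ι : Type*} {S : Submodule ℂ (H →L[ℂ] H)} (h1 : 1 ∈ S)
    {G : Set (H →L[ℂ] H)} (hstar : ∀ g ∈ G, star g ∈ G) (hG : ∀ g ∈ G, ∀ s ∈ S, g * s ∈ S)
    {x : H →L[ℂ] H} (hx : ∀ y, (∀ g ∈ G, g * y = y * g) → x * y = y * x) (v : Amp ι H) :
    amplify ι x v ∈ closure {w | ∃ s ∈ S, w = amplify ι s v} := by
  classical
  let ev : (H →L[ℂ] H) →ₗ[ℂ] Amp ι H :=
    { toFun := fun s => amplify ι s v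
      map_add' := fun s t => by rw [amplify_add]; rfl
      map_smul' := fun c s => by rw [amplify_smul]; rfl }
  let L : Submodule ℂ (Amp ι H) := (S.map ev).topologicalClosure
  have hL : (L : Set (Amp ι H)) = closure {w | ∃ s ∈ S, w = amplify ι s v} := by
    rw [Submodule.topologicalClosure_coe]
    congr 1
    ext w
    simp only [Submodule.map_coe, Set.mem_image, SetLike.mem_coe, Set.mem_ofPred_eq]
    exact ⟨fun ⟨s, hs, h⟩ => ⟨s, hs, h.symm⟩, fun ⟨s, hs, h⟩ => ⟨s, hs, h.symm⟩⟩
  have : CompleteSpace L := (Submodule.isClosed_topologicalClosure _).completeSpace_coe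
  have hinv : ∀ g ∈ G, ∀ w ∈ L, amplify ι g w ∈ L := by
    intro g hg w hw
    have h2 : (S.map ev).topologicalClosure ≤
        (S.map ev).topologicalClosure.comap (amplify ι g : Amp ι H →ₗ[ℂ] Amp ι H) := by
      refine Submodule.topologicalClosure_minimal _ ?_ ?_
      · rintro _ ⟨s, hs, rfl⟩
        exact Submodule.le_topologicalClosure _ ⟨g * s, hG g hg s hs, rfl⟩
      · exact (Submodule.isClosed_topologicalClosure _).preimage (amplify ι g).continuous
    exact h2 hw
  have hcomm : ∀ g ∈ G, ∀ w, L.starProjection (amplify ι g w) = amplify ι g (L.starProjection w) :=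
    fun g hg => starProjection_commute L _ (amplify ι (star g))
      (fun a b => by rw [inner_amplify_left, star_star]) (hinv g hg) (hinv _ (hstar g hg))
  -- The matrix entries of the projection onto `L`. The projection commutes with the amplified `G`,
  -- so each entry commutes with `G`, hence with `x`; therefore the amplified `x` commutes with the
  -- projection and leaves `L` invariant.
  let entry : ι → ι → H →L[ℂ] H := fun m k =>
    (lp.evalCLM ℂ (fun _ : ι => H) 2 m).comp (L.starProjection.comp
      (lp.singleContinuousLinearMap ℂ (fun _ : ι => H) 2 k))
  have hsing : ∀ (y : H →L[ℂ] H) (k : ι) (a : H),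
      amplify ι y (lp.single 2 k a) = lp.single 2 k (y a) := by
    intro y k a
    ext m
    rw [amplify_apply, lp.coeFn_single, lp.coeFn_single]
    by_cases hm : m = k
    · subst hm; simp
    · simp [hm]
  have hxcomm : ∀ w, L.starProjection (amplify ι x w) = amplify ι x (L.starProjection w) := by
    have key : L.starProjection.comp (amplify ι x) = (amplify ι x).comp L.starProjection := by
      refine lp.ext_continuousLinearMap (by norm_num) fun k => ?_
      ext a m
      have := hx (entry m k) (fun g hg => by
        ext b
        have h3 := congrArg (fun z : Amp ι H => z m) (hcomm g hg (lp.single 2 k b))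
        simp only [hsing, amplify_apply] at h3
        exact h3.symm)
      have h4 := congrArg (fun T : H →L[ℂ] H => T a) this
      change (L.starProjection (amplify ι x (lp.single 2 k a)) : Amp ι H) m = _
      rw [hsing]
      exact h4.symm
    intro w
    exact congrArg (fun T => T w) key
  have hv : v ∈ L := Submodule.le_topologicalClosure _ ⟨1, h1, rfl⟩
  rw [← hL]
  have h5 := hxcomm v
  rw [Submodule.starProjection_eq_self_iff.2 hv] at h5
  exact Submodule.starProjection_eq_self_iff.1 h5

/-- The σ-strong form of the double commutant theorem. -/
theorem exists_seq_tendsto_amplify {S : Submodule ℂ (H →L[ℂ] H)} (h1 : 1 ∈ S)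
    {G : Set (H →L[ℂ] H)} (hstar : ∀ g ∈ G, star g ∈ G) (hG : ∀ g ∈ G, ∀ s ∈ S, g * s ∈ S)
    {x : H →L[ℂ] H} (hx : ∀ y, (∀ g ∈ G, g * y = y * g) → x * y = y * x)
    {κ : Type*} [Finite κ] (w : κ → Amp ℕ H) :
    ∃ s : ℕ → H →L[ℂ] H, (∀ k, s k ∈ S) ∧
      ∀ i, Tendsto (fun k => amplify ℕ (s k) (w i)) atTop (𝓝 (amplify ℕ x (w i))) := by
  -- Concatenating the finitely many families into one yields a single approximating sequence that
  -- works for all of them.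
  let v : Amp (κ × ℕ) H := ⟨fun p => w p.1 p.2, memℓp_two <| by
    rw [summable_prod_of_nonneg (fun _ => by positivity)]
    exact ⟨fun i => summable_norm_sq (w i), Summable.of_finite⟩⟩
  have h := amplify_mem_closure h1 hstar hG hx v
  rw [mem_closure_iff_seq_limit] at h
  obtain ⟨z, hz, hlim⟩ := h
  choose s hs hzs using hz
  refine ⟨s, hs, fun i => ?_⟩
  have h2 := ((reindex (H := H) ⟨fun n => (i, n), fun a b hab => (Prod.mk.inj hab).2⟩).continuous.tendsto
    _).comp hlim
  refine (h2.congr fun k => ?_)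
  rw [Function.comp_apply, hzs k]
  rfl

/-- The σ-weakly continuous functional given by a pair of square-summable families. -/
def vecFunctional (u v : Amp ℕ H) : (H →L[ℂ] H) →ₗ[ℂ] ℂ where
  toFun X := ⟪u, amplify ℕ X v⟫_ℂ
  map_add' X Y := by rw [amplify_add, add_apply, inner_add_right]
  map_smul' c X := by
    rw [amplify_smul, smul_apply, inner_smul_right]; rfl

theorem vecFunctional_apply (u v : Amp ℕ H) (X : H →L[ℂ] H) :
    vecFunctional u v X = ⟪u, amplify ℕ X v⟫_ℂ := rfl

theorem vecFunctional_star_mul (u v : Amp ℕ H) (X Y : H →L[ℂ] H) :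
    vecFunctional u v (star X * Y) = ⟪amplify ℕ X u, amplify ℕ Y v⟫_ℂ := by
  rw [vecFunctional_apply, amplify_mul, inner_amplify_right, star_star]

/-- A normal functional on a von Neumann algebra extends to a σ-weakly continuous functional on all
bounded operators. -/
theorem IsNormal.exists_vecFunctional {M : VonNeumannAlgebra H} {φ : Elem M →ₗ[ℂ] ℂ}
    (h : IsNormal φ) : ∃ u v : Amp ℕ H, ∀ X : Elem M, φ X = vecFunctional u v X := by
  obtain ⟨ξ, η, hξ, hη, h⟩ := h
  exact ⟨⟨ξ, memℓp_two hξ⟩, ⟨η, memℓp_two hη⟩, fun X => (h X).unique (lp.hasSum_inner _ _)⟩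

/-- Strong convergence of a bounded sequence implies σ-weak convergence. -/
theorem tendsto_vecFunctional (u v : Amp ℕ H) {b : ℕ → H →L[ℂ] H} {x : H →L[ℂ] H} {C : ℝ}
    (hC : ∀ k, ‖b k‖ ≤ C) (h : ∀ a, Tendsto (fun k => b k a) atTop (𝓝 (x a))) :
    Tendsto (fun k => vecFunctional u v (b k)) atTop (𝓝 (vecFunctional u v x)) := by
  simp only [vecFunctional_apply, lp.inner_eq_tsum, amplify_apply]
  have hs : Summable fun i => ‖u i‖ * (C * ‖v i‖) := by
    refine Summable.of_nonneg_of_le (fun i => by have := (norm_nonneg _).trans (hC 0); positivity)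
      (fun i => ?_) (((summable_norm_sq u).add (summable_norm_sq v)).mul_left C)
    have := (norm_nonneg _).trans (hC 0)
    rw [mul_left_comm]
    gcongr
    nlinarith [two_mul_le_add_sq ‖u i‖ ‖v i‖, norm_nonneg (u i), norm_nonneg (v i)]
  refine tendsto_tsum_of_dominated_convergence hs (fun i => ?_) (Eventually.of_forall fun k i => ?_)
  · exact ((continuous_const.inner continuous_id).tendsto _).comp (h (v i))
  · refine (norm_inner_le_norm _ _).trans ?_
    gcongr
    exact ((b k).le_opNorm _).trans (by gcongr; exact hC k)

end Amplification

/-! ### Elementary properties of states, and strong limits of operators. -/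

section StatesOnAlgebras

variable {H : Type*} [NormedAddCommGroup H] [InnerProductSpace ℂ H] [CompleteSpace H]

/-- A linear functional on all bounded operators which restricts to a state of the von Neumann
algebra `N`. -/
structure IsStateOn (N : VonNeumannAlgebra H) (φ : (H →L[ℂ] H) →ₗ[ℂ] ℂ) : Prop where
  nonneg : ∀ X ∈ N, 0 ≤ φ (star X * X)
  one : φ 1 = 1

theorem smul_mem_vn (N : VonNeumannAlgebra H) (c : ℂ) {x : H →L[ℂ] H} (hx : x ∈ N) : c • x ∈ N :=
  N.toStarSubalgebra.smul_mem hx c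

theorem mem_iff_commute {N : VonNeumannAlgebra H} {x : H →L[ℂ] H} :
    x ∈ N ↔ ∀ B ∈ N.commutant, B * x = x * B := by
  conv_lhs => rw [← N.commutant_commutant]
  exact VonNeumannAlgebra.mem_commutant_iff

theorem cfc_mem_vn {N : VonNeumannAlgebra H} {a : H →L[ℂ] H} (ha : a ∈ N) (f : ℝ → ℝ) :
    cfc f a ∈ N := by
  rw [mem_iff_commute]
  intro B hB
  have h : Commute a B := (mem_iff_commute.1 ha B hB).symm
  exact (h.cfc_real f).eq.symm

theorem exists_star_mul_self_of_nonneg {N : VonNeumannAlgebra H} {a : H →L[ℂ] H} (ha : a ∈ N)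
    (h0 : 0 ≤ a) : ∃ y ∈ N, star y * y = a := by
  refine ⟨cfc Real.sqrt a, cfc_mem_vn ha _, ?_⟩
  have hsa : IsSelfAdjoint (cfc Real.sqrt a) := cfc_predicate _ _
  rw [hsa.star_eq, ← cfc_mul Real.sqrt Real.sqrt a]
  conv_rhs => rw [← cfc_id ℝ a]
  refine cfc_congr fun x hx => ?_
  exact Real.mul_self_sqrt (spectrum_nonneg_of_nonneg h0 hx)

namespace IsStateOn

variable {N : VonNeumannAlgebra H} {φ : (H →L[ℂ] H) →ₗ[ℂ] ℂ}

theorem of_nonneg (h : IsStateOn N φ) {a : H →L[ℂ] H} (ha : a ∈ N) (h0 : 0 ≤ a) : 0 ≤ φ a := by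
  obtain ⟨y, hy, rfl⟩ := exists_star_mul_self_of_nonneg ha h0
  exact h.nonneg y hy

theorem re_nonneg (h : IsStateOn N φ) {a : H →L[ℂ] H} (ha : a ∈ N) (h0 : 0 ≤ a) : 0 ≤ (φ a).re :=
  (Complex.le_def.1 (h.of_nonneg ha h0)).1

theorem im_eq_zero (h : IsStateOn N φ) {a : H →L[ℂ] H} (ha : a ∈ N) (h0 : 0 ≤ a) :
    (φ a).im = 0 :=
  (Complex.le_def.1 (h.of_nonneg ha h0)).2.symm

theorem re_mono (h : IsStateOn N φ) {a b : H →L[ℂ] H} (ha : a ∈ N) (hb : b ∈ N) (hab : a ≤ b) :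
    (φ a).re ≤ (φ b).re := by
  have := h.re_nonneg (sub_mem hb ha) (sub_nonneg.2 hab)
  rw [map_sub, Complex.sub_re] at this
  linarith

theorem mono (h : IsStateOn N φ) {N' : VonNeumannAlgebra H} (hN : N' ≤ N) : IsStateOn N' φ :=
  ⟨fun X hX => h.nonneg X (hN hX), h.one⟩

/-- Polarization: `φ ((1 + a)²)` and `φ (a²)` are real, and they differ by `1 + 2 φ a`. -/
theorem im_eq_zero_of_isSelfAdjoint (h : IsStateOn N φ) {a : H →L[ℂ] H} (ha : a ∈ N)
    (hs : IsSelfAdjoint a) : (φ a).im = 0 := by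
  have e : φ (star (1 + a) * (1 + a)) = 1 + 2 * φ a + φ (star a * a) := by
    rw [star_add, star_one, hs.star_eq, add_mul, one_mul, mul_add, mul_one, map_add, map_add,
      map_add, h.one]
    ring
  have h1 := (Complex.le_def.1 (h.nonneg (1 + a) (add_mem (one_mem N) ha))).2
  have h2 := (Complex.le_def.1 (h.nonneg a ha)).2
  rw [e] at h1
  simp only [Complex.zero_im, Complex.add_im, Complex.one_im, Complex.mul_im, Complex.re_ofNat,
    Complex.im_ofNat] at h1 h2
  linarith

theorem map_star (h : IsStateOn N φ) {a : H →L[ℂ] H} (ha : a ∈ N) :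
    φ (star a) = star (φ a) := by
  have h1 := h.im_eq_zero_of_isSelfAdjoint (add_mem ha (star_mem ha)) (.add_star_self a)
  have h2 : (φ (Complex.I • (a - star a))).im = 0 := by
    refine h.im_eq_zero_of_isSelfAdjoint
      (smul_mem_vn N _ (sub_mem ha (star_mem ha))) ?_
    rw [isSelfAdjoint_iff, star_smul, star_sub, star_star, Complex.star_def, Complex.conj_I,
      neg_smul, ← smul_neg, neg_sub]
  rw [map_smul, map_sub, smul_eq_mul] at h2
  rw [map_add] at h1
  simp only [Complex.add_im, Complex.mul_im, Complex.I_re, Complex.I_im, Complex.sub_re] at h1 h2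
  apply Complex.ext
  · simp only [Complex.star_def, Complex.conj_re]; linarith
  · simp only [Complex.star_def, Complex.conj_im]; linarith

theorem cauchySchwarz (h : IsStateOn N φ) {a b : H →L[ℂ] H} (ha : a ∈ N) (hb : b ∈ N) :
    ‖φ (star a * b)‖ ^ 2 ≤ (φ (star a * a)).re * (φ (star b * b)).re := by
  let c : PreInnerProductSpace.Core ℂ N.toStarSubalgebra :=
    { inner := fun x y => φ (star (x : H →L[ℂ] H) * y)
      conj_inner_symm := fun x y => by
        have := h.map_star (mul_mem (star_mem y.2) x.2 : star (y : H →L[ℂ] H) * x ∈ N)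
        rw [star_mul, star_star] at this
        exact this.symm
      re_inner_nonneg := fun x => (Complex.le_def.1 (h.nonneg x x.2)).1
      add_left := fun x y z => by
        change φ (star ((x : H →L[ℂ] H) + y) * z) = _
        rw [star_add, add_mul, map_add]
      smul_left := fun x y r => by
        change φ (star (r • (x : H →L[ℂ] H)) * y) = _
        rw [star_smul, smul_mul_assoc, map_smul]; rfl }
  have := @InnerProductSpace.Core.inner_mul_inner_self_le ℂ _ _ _ _ c ⟨a, ha⟩ ⟨b, hb⟩
  have e : ‖φ (star b * a)‖ = ‖φ (star a * b)‖ := by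
    have := h.map_star (mul_mem (star_mem hb) ha : star b * a ∈ N)
    rw [star_mul, star_star] at this
    rw [this, norm_star]
  change ‖φ (star a * b)‖ * ‖φ (star b * a)‖ ≤ _ at this
  rw [e] at this
  rw [sq]
  exact this

theorem norm_sq_le (h : IsStateOn N φ) {a : H →L[ℂ] H} (ha : a ∈ N) :
    ‖φ a‖ ^ 2 ≤ (φ (star a * a)).re := by
  have := h.cauchySchwarz (one_mem N) ha
  simpa [h.one] using this

theorem re_star_mul_self_le (h : IsStateOn N φ) {a : H →L[ℂ] H} (ha : a ∈ N) :
    (φ (star a * a)).re ≤ ‖a‖ ^ 2 := by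
  have h1 := h.re_mono (mul_mem (star_mem ha) ha)
    (by rw [Algebra.algebraMap_eq_smul_one]; exact smul_mem_vn N (‖a‖ ^ 2 : ℝ) (one_mem N))
    (CStarAlgebra.star_mul_le_algebraMap_norm_sq (a := a))
  refine h1.trans (le_of_eq ?_)
  rw [Algebra.algebraMap_eq_smul_one, ← Complex.coe_smul, map_smul, h.one, smul_eq_mul, mul_one,
    Complex.ofReal_re]

theorem norm_le (h : IsStateOn N φ) {a : H →L[ℂ] H} (ha : a ∈ N) : ‖φ a‖ ≤ ‖a‖ :=
  le_of_sq_le_sq ((h.norm_sq_le ha).trans (h.re_star_mul_self_le ha)) (norm_nonneg _)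

/-- Cauchy-Schwarz. This is how indistinguishable versions of a conditional expectation become
interchangeable under the state. -/
theorem eq_zero_of_star_mul_self (h : IsStateOn N φ) {a b : H →L[ℂ] H} (ha : a ∈ N) (hb : b ∈ N)
    (h0 : φ (star a * a) = 0) : φ (b * a) = 0 := by
  have := h.cauchySchwarz (star_mem hb) ha
  rw [h0, star_star, Complex.zero_re, mul_zero] at this
  have h2 : ‖φ (b * a)‖ = 0 := by nlinarith [norm_nonneg (φ (b * a))]
  exact norm_eq_zero.1 h2

end IsStateOn

/-! ### Monotone strong limits -/

theorem isClosed_nonneg_strong {b : ℕ → H →L[ℂ] H} {x : H →L[ℂ] H} (hb : ∀ k, 0 ≤ b k)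
    (h : ∀ a, Tendsto (fun k => b k a) atTop (𝓝 (x a))) : 0 ≤ x := by
  rw [ContinuousLinearMap.nonneg_iff_isPositive, ContinuousLinearMap.isPositive_iff_complex]
  intro v
  have h1 : Tendsto (fun k => ⟪b k v, v⟫_ℂ) atTop (𝓝 ⟪x v, v⟫_ℂ) := (h v).inner tendsto_const_nhds
  have h2 : 0 ≤ ⟪x v, v⟫_ℂ := by
    refine ge_of_tendsto' h1 fun k => ?_
    exact ((ContinuousLinearMap.isPositive_iff _).1
      ((ContinuousLinearMap.nonneg_iff_isPositive _).1 (hb k))).2 v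
  rw [Complex.le_def] at h2
  refine ⟨?_, h2.1⟩
  apply Complex.ext
  · simp
  · simpa using h2.2

/-- Holds because `d² ≤ d`. It lets convergence of quadratic forms control convergence of vectors.
-/
theorem norm_apply_sq_le_of_le_one {d : H →L[ℂ] H} (h0 : 0 ≤ d) (h1 : d ≤ 1) (v : H) :
    ‖d v‖ ^ 2 ≤ (⟪d v, v⟫_ℂ).re := by
  have h2 : d * d ≤ d := by
    have := CStarAlgebra.pow_antitone h0 h1 (show 1 ≤ 2 by norm_num)
    simpa [sq] using this
  have h3 := (ContinuousLinearMap.isPositive_def'.1 (ContinuousLinearMap.le_def _ _ |>.1 h2)).2 v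
  have hsa : ContinuousLinearMap.adjoint d = d := (IsSelfAdjoint.of_nonneg h0).star_eq
  have h4 : ⟪d (d v), v⟫_ℂ = ⟪d v, d v⟫_ℂ := by
    conv_lhs => rw [← ContinuousLinearMap.adjoint_inner_right, hsa]
  rw [ContinuousLinearMap.reApplyInnerSelf_apply] at h3
  change 0 ≤ RCLike.re ⟪d v - d (d v), v⟫_ℂ at h3
  rw [inner_sub_left, h4, map_sub, inner_self_eq_norm_sq] at h3
  have h5 : RCLike.re ⟪d v, v⟫_ℂ = (⟪d v, v⟫_ℂ).re := rfl
  rw [h5] at h3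
  linarith

/-- A decreasing sequence of positive contractions converges strongly. -/
theorem exists_strong_limit {b : ℕ → H →L[ℂ] H} (h0 : ∀ k, 0 ≤ b k) (h1 : ∀ k, b k ≤ 1)
    (hb : Antitone b) : ∃ x : H →L[ℂ] H, ∀ a, Tendsto (fun k => b k a) atTop (𝓝 (x a)) := by
  have hcau : ∀ a, CauchySeq fun k => b k a := by
    intro a
    let r : ℕ → ℝ := fun k => (⟪b k a, a⟫_ℂ).re
    have hdiff : ∀ m n, m ≤ n → ‖b m a - b n a‖ ^ 2 ≤ r m - r n := by
      intro m n hmn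
      have := norm_apply_sq_le_of_le_one (sub_nonneg.2 (hb hmn))
        ((sub_le_self _ (h0 n)).trans (h1 m)) a
      rw [sub_apply, inner_sub_left, Complex.sub_re] at this
      exact this
    have hanti : Antitone r := fun m n hmn => by
      have := (sq_nonneg _).trans (hdiff m n hmn)
      linarith
    have hbdd : BddBelow (Set.range r) := ⟨0, by
      rintro _ ⟨k, rfl⟩
      exact ((ContinuousLinearMap.nonneg_iff_isPositive _).1 (h0 k)).re_inner_nonneg_left a⟩
    have hr := (tendsto_atTop_ciInf hanti hbdd).cauchySeq
    rw [Metric.cauchySeq_iff'] at hr ⊢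
    intro ε hε
    obtain ⟨K, hK⟩ := hr (ε ^ 2) (by positivity)
    refine ⟨K, fun n hn => ?_⟩
    have h2 := hdiff K n hn
    have h3 := hK n hn
    rw [Real.dist_eq, abs_lt] at h3
    rw [dist_comm, dist_eq_norm]
    exact lt_of_pow_lt_pow_left₀ 2 hε.le (by linarith)
  choose f hf using fun a => cauchySeq_tendsto_of_complete (hcau a)
  exact ⟨continuousLinearMapOfTendsto b (tendsto_pi_nhds.2 hf), hf⟩

theorem strong_limit_mem {N : VonNeumannAlgebra H} {b : ℕ → H →L[ℂ] H} {x : H →L[ℂ] H}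
    (hb : ∀ k, b k ∈ N) (h : ∀ a, Tendsto (fun k => b k a) atTop (𝓝 (x a))) : x ∈ N := by
  rw [mem_iff_commute]
  intro B hB
  ext a
  have h1 : Tendsto (fun k => B (b k a)) atTop (𝓝 (B (x a))) := (B.continuous.tendsto _).comp (h a)
  refine tendsto_nhds_unique h1 ((h (B a)).congr fun k => ?_)
  exact congrArg (fun T : H →L[ℂ] H => T a) (mem_iff_commute.1 (hb k) B hB).symm

theorem strong_limit_le {b : ℕ → H →L[ℂ] H} {x c : H →L[ℂ] H} (hb : ∀ k, b k ≤ c)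
    (h : ∀ a, Tendsto (fun k => b k a) atTop (𝓝 (x a))) : x ≤ c := by
  rw [← sub_nonneg]
  exact isClosed_nonneg_strong (b := fun k => c - b k) (fun k => sub_nonneg.2 (hb k))
    fun a => tendsto_const_nhds.sub (h a)

end StatesOnAlgebras

/-! ### From absolute continuity on projections to an ε-η form, by a Borel-Cantelli argument. -/

section AbsoluteContinuity

variable {H : Type*} [NormedAddCommGroup H] [InnerProductSpace ℂ H] [CompleteSpace H]

/-- The product `c N * c (N + 1) * ⋯ * c (N + m - 1)`. -/
def intervalProd {R : Type*} [Monoid R] (c : ℕ → R) : ℕ → ℕ → R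
  | 0, _ => 1
  | m + 1, N => c N * intervalProd c m (N + 1)

section

variable {N : VonNeumannAlgebra H} (hN : ∀ B ∈ N, ∀ C ∈ N, B * C = C * B)

include hN in
theorem mul_nonneg_of_commutative {x y : H →L[ℂ] H} (hx : x ∈ N) (hy : y ∈ N) (hx0 : 0 ≤ x)
    (hy0 : 0 ≤ y) : 0 ≤ x * y :=
  Commute.mul_nonneg hx0 hy0 (hN x hx y hy)

include hN in
-- In a commutative algebra, multiplying by a positive contraction decreases a positive element. The
-- bounds are proved in one induction, over all starting indices, because each depends on the
-- others.
theorem intervalProd_spec {c : ℕ → H →L[ℂ] H} (hc : ∀ k, c k ∈ N) (h0 : ∀ k, 0 ≤ c k)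
    (h1 : ∀ k, c k ≤ 1) (m : ℕ) : ∀ K, intervalProd c m K ∈ N ∧ 0 ≤ intervalProd c m K ∧
      intervalProd c m K ≤ 1 ∧ intervalProd c (m + 1) K ≤ intervalProd c m K ∧
      intervalProd c (m + 1) K ≤ intervalProd c m (K + 1) ∧ intervalProd c (m + 1) K ≤ c K := by
  induction m with
  | zero =>
    intro K
    simp only [intervalProd, mul_one]
    refine ⟨one_mem N, zero_le_one, le_rfl, h1 K, h1 K, le_rfl⟩
  | succ m ih =>
    intro K
    obtain ⟨a1, a2, a3, a4, a5, a6⟩ := ih (K + 1)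
    obtain ⟨b1, b2, b3, b4, b5, b6⟩ := ih K
    have e : ∀ i L, intervalProd c (i + 1) L = c L * intervalProd c i (L + 1) := fun _ _ => rfl
    have hmem : intervalProd c (m + 1) K ∈ N := mul_mem (hc K) a1
    have hmem' : intervalProd c (m + 1) (K + 1) ∈ N := mul_mem (hc _) (ih _).1
    have hnn : ∀ L, 0 ≤ intervalProd c (m + 1) L := fun L =>
      mul_nonneg_of_commutative hN (hc L) (ih _).1 (h0 L) (ih _).2.1
    have hle : ∀ L, intervalProd c (m + 1) L ≤ 1 := fun L => (ih L).2.2.2.1.trans (ih L).2.2.1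
    refine ⟨hmem, hnn K, hle K, ?_, ?_, ?_⟩
    · rw [← sub_nonneg]
      change 0 ≤ c K * intervalProd c m (K + 1) - c K * intervalProd c (m + 1) (K + 1)
      rw [← mul_sub]
      exact mul_nonneg_of_commutative hN (hc K) (sub_mem a1 hmem') (h0 K) (sub_nonneg.2 a4)
    · rw [e (m + 1), ← sub_nonneg, ← one_sub_mul]
      exact mul_nonneg_of_commutative hN (sub_mem (one_mem N) (hc K)) hmem'
        (sub_nonneg.2 (h1 K)) (hnn _)
    · rw [e (m + 1), ← sub_nonneg, ← mul_one_sub]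
      exact mul_nonneg_of_commutative hN (hc K) (sub_mem (one_mem N) hmem') (h0 K)
        (sub_nonneg.2 (hle _))

include hN in
-- The union bound, a consequence of `0 ≤ (1 - x) * (1 - y)`.
theorem re_one_sub_mul_le {φ : (H →L[ℂ] H) →ₗ[ℂ] ℂ} (hφ : IsStateOn N φ) {x y : H →L[ℂ] H}
    (hx : x ∈ N) (hy : y ∈ N) (hx1 : x ≤ 1) (hy1 : y ≤ 1) :
    (φ (1 - x * y)).re ≤ (φ (1 - x)).re + (φ (1 - y)).re := by
  have h1 := hφ.re_nonneg (mul_mem (sub_mem (one_mem N) hx) (sub_mem (one_mem N) hy))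
    (mul_nonneg_of_commutative hN (sub_mem (one_mem N) hx) (sub_mem (one_mem N) hy)
      (sub_nonneg.2 hx1) (sub_nonneg.2 hy1))
  have e : (1 - x) * (1 - y) = (1 - x) + (1 - y) - (1 - x * y) := by
    rw [sub_mul, one_mul, mul_sub, mul_one]
    abel
  rw [e, map_sub, map_add, Complex.sub_re, Complex.add_re] at h1
  linarith

/-- The strong limits of powers of a positive contraction are projections. -/
theorem exists_limit_pow {z : H →L[ℂ] H} (hz : z ∈ N) (h0 : 0 ≤ z) (h1 : z ≤ 1) :
    ∃ e ∈ N, IsStarProjection e ∧ ∀ a, Tendsto (fun k => (z ^ k) a) atTop (𝓝 (e a)) := by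
  have hnn : ∀ k, 0 ≤ z ^ k := fun k => CStarAlgebra.pow_nonneg h0 k
  have hanti : Antitone fun k : ℕ => z ^ k := CStarAlgebra.pow_antitone h0 h1
  have hle : ∀ k, z ^ k ≤ 1 := fun k => by simpa using hanti (Nat.zero_le k)
  obtain ⟨e, he⟩ := exists_strong_limit hnn hle hanti
  have hmem : e ∈ N := strong_limit_mem (fun k => pow_mem hz k) he
  have hbd : ∀ k, ‖z ^ k‖ ≤ 1 := fun k => CStarAlgebra.norm_le_one_iff_of_nonneg _ (hnn k) |>.2 (hle k)
  refine ⟨e, hmem, ⟨?_, (IsSelfAdjoint.of_nonneg (isClosed_nonneg_strong hnn he))⟩, he⟩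
  change e * e = e
  ext a
  have hlim : Tendsto (fun k : ℕ => (z ^ (k + k)) a) atTop (𝓝 (e a)) :=
    (he a).comp (tendsto_atTop_mono (fun k => Nat.le_add_left k k) tendsto_id)
  refine tendsto_nhds_unique ?_ hlim
  -- Since the powers are contractions, `z ^ (2 k) a` has the same limit as `z ^ k (e a)`, which is
  -- `e (e a)`; this gives idempotence.
  have h2 : Tendsto (fun k => (z ^ k) ((z ^ k) a - e a)) atTop (𝓝 0) := by
    rw [tendsto_zero_iff_norm_tendsto_zero]
    refine squeeze_zero (fun _ => norm_nonneg _) (fun k => ?_)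
      ((tendsto_zero_iff_norm_tendsto_zero.1 (tendsto_sub_nhds_zero_iff.2 (he a))))
    calc ‖(z ^ k) ((z ^ k) a - e a)‖ ≤ ‖z ^ k‖ * ‖(z ^ k) a - e a‖ := (z ^ k).le_opNorm _
      _ ≤ 1 * ‖(z ^ k) a - e a‖ := by gcongr; exact hbd k
      _ = _ := one_mul _
  have h3 := h2.add (he (e a))
  rw [zero_add] at h3
  refine h3.congr fun k => ?_
  rw [map_sub, sub_add_cancel, pow_add]
  generalize z ^ k = w
  rfl

include hN in
/-- Absolute continuity on projections of a commutative von Neumann algebra implies a quantitative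
form of absolute continuity. -/
theorem exists_pos_forall_le_of_absCont {u₁ v₁ u₂ v₂ : Amp ℕ H}
    (h₁ : IsStateOn N (vecFunctional u₁ v₁)) (h₂ : IsStateOn N (vecFunctional u₂ v₂))
    (hac : ∀ p ∈ N, IsStarProjection p → vecFunctional u₂ v₂ p = 0 → vecFunctional u₁ v₁ p = 0)
    {ε : ℝ} (hε : 0 < ε) : ∃ η > 0, ∀ a ∈ N, 0 ≤ a → a ≤ 1 →
      (vecFunctional u₂ v₂ a).re ≤ η → (vecFunctional u₁ v₁ a).re ≤ ε := by
  by_contra! hcon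
  choose a ha ha0 ha1 h2a h1a using fun n : ℕ => hcon ((1 / 2) ^ n) (by positivity)
  set φ₁ := vecFunctional u₁ v₁ with hφ₁
  set φ₂ := vecFunctional u₂ v₂ with hφ₂
  -- With `a k` read as an event, a product of the `c k` is the complement of a union. The infinite
  -- product `x K` below is the event that nothing occurs from index `K` on.
  let c : ℕ → H →L[ℂ] H := fun k => 1 - a k
  have hc : ∀ k, c k ∈ N := fun k => sub_mem (one_mem N) (ha k)
  have hc0 : ∀ k, 0 ≤ c k := fun k => sub_nonneg.2 (ha1 k)
  have hc1 : ∀ k, c k ≤ 1 := fun k => sub_le_self _ (ha0 k)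
  have spec := intervalProd_spec hN hc hc0 hc1
  have nrm : ∀ {x : H →L[ℂ] H}, 0 ≤ x → x ≤ 1 → ‖x‖ ≤ 1 := fun h0 h1 =>
    (CStarAlgebra.norm_le_one_iff_of_nonneg _ h0).2 h1
  have lim : ∀ (u v : Amp ℕ H) {b : ℕ → H →L[ℂ] H} {x : H →L[ℂ] H}, (∀ k, 0 ≤ b k) →
      (∀ k, b k ≤ 1) → (∀ y, Tendsto (fun k => b k y) atTop (𝓝 (x y))) →
      Tendsto (fun k => (vecFunctional u v (b k)).re) atTop (𝓝 (vecFunctional u v x).re) :=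
    fun u v b x hb0 hb1 hb => (Complex.continuous_re.tendsto _).comp
      (tendsto_vecFunctional u v (fun k => nrm (hb0 k) (hb1 k)) hb)
  have hsmall : ∀ m K, (φ₂ (1 - intervalProd c m K)).re ≤ 2 * (1 / 2) ^ K := by
    intro m
    induction m with
    | zero => intro K; simp [intervalProd]
    | succ m ih =>
      intro K
      have e1 := re_one_sub_mul_le hN h₂ (hc K) (spec m (K + 1)).1 (hc1 K) (spec m (K + 1)).2.2.1
      have e2 := ih (K + 1)
      have e3 : (φ₂ (1 - c K)).re ≤ (1 / 2) ^ K := by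
        simpa only [c, sub_sub_cancel] using h2a K
      rw [pow_succ] at e2
      change (φ₂ (1 - c K * intervalProd c m (K + 1))).re ≤ _
      linarith
  choose x hx using fun K => exists_strong_limit (b := fun m => intervalProd c m K)
    (fun m => (spec m K).2.1) (fun m => (spec m K).2.2.1)
    (antitone_nat_of_succ_le fun m => (spec m K).2.2.2.1)
  have hxN : ∀ K, x K ∈ N := fun K => strong_limit_mem (fun m => (spec m K).1) (hx K)
  have hx0 : ∀ K, 0 ≤ x K := fun K => isClosed_nonneg_strong (fun m => (spec m K).2.1) (hx K)
  have hx1 : ∀ K, x K ≤ 1 := fun K => strong_limit_le (fun m => (spec m K).2.2.1) (hx K)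
  have hxa : ∀ K, x K ≤ c K := fun K => strong_limit_le (fun m => (spec m K).2.2.2.2.2)
    (fun y => (hx K y).comp (tendsto_add_atTop_nat 1))
  have hxmono : ∀ K, x K ≤ x (K + 1) := by
    intro K
    rw [← sub_nonneg]
    refine isClosed_nonneg_strong
      (b := fun m => intervalProd c m (K + 1) - intervalProd c (m + 1) K)
      (fun m => sub_nonneg.2 (spec m K).2.2.2.2.1) fun y => (hx (K + 1) y).sub ?_
    exact (hx K y).comp (tendsto_add_atTop_nat 1)
  have hφx : ∀ K, (φ₂ (1 - x K)).re ≤ 2 * (1 / 2) ^ K := by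
    intro K
    have e1 := lim u₂ v₂ (fun m => (spec m K).2.1) (fun m => (spec m K).2.2.1) (hx K)
    have e2 : Tendsto (fun m => (φ₂ (1 - intervalProd c m K)).re) atTop (𝓝 (φ₂ (1 - x K)).re) := by
      simp only [map_sub, Complex.sub_re]
      exact tendsto_const_nhds.sub e1
    exact le_of_tendsto' e2 fun m => hsmall m K
  have hφx1 : ∀ K, ε ≤ (φ₁ (1 - x K)).re := by
    intro K
    refine (h1a K).le.trans (h₁.re_mono (ha K) (sub_mem (one_mem N) (hxN K)) ?_)
    have := hxa K
    exact le_sub_comm.1 this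
  have hy_anti : Antitone fun K => 1 - x K :=
    antitone_nat_of_succ_le fun K => sub_le_sub_left (hxmono K) 1
  have hy0 : ∀ K, 0 ≤ 1 - x K := fun K => sub_nonneg.2 (hx1 K)
  have hy1 : ∀ K, 1 - x K ≤ 1 := fun K => sub_le_self _ (hx0 K)
  -- The analogue of the limit superior of the `a k`: `φ₂` gives it mass zero, while `φ₁` gives it
  -- mass at least `ε`.
  obtain ⟨y, hy⟩ := exists_strong_limit hy0 hy1 hy_anti
  have hyN : y ∈ N := strong_limit_mem (fun K => sub_mem (one_mem N) (hxN K)) hy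
  have hyy0 : 0 ≤ y := isClosed_nonneg_strong hy0 hy
  have hyy1 : y ≤ 1 := strong_limit_le hy1 hy
  have hφy : (φ₂ y).re ≤ 0 := by
    have e1 : Tendsto (fun K : ℕ => 2 * (1 / 2 : ℝ) ^ K) atTop (𝓝 (2 * 0)) :=
      (tendsto_pow_atTop_nhds_zero_of_lt_one (by norm_num) (by norm_num)).const_mul 2
    rw [mul_zero] at e1
    exact le_of_tendsto_of_tendsto' (lim u₂ v₂ hy0 hy1 hy) e1 hφx
  have hφy1 : ε ≤ (φ₁ y).re := ge_of_tendsto' (lim u₁ v₁ hy0 hy1 hy) hφx1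
  have hzN : 1 - y ∈ N := sub_mem (one_mem N) hyN
  have hz0 : 0 ≤ 1 - y := sub_nonneg.2 hyy1
  have hz1 : 1 - y ≤ 1 := sub_le_self _ hyy0
  -- Here `1 - e` is the support projection of `y`. It dominates `y` and, by the union bound applied
  -- to the powers of `1 - y`, is still `φ₂`-null; this contradicts `hac`.
  obtain ⟨e, heN, hep, he⟩ := exists_limit_pow hzN hz0 hz1
  have hpow1 : ∀ k : ℕ, (1 - y) ^ k ≤ 1 := fun k => by
    simpa using CStarAlgebra.pow_antitone hz0 hz1 (Nat.zero_le k)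
  have hpow : ∀ k : ℕ, (φ₂ (1 - (1 - y) ^ k)).re ≤ 0 := by
    intro k
    induction k with
    | zero => simp
    | succ k ih =>
      have e1 := re_one_sub_mul_le hN h₂ (pow_mem hzN k) hzN (hpow1 k) hz1
      rw [sub_sub_cancel] at e1
      rw [pow_succ]
      linarith
  have hpe : (φ₂ (1 - e)).re ≤ 0 := by
    have e1 := lim u₂ v₂ (fun k => CStarAlgebra.pow_nonneg hz0 k) hpow1 he
    have e2 : Tendsto (fun k => (φ₂ (1 - (1 - y) ^ k)).re) atTop (𝓝 (φ₂ (1 - e)).re) := by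
      simp only [map_sub, Complex.sub_re] at e1 ⊢
      exact tendsto_const_nhds.sub e1
    exact le_of_tendsto' e2 hpow
  have hp : IsStarProjection (1 - e) := hep.one_sub
  have hpN : 1 - e ∈ N := sub_mem (one_mem N) heN
  have hp0 : 0 ≤ 1 - e := hp.nonneg
  have hφp : φ₂ (1 - e) = 0 :=
    Complex.ext (le_antisymm hpe (h₂.re_nonneg hpN hp0)) (h₂.im_eq_zero hpN hp0)
  have h3 := hac _ hpN hp hφp
  have hle : y ≤ 1 - e := by
    have e4 : e ≤ 1 - y := strong_limit_le
      (fun k => by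
        have := CStarAlgebra.pow_antitone hz0 hz1 (Nat.le_add_left 1 k)
        simpa only [pow_one] using this) (fun v => (he v).comp (tendsto_add_atTop_nat 1))
    exact le_sub_comm.1 e4
  have h4 := h₁.re_mono hyN hpN hle
  rw [h3, Complex.zero_re] at h4
  linarith

end

end AbsoluteContinuity

/-! ### Nearly optimal quadratic tests and an approximate Radon-Nikodym theorem. -/

section RadonNikodym

variable {H : Type*} [NormedAddCommGroup H] [InnerProductSpace ℂ H] [CompleteSpace H]

/-- The union of an increasing family of von Neumann algebras. -/
def unionSubmodule {ι : Type*} [LinearOrder ι] [Nonempty ι] {F : ι → VonNeumannAlgebra H}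
    (hF : Monotone F) : Submodule ℂ (H →L[ℂ] H) where
  carrier := {x | ∃ t, x ∈ F t}
  zero_mem' := ⟨Classical.arbitrary ι, zero_mem _⟩
  add_mem' := by
    rintro x y ⟨s, hs⟩ ⟨t, ht⟩
    exact ⟨max s t, add_mem (hF (le_max_left s t) hs) (hF (le_max_right s t) ht)⟩
  smul_mem' := by
    rintro c x ⟨s, hs⟩
    exact ⟨s, smul_mem_vn _ c hs⟩

theorem exists_seq_union {ι : Type*} [LinearOrder ι] [Nonempty ι] {F : ι → VonNeumannAlgebra H}
    (hF : Monotone F) {x : H →L[ℂ] H}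
    (hx : ∀ y, (∀ t, ∀ g ∈ F t, g * y = y * g) → x * y = y * x)
    {κ : Type*} [Finite κ] (w : κ → Amp ℕ H) :
    ∃ s : ℕ → H →L[ℂ] H, (∀ k, ∃ t, s k ∈ F t) ∧
      ∀ i, Tendsto (fun k => amplify ℕ (s k) (w i)) atTop (𝓝 (amplify ℕ x (w i))) := by
  refine exists_seq_tendsto_amplify (S := unionSubmodule hF) (G := {g | ∃ t, g ∈ F t})
    ⟨Classical.arbitrary ι, one_mem _⟩ ?_ ?_ ?_ w
  · rintro g ⟨t, ht⟩
    exact ⟨t, star_mem ht⟩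
  · rintro g ⟨t, ht⟩ s ⟨t', ht'⟩
    exact ⟨max t t', mul_mem (hF (le_max_left t t') ht) (hF (le_max_right t t') ht')⟩
  · exact fun y hy => hx y fun t g hg => hy g ⟨t, hg⟩

section

variable {N : VonNeumannAlgebra H} (hN : ∀ B ∈ N, ∀ C ∈ N, B * C = C * B)

/-- The mean squared error of `k` as a test between the states `φ₁` and `φ₂`. -/
def testError (φ₁ φ₂ : (H →L[ℂ] H) →ₗ[ℂ] ℂ) (k : H →L[ℂ] H) : ℝ :=
  (φ₂ (star k * k)).re + (φ₁ (star (1 - k) * (1 - k))).re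

theorem testError_nonneg {φ₁ φ₂ : (H →L[ℂ] H) →ₗ[ℂ] ℂ} (h₁ : IsStateOn N φ₁)
    (h₂ : IsStateOn N φ₂) {k : H →L[ℂ] H} (hk : k ∈ N) : 0 ≤ testError φ₁ φ₂ k :=
  add_nonneg (Complex.le_def.1 (h₂.nonneg k hk)).1
    (Complex.le_def.1 (h₁.nonneg _ (sub_mem (one_mem N) hk))).1

include hN in
-- By commutativity `s` is normal, so `star s * s` is the sum of the squares of its real and
-- imaginary parts; the second square is dropped.
theorem re_star_mul_self_realPart_le {φ : (H →L[ℂ] H) →ₗ[ℂ] ℂ} (h : IsStateOn N φ)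
    {s : H →L[ℂ] H} (hs : s ∈ N) :
    (φ (star ((1 / 2 : ℂ) • (s + star s)) * ((1 / 2 : ℂ) • (s + star s)))).re ≤
      (φ (star s * s)).re := by
  have h1 := (Complex.le_def.1 (h.nonneg (s - star s) (sub_mem hs (star_mem hs)))).1
  have h2 : star s * s = s * star s := hN _ (star_mem hs) _ hs
  have e1 : star (s - star s) * (s - star s) =
      (2 : ℂ) • (star s * s) - (star s * star s + s * s) := by
    rw [star_sub, star_star, sub_mul, mul_sub, mul_sub, ← h2, two_smul]
    abel
  have e2 : star ((1 / 2 : ℂ) • (s + star s)) * ((1 / 2 : ℂ) • (s + star s)) =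
      (1 / 4 : ℂ) • ((2 : ℂ) • (star s * s) + (star s * star s + s * s)) := by
    rw [star_smul, star_add, star_star, smul_mul_assoc, mul_smul_comm, smul_smul, add_mul, mul_add,
      mul_add, ← h2, two_smul]
    congr 1
    · rw [Complex.star_def, map_div₀, map_one, map_ofNat]; norm_num
    · abel
  rw [e2]
  rw [e1] at h1
  simp only [map_sub, map_add, map_smul, smul_eq_mul, Complex.sub_re, Complex.add_re,
    Complex.mul_re, Complex.re_ofNat, Complex.im_ofNat, zero_mul, sub_zero, Complex.zero_re] at h1 ⊢
  have e3 : (1 / 4 : ℂ).re = 1 / 4 := by norm_num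
  have e4 : (1 / 4 : ℂ).im = 0 := by norm_num
  rw [e3, e4]
  linarith

include hN in
theorem testError_realPart_le {φ₁ φ₂ : (H →L[ℂ] H) →ₗ[ℂ] ℂ} (h₁ : IsStateOn N φ₁)
    (h₂ : IsStateOn N φ₂) {s : H →L[ℂ] H} (hs : s ∈ N) :
    testError φ₁ φ₂ ((1 / 2 : ℂ) • (s + star s)) ≤ testError φ₁ φ₂ s := by
  have e : 1 - (1 / 2 : ℂ) • (s + star s) = (1 / 2 : ℂ) • ((1 - s) + star (1 - s)) := by
    have : (1 : H →L[ℂ] H) = (1 / 2 : ℂ) • (1 + 1) := by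
      rw [← two_smul ℂ (1 : H →L[ℂ] H), smul_smul]; norm_num
    conv_lhs => rw [this]
    rw [← smul_sub, star_sub, star_one]
    congr 1
    abel
  unfold testError
  rw [e]
  exact add_le_add (re_star_mul_self_realPart_le hN h₂ hs)
    (re_star_mul_self_realPart_le hN h₁ (sub_mem (one_mem N) hs))

/-- Clipping to the unit interval decreases both `x²` and `(1 - x)²` pointwise on the spectrum. -/
theorem testError_truncate_le {φ₁ φ₂ : (H →L[ℂ] H) →ₗ[ℂ] ℂ} (h₁ : IsStateOn N φ₁)
    (h₂ : IsStateOn N φ₂) {h : H →L[ℂ] H} (hh : h ∈ N) (hsa : IsSelfAdjoint h) :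
    testError φ₁ φ₂ (cfc (fun x : ℝ => max 0 (min x 1)) h) ≤ testError φ₁ φ₂ h := by
  have htr : IsSelfAdjoint (cfc (fun x : ℝ => max 0 (min x 1)) h) := cfc_predicate _ _
  have htN := cfc_mem_vn hh (fun x : ℝ => max 0 (min x 1))
  unfold testError
  rw [star_sub, star_one, htr.star_eq, star_sub, star_one, hsa.star_eq]
  refine add_le_add (h₂.re_mono (mul_mem htN htN) (mul_mem hh hh) ?_)
    (h₁.re_mono (mul_mem (sub_mem (one_mem N) htN) (sub_mem (one_mem N) htN))
      (mul_mem (sub_mem (one_mem N) hh) (sub_mem (one_mem N) hh)) ?_)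
  · rw [← cfc_mul (fun x : ℝ => max 0 (min x 1)) (fun x : ℝ => max 0 (min x 1)) h]
    conv_rhs => rw [← cfc_id' ℝ h, ← cfc_mul (fun x : ℝ => x) (fun x : ℝ => x) h]
    refine cfc_mono fun x _ => ?_
    rcases le_total x 0 with hx | hx
    · rw [max_eq_left ((min_le_left _ _).trans hx)]; nlinarith
    · rcases le_total x 1 with hx1 | hx1
      · rw [min_eq_left hx1, max_eq_right hx]
      · rw [min_eq_right hx1, max_eq_right zero_le_one]; nlinarith
  · have e1 : (1 : H →L[ℂ] H) - cfc (fun x : ℝ => max 0 (min x 1)) h =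
        cfc (fun x : ℝ => 1 - max 0 (min x 1)) h := by
      rw [cfc_sub (fun _ : ℝ => (1 : ℝ)) (fun x : ℝ => max 0 (min x 1)) h, cfc_const_one ℝ h]
    have e2 : (1 : H →L[ℂ] H) - h = cfc (fun x : ℝ => 1 - x) h := by
      rw [cfc_sub (fun _ : ℝ => (1 : ℝ)) (fun x : ℝ => x) h, cfc_const_one ℝ h, cfc_id' ℝ h]
    rw [e1, e2, ← cfc_mul .., ← cfc_mul ..]
    refine cfc_mono fun x _ => ?_
    rcases le_total x 0 with hx | hx
    · rw [max_eq_left ((min_le_left _ _).trans hx)]; nlinarith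
    · rcases le_total x 1 with hx1 | hx1
      · rw [min_eq_left hx1, max_eq_right hx]
      · rw [min_eq_right hx1, max_eq_right zero_le_one]; nlinarith

include hN in
-- The coefficient of `r` is the first variation. Its vanishing in every direction characterizes the
-- optimal test, formally `k = dφ₁ / d(φ₁ + φ₂)`.
theorem testError_add {φ₁ φ₂ : (H →L[ℂ] H) →ₗ[ℂ] ℂ} {k W : H →L[ℂ] H} (hk : k ∈ N) (hW : W ∈ N)
    (hks : IsSelfAdjoint k) (hWs : IsSelfAdjoint W) (r : ℝ) :
    testError φ₁ φ₂ (k + (r : ℂ) • W) = testError φ₁ φ₂ k +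
      2 * r * (φ₂ (k * W) - φ₁ ((1 - k) * W)).re + r ^ 2 * ((φ₂ (W * W)).re + (φ₁ (W * W)).re) := by
  have hkW : W * k = k * W := hN _ hW _ hk
  have e1 : star (k + (r : ℂ) • W) * (k + (r : ℂ) • W) =
      k * k + (2 * r : ℂ) • (k * W) + (r ^ 2 : ℂ) • (W * W) := by
    rw [star_add, star_smul, hks.star_eq, hWs.star_eq, Complex.star_def, Complex.conj_ofReal,
      add_mul, mul_add, mul_add, smul_mul_assoc, mul_smul_comm, smul_mul_assoc, mul_smul_comm, hkW,
      smul_smul, ← sq (r : ℂ), mul_smul, two_smul ℂ]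
    abel
  have e2 : star (1 - (k + (r : ℂ) • W)) * (1 - (k + (r : ℂ) • W)) =
      (1 - k) * (1 - k) - (2 * r : ℂ) • ((1 - k) * W) + (r ^ 2 : ℂ) • (W * W) := by
    have h1 : W * (1 - k) = (1 - k) * W := hN _ hW _ (sub_mem (one_mem N) hk)
    rw [← sub_sub, star_sub (1 - k), star_smul, star_sub, star_one, hks.star_eq, hWs.star_eq,
      Complex.star_def, Complex.conj_ofReal, sub_mul (1 - k), mul_sub _ (1 - k), mul_sub _ (1 - k),
      smul_mul_assoc, mul_smul_comm, smul_mul_assoc, mul_smul_comm, h1,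
      smul_smul, ← sq (r : ℂ), mul_smul, two_smul ℂ]
    abel
  unfold testError
  rw [e1, e2, star_sub, star_one, hks.star_eq]
  simp only [map_sub, map_add, map_smul, smul_eq_mul, Complex.sub_re, Complex.add_re]
  have a1 : ∀ z : ℂ, ((2 * r : ℂ) * z).re = 2 * r * z.re := fun z => by
    rw [← Complex.re_ofReal_mul]; push_cast; rfl
  have a2 : ∀ z : ℂ, ((r ^ 2 : ℂ) * z).re = r ^ 2 * z.re := fun z => by
    rw [← Complex.re_ofReal_mul]; push_cast; rfl
  simp only [a1, a2]
  ring

/-- A functional which is small on self-adjoint elements is small. -/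
theorem norm_le_of_isSelfAdjoint {β : (H →L[ℂ] H) →ₗ[ℂ] ℂ} {ε : ℝ} (hε : 0 ≤ ε)
    (h : ∀ W ∈ N, IsSelfAdjoint W → ‖β W‖ ≤ ε * ‖W‖) {W : H →L[ℂ] H} (hW : W ∈ N) :
    ‖β W‖ ≤ 2 * ε * ‖W‖ := by
  let a : H →L[ℂ] H := (1 / 2 : ℂ) • (W + star W)
  let b : H →L[ℂ] H := (-Complex.I / 2 : ℂ) • (W - star W)
  have hab : W = a + Complex.I • b := by
    have h1 : Complex.I * (-Complex.I / 2) = 1 / 2 := by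
      rw [mul_div_assoc', mul_neg, Complex.I_mul_I, neg_neg]
    simp only [a, b]
    rw [smul_smul, h1, ← smul_add, add_add_sub_cancel, ← two_smul ℂ W, smul_smul]
    norm_num
  have ha : IsSelfAdjoint a := by
    rw [isSelfAdjoint_iff, star_smul, star_add, star_star, add_comm]
    simp [a]
  have hb : IsSelfAdjoint b := by
    rw [isSelfAdjoint_iff, star_smul, star_sub, star_star, ← neg_sub W (star W), smul_neg,
      ← neg_smul]
    simp only [b]
    congr 1
    simp [neg_div]
  have haN : a ∈ N := smul_mem_vn N _ (add_mem hW (star_mem hW))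
  have hbN : b ∈ N := smul_mem_vn N _ (sub_mem hW (star_mem hW))
  have hna : ‖a‖ ≤ ‖W‖ := by
    refine (norm_smul_le _ _).trans ?_
    have := norm_add_le W (star W)
    rw [norm_star] at this
    norm_num
    linarith
  have hnb : ‖b‖ ≤ ‖W‖ := by
    refine (norm_smul_le _ _).trans ?_
    have := norm_sub_le W (star W)
    rw [norm_star] at this
    norm_num
    linarith
  have key : ∀ c ∈ N, IsSelfAdjoint c → ‖c‖ ≤ ‖W‖ → ‖β c‖ ≤ ε * ‖W‖ := by
    intro c hc hcs hcn
    exact (h c hc hcs).trans (by gcongr)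
  calc ‖β W‖ = ‖β a + Complex.I * β b‖ := by
        conv_lhs => rw [hab]
        rw [map_add, map_smul β Complex.I b, smul_eq_mul]
    _ ≤ ‖β a‖ + ‖β b‖ := (norm_add_le _ _).trans (by rw [norm_mul, Complex.norm_I, one_mul])
    _ ≤ ε * ‖W‖ + ε * ‖W‖ := add_le_add (key a haN ha hna) (key b hbN hb hnb)
    _ = 2 * ε * ‖W‖ := by ring

/-- The element `a = δ / (1 - k + δ)`. -/
theorem exists_cfc_one_sub_mul {k : H →L[ℂ] H} (hk0 : 0 ≤ k) (hk1 : k ≤ 1) {δ : ℝ} (hδ : 0 < δ) :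
    ∃ f : ℝ → ℝ, 0 ≤ cfc f k ∧ cfc f k ≤ 1 ∧ (1 - k) * cfc f k = (δ : ℂ) • (1 - cfc f k) := by
  have hks : IsSelfAdjoint k := .of_nonneg hk0
  have hspec : ∀ x ∈ spectrum ℝ k, x ≤ 1 := fun x hx => by
    have := (cfc_le_one_iff (fun x : ℝ => x) k (by fun_prop) hks).1 (by rwa [cfc_id' ℝ k])
    exact this x hx
  have hpos : ∀ x : ℝ, 0 < max (1 - x) 0 + δ := fun x => by positivity
  -- The maximum is inactive on the spectrum of `k`; it makes `f` continuous on the whole line.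
  let f : ℝ → ℝ := fun x => δ / (max (1 - x) 0 + δ)
  have hf : Continuous f := by
    refine Continuous.div (by fun_prop) (by fun_prop) fun x => (hpos x).ne'
  refine ⟨f, cfc_nonneg fun x _ => by have := hpos x; positivity, cfc_le_one _ _ fun x _ => by
    rw [div_le_one (hpos x)]
    linarith [le_max_right (1 - x) 0], ?_⟩
  have e1 : (1 : H →L[ℂ] H) - k = cfc (fun x : ℝ => 1 - x) k := by
    rw [cfc_sub (fun _ : ℝ => (1 : ℝ)) (fun x : ℝ => x) k, cfc_const_one ℝ k, cfc_id' ℝ k]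
  have e2 : (1 : H →L[ℂ] H) - cfc f k = cfc (fun x : ℝ => 1 - f x) k := by
    rw [cfc_sub (fun _ : ℝ => (1 : ℝ)) f k, cfc_const_one ℝ k]
  rw [Complex.coe_smul, e1, e2, ← cfc_mul (fun x : ℝ => 1 - x) f k,
    ← cfc_smul δ (fun x : ℝ => 1 - f x) k]
  refine cfc_congr fun x hx => ?_
  have hx1 : max (1 - x) 0 = 1 - x := max_eq_left (sub_nonneg.2 (hspec x hx))
  have hp := hpos x
  simp only [f, smul_eq_mul]
  rw [hx1] at hp ⊢
  field_simp
  ring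

section

variable {ι : Type*} [LinearOrder ι] [Nonempty ι] {F : ι → VonNeumannAlgebra H} (hF : Monotone F)
  (hFN : ∀ t, F t ≤ N)
  (hgen : ∀ x ∈ N, ∀ y, (∀ t, ∀ g ∈ F t, g * y = y * g) → x * y = y * x)
  {u₁ v₁ u₂ v₂ : Amp ℕ H}
  (h₁ : IsStateOn N (vecFunctional u₁ v₁)) (h₂ : IsStateOn N (vecFunctional u₂ v₂))

include hF hgen in
-- The error depends only on the action of the amplified operator on four vectors, so the double
-- commutant theorem approximates it from the union of the algebras.
theorem exists_testError_lt {x : H →L[ℂ] H} (hx : x ∈ N) {c : ℝ}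
    (hc : testError (vecFunctional u₁ v₁) (vecFunctional u₂ v₂) x < c) :
    ∃ t, ∃ s ∈ F t, testError (vecFunctional u₁ v₁) (vecFunctional u₂ v₂) s < c := by
  obtain ⟨s, hs, hlim⟩ := exists_seq_union hF (hgen x hx) ![u₁, v₁, u₂, v₂]
  have hu₁ := hlim 0
  have hv₁ := hlim 1
  have hu₂ := hlim 2
  have hv₂ := hlim 3
  simp only [Matrix.cons_val] at hu₁ hv₁ hu₂ hv₂
  have sub : ∀ (y : H →L[ℂ] H) (u : Amp ℕ H), amplify ℕ (1 - y) u = u - amplify ℕ y u :=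
    fun y u => by rw [amplify_sub]; rfl
  have h : Tendsto (fun k => testError (vecFunctional u₁ v₁) (vecFunctional u₂ v₂) (s k)) atTop
      (𝓝 (testError (vecFunctional u₁ v₁) (vecFunctional u₂ v₂) x)) := by
    unfold testError
    simp only [vecFunctional_star_mul, sub]
    exact ((Complex.continuous_re.tendsto _).comp (hu₂.inner hv₂)).add
      ((Complex.continuous_re.tendsto _).comp
        ((tendsto_const_nhds.sub hu₁).inner (tendsto_const_nhds.sub hv₁)))
  obtain ⟨k, hk⟩ := (h.eventually_lt_const hc).exists
  obtain ⟨t, ht⟩ := hs k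
  exact ⟨t, s k, ht, hk⟩

include hN hF hFN hgen h₁ h₂ in
/-- Nearly optimal tests between two normal states are found in the union of the algebras, and
they nearly satisfy the equation of the optimal test. -/
theorem exists_test {ε : ℝ} (hε : 0 < ε) : ∃ t, ∃ k ∈ F t, 0 ≤ k ∧ k ≤ 1 ∧ ∀ W ∈ N,
    ‖vecFunctional u₂ v₂ (k * W) - vecFunctional u₁ v₁ ((1 - k) * W)‖ ≤ ε * ‖W‖ := by
  set φ₁ := vecFunctional u₁ v₁ with hφ₁
  set φ₂ := vecFunctional u₂ v₂ with hφ₂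
  -- A test within `δ²` of the infimum has first variation at most `3δ/2` in self-adjoint directions
  -- of norm at most one; the factor 2 pays for splitting a general `W` into two self-adjoint parts.
  obtain ⟨δ, hδ, rfl⟩ : ∃ δ : ℝ, 0 < δ ∧ ε = 2 * (3 / 2 * δ) := ⟨ε / 3, by positivity, by ring⟩
  let I : ℝ := sInf {r | ∃ x ∈ N, r = testError φ₁ φ₂ x}
  have hbdd : BddBelow {r | ∃ x ∈ N, r = testError φ₁ φ₂ x} := ⟨0, by
    rintro _ ⟨x, hx, rfl⟩
    exact testError_nonneg h₁ h₂ hx⟩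
  have hI : ∀ x ∈ N, I ≤ testError φ₁ φ₂ x := fun x hx => csInf_le hbdd ⟨x, hx, rfl⟩
  obtain ⟨_, ⟨x, hx, rfl⟩, hxI⟩ := exists_lt_of_csInf_lt
    (⟨_, 0, zero_mem N, rfl⟩ : {r | ∃ x ∈ N, r = testError φ₁ φ₂ x}.Nonempty)
    (show I < I + δ ^ 2 by have : 0 < δ ^ 2 := by positivity
                           linarith)
  obtain ⟨t, s, hs, hsI⟩ := exists_testError_lt hF hgen hx hxI
  have hsN := hFN t hs
  let h : H →L[ℂ] H := (1 / 2 : ℂ) • (s + star s)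
  have hhF : h ∈ F t := smul_mem_vn _ _ (add_mem hs (star_mem hs))
  have hsa : IsSelfAdjoint h := by
    rw [isSelfAdjoint_iff, star_smul, star_add, star_star, add_comm]
    simp [h]
  let k : H →L[ℂ] H := cfc (fun x : ℝ => max 0 (min x 1)) h
  have hkF : k ∈ F t := cfc_mem_vn hhF _
  have hkN : k ∈ N := hFN t hkF
  have hk0 : 0 ≤ k := cfc_nonneg fun _ _ => le_max_left _ _
  have hk1 : k ≤ 1 := cfc_le_one _ _ fun _ _ => max_le zero_le_one (min_le_right _ _)
  have hkI : testError φ₁ φ₂ k ≤ I + δ ^ 2 :=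
    ((testError_truncate_le h₁ h₂ (hFN t hhF) hsa).trans (testError_realPart_le hN h₁ h₂ hsN)).trans
      hsI.le
  have hks : IsSelfAdjoint k := IsSelfAdjoint.of_nonneg hk0
  refine ⟨t, k, hkF, hk0, hk1, ?_⟩
  let β : (H →L[ℂ] H) →ₗ[ℂ] ℂ := φ₂ ∘ₗ LinearMap.mulLeft ℂ k - φ₁ ∘ₗ LinearMap.mulLeft ℂ (1 - k)
  have hβ : ∀ W, β W = φ₂ (k * W) - φ₁ ((1 - k) * W) := fun W => rfl
  have hprod : ∀ {a b : H →L[ℂ] H}, a ∈ N → b ∈ N → IsSelfAdjoint a → IsSelfAdjoint b →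
      IsSelfAdjoint (a * b) := fun ha hb hsa hsb => by
    rw [isSelfAdjoint_iff, star_mul, hsa.star_eq, hsb.star_eq, hN _ hb _ ha]
  have unit : ∀ W ∈ N, IsSelfAdjoint W → ‖W‖ ≤ 1 → |(β W).re| ≤ 3 / 2 * δ := by
    intro W hW hWs hW1
    have hsq : (φ₂ (W * W)).re + (φ₁ (W * W)).re ≤ 2 := by
      have e1 := h₁.re_star_mul_self_le hW
      have e2 := h₂.re_star_mul_self_le hW
      rw [hWs.star_eq] at e1 e2
      nlinarith [norm_nonneg W]
    -- Near-minimality of `k` against the competitor `k + r W`; the choices `r = ±δ` bound the first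
    -- variation.
    have pert : ∀ r : ℝ, I ≤ I + δ ^ 2 + 2 * r * (β W).re + r ^ 2 * 2 := by
      intro r
      have e1 := hI (k + (r : ℂ) • W) (add_mem hkN (smul_mem_vn N _ hW))
      rw [testError_add hN hkN hW hks hWs] at e1
      have e2 : r ^ 2 * ((φ₂ (W * W)).re + (φ₁ (W * W)).re) ≤ r ^ 2 * 2 := by gcongr
      rw [hβ]
      linarith
    have p1 := pert δ
    have p2 := pert (-δ)
    rw [abs_le]
    constructor <;> nlinarith
  have sa : ∀ W ∈ N, IsSelfAdjoint W → ‖β W‖ ≤ 3 / 2 * δ * ‖W‖ := by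
    intro W hW hWs
    have him : (β W).im = 0 := by
      rw [hβ, Complex.sub_im, h₂.im_eq_zero_of_isSelfAdjoint (mul_mem hkN hW) (hprod hkN hW hks hWs),
        h₁.im_eq_zero_of_isSelfAdjoint (mul_mem (sub_mem (one_mem N) hkN) hW)
          (hprod (sub_mem (one_mem N) hkN) hW ((IsSelfAdjoint.one _).sub hks) hWs), sub_zero]
    have hre : ‖β W‖ = |(β W).re| := by
      have : β W = ((β W).re : ℂ) := Complex.ext (by simp) (by simp [him])
      conv_lhs => rw [this]
      exact Complex.norm_real _
    rw [hre]
    by_cases hW0 : W = 0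
    · subst hW0; simp
    have hWpos : 0 < ‖W‖ := norm_pos_iff.2 hW0
    have e1 := unit (((‖W‖⁻¹ : ℝ) : ℂ) • W) (smul_mem_vn N _ hW)
      (by rw [isSelfAdjoint_iff, star_smul, hWs.star_eq, Complex.star_def, Complex.conj_ofReal])
      (by rw [norm_smul, Complex.norm_real, norm_inv, norm_norm, inv_mul_cancel₀ hWpos.ne'])
    rw [map_smul, smul_eq_mul, Complex.re_ofReal_mul, abs_mul, abs_of_pos (inv_pos.2 hWpos),
      inv_mul_le_iff₀ hWpos] at e1
    linarith
  exact fun W hW => norm_le_of_isSelfAdjoint (β := β) (by positivity) sa hW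

include hN hF hFN hgen h₁ h₂ in
/-- An approximate Radon-Nikodym theorem: if `φ₁` is absolutely continuous with respect to `φ₂` on
the commutative von Neumann algebra generated by an increasing family of algebras, then the
restriction of `φ₁` is norm-close to `W ↦ φ₂ (D * W)` for some `D` in one of these algebras. -/
theorem exists_density
    (hac : ∀ p ∈ N, IsStarProjection p → vecFunctional u₂ v₂ p = 0 → vecFunctional u₁ v₁ p = 0)
    {ε : ℝ} (hε : 0 < ε) : ∃ t, ∃ D ∈ F t, ∀ W ∈ N,
    ‖vecFunctional u₁ v₁ W - vecFunctional u₂ v₂ (D * W)‖ ≤ ε * ‖W‖ := by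
  obtain ⟨η, hη, hAC⟩ := exists_pos_forall_le_of_absCont hN h₁ h₂ hac
    (show 0 < (ε / 2) ^ 2 by positivity)
  set φ₁ := vecFunctional u₁ v₁ with hφ₁
  set φ₂ := vecFunctional u₂ v₂ with hφ₂
  let δ : ℝ := η / 4
  have hδ : 0 < δ := by positivity
  let ε' : ℝ := min (η / 4) (δ * (ε / 2))
  have hε' : 0 < ε' := by positivity
  obtain ⟨t, k, hkF, hk0, hk1, hβ⟩ := exists_test hN hF hFN hgen h₁ h₂ hε'
  have hkN := hFN t hkF
  obtain ⟨f, ha0, ha1, hka⟩ := exists_cfc_one_sub_mul hk0 hk1 hδ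
  set a : H →L[ℂ] H := cfc f k with ha_def
  have haF : a ∈ F t := cfc_mem_vn hkF _
  have haN := hFN t haF
  have hna : ‖a‖ ≤ 1 := (CStarAlgebra.norm_le_one_iff_of_nonneg _ ha0).2 ha1
  -- The element `a` is large only where `k` is near 1, that is, where `φ₂` is negligible against
  -- `φ₁`. The test equation gives `φ₂ a ≤ 2δ + ε' ≤ 3η/4`.
  have h2a : (φ₂ a).re ≤ η := by
    have e1 : φ₂ a = φ₂ (k * a) + δ * φ₂ (1 - a) := by
      have e0 := congrArg φ₂ hka
      rw [map_smul, smul_eq_mul] at e0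
      rw [← e0, ← map_add, ← add_mul, add_sub_cancel, one_mul]
    have e2 := (Complex.re_le_norm _).trans (hβ a haN)
    rw [hka, map_smul, smul_eq_mul, Complex.sub_re, Complex.re_ofReal_mul] at e2
    have e3 := h₁.re_nonneg haN ha0
    have e4 := h₂.re_nonneg haN ha0
    have o1 : ∀ {φ : (H →L[ℂ] H) →ₗ[ℂ] ℂ}, IsStateOn N φ → (φ (1 - a)).re = 1 - (φ a).re :=
      fun h => by rw [map_sub, h.one, Complex.sub_re, Complex.one_re]
    rw [o1 h₁] at e2
    rw [e1, Complex.add_re, Complex.re_ofReal_mul, o1 h₂]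
    have e5 : ε' ≤ η / 4 := min_le_left _ _
    have e6 : ε' * ‖a‖ ≤ ε' * 1 := by gcongr
    have e7 : δ = η / 4 := rfl
    nlinarith
  have h1a := hAC a haN ha0 ha1 h2a
  -- This density is `k / (1 - k + δ)`, a regularized `k / (1 - k)`. The test equation at `δ⁻¹ a W`
  -- compares it with `φ₁ ((1 - a) W)`; the remainder `φ₁ (a W)` is small by Cauchy-Schwarz.
  refine ⟨t, ((δ⁻¹ : ℝ) : ℂ) • (k * a), smul_mem_vn _ _ (mul_mem hkF haF), fun W hW => ?_⟩
  have hδc : ((δ⁻¹ : ℝ) : ℂ) * (δ : ℂ) = 1 := by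
    rw [← Complex.ofReal_mul, inv_mul_cancel₀ hδ.ne', Complex.ofReal_one]
  have e1 := hβ (((δ⁻¹ : ℝ) : ℂ) • (a * W)) (smul_mem_vn N _ (mul_mem haN hW))
  rw [mul_smul_comm, mul_smul_comm, ← mul_assoc, ← mul_assoc, hka, smul_mul_assoc, smul_smul, hδc,
    one_smul, sub_mul, one_mul, ← smul_mul_assoc] at e1
  have e2 : ε' * ‖((δ⁻¹ : ℝ) : ℂ) • (a * W)‖ ≤ ε / 2 * ‖W‖ := by
    rw [norm_smul, Complex.norm_real, Real.norm_of_nonneg (inv_nonneg.2 hδ.le)]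
    calc ε' * (δ⁻¹ * ‖a * W‖) ≤ (δ * (ε / 2)) * (δ⁻¹ * (1 * ‖W‖)) := by
          gcongr
          · exact min_le_right _ _
          · exact (norm_mul_le _ _).trans (by gcongr)
      _ = ε / 2 * ‖W‖ := by field_simp
  have e3 : ‖φ₁ (a * W)‖ ≤ ε / 2 * ‖W‖ := by
    have hsa : IsSelfAdjoint a := IsSelfAdjoint.of_nonneg ha0
    have c1 := h₁.cauchySchwarz haN hW
    have c2 : (φ₁ (star a * a)).re ≤ (ε / 2) ^ 2 := by
      refine (h₁.re_mono (mul_mem (star_mem haN) haN) haN ?_).trans h1a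
      have := CStarAlgebra.pow_antitone ha0 ha1 (show 1 ≤ 2 by norm_num)
      simpa [sq, hsa.star_eq] using this
    have c3 := h₁.re_star_mul_self_le hW
    have c4 := (Complex.le_def.1 (h₁.nonneg W hW)).1
    rw [hsa.star_eq] at c1 c2
    refine le_of_sq_le_sq ?_ (by positivity)
    rw [mul_pow]
    exact c1.trans (mul_le_mul c2 c3 c4 (by positivity))
  calc ‖φ₁ W - φ₂ (((δ⁻¹ : ℝ) : ℂ) • (k * a) * W)‖
      = ‖φ₁ (a * W) - (φ₂ (((δ⁻¹ : ℝ) : ℂ) • (k * a) * W) - φ₁ (W - a * W))‖ := by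
        rw [map_sub φ₁ W]; congr 1; ring
    _ ≤ ‖φ₁ (a * W)‖ + ‖φ₂ (((δ⁻¹ : ℝ) : ℂ) • (k * a) * W) - φ₁ (W - a * W)‖ := norm_sub_le _ _
    _ ≤ ε / 2 * ‖W‖ + ε / 2 * ‖W‖ := add_le_add e3 (e1.trans e2)
    _ = ε * ‖W‖ := by ring

end

end

end RadonNikodym

/-! ### Resolvents of self-adjoint operators, and commutation with their bounded functions. -/

section FunctionalCalculus

variable {H : Type*} [NormedAddCommGroup H] [InnerProductSpace ℂ H] [CompleteSpace H]

/-! ### The resolvent of a self-adjoint operator -/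

theorem mem_graph_iff_of_isSelfAdjoint {T : H →ₗ.[ℂ] H} (hT : IsSelfAdjoint T) (x y : H) :
    (x, y) ∈ T.graph ↔ ∀ a b, (a, b) ∈ T.graph → ⟪b, x⟫_ℂ = ⟪a, y⟫_ℂ := by
  have h : T.graph = T.graph.adjoint := by
    rw [← LinearPMap.adjoint_graph_eq_graph_adjoint hT.dense_domain]
    exact congrArg LinearPMap.graph (LinearPMap.isSelfAdjoint_def.1 hT).symm
  conv_lhs => rw [h]
  rw [Submodule.mem_adjoint_iff]
  simp only [sub_eq_zero]

theorem norm_sq_add_I_smul {T : H →ₗ.[ℂ] H} (hT : IsSelfAdjoint T) {x y : H}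
    (h : (x, y) ∈ T.graph) : ‖y + Complex.I • x‖ ^ 2 = ‖y‖ ^ 2 + ‖x‖ ^ 2 := by
  have h1 := (mem_graph_iff_of_isSelfAdjoint hT x y).1 h x y h
  have h2 : (⟪y, Complex.I • x⟫_ℂ).re = 0 := by
    rw [inner_smul_right]
    have h3 : (⟪y, x⟫_ℂ).im = 0 := by
      have h4 := inner_conj_symm y x (𝕜 := ℂ)
      rw [← h1] at h4
      exact Complex.conj_eq_iff_im.1 h4
    simp [h3]
  have h5 := norm_add_sq (𝕜 := ℂ) y (Complex.I • x)
  rw [norm_smul, Complex.norm_I, one_mul] at h5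
  have h6 : RCLike.re ⟪y, Complex.I • x⟫_ℂ = 0 := h2
  rw [h6] at h5
  linarith

/-- The resolvent `(T + i)⁻¹` of a self-adjoint operator. -/
theorem exists_resolvent {T : H →ₗ.[ℂ] H} (hT : IsSelfAdjoint T) :
    ∃ R : H →L[ℂ] H, ∀ x y : H, (x, y) ∈ T.graph ↔ R (y + Complex.I • x) = x := by
  -- This is `T + i` viewed on the graph. It is bounded below, so its range is closed; it remains to
  -- see that the range is dense.
  let L : T.graph →L[ℂ] H :=
    ((ContinuousLinearMap.snd ℂ H H) + Complex.I • ContinuousLinearMap.fst ℂ H H).comp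
      T.graph.subtypeL
  have hL : ∀ p : T.graph, L p = (p : H × H).2 + Complex.I • (p : H × H).1 := fun p => rfl
  have hnorm : ∀ p : T.graph, ‖p‖ ≤ ‖L p‖ := by
    intro p
    have h1 := norm_sq_add_I_smul hT (x := (p : H × H).1) (y := (p : H × H).2) p.2
    rw [← hL] at h1
    change ‖(p : H × H)‖ ≤ _
    rw [Prod.norm_def]
    refine max_le ?_ ?_ <;> refine le_of_sq_le_sq ?_ (norm_nonneg _) <;> rw [h1]
    · linarith [sq_nonneg ‖(p : H × H).2‖]
    · linarith [sq_nonneg ‖(p : H × H).1‖]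
  have hcl : IsClosed (T.graph : Set (H × H)) := hT.isClosed
  have : CompleteSpace T.graph := hcl.completeSpace_coe
  have hanti : AntilipschitzWith 1 L := L.antilipschitz_of_bound fun p => by simpa using hnorm p
  have hinj : Function.Injective L := hanti.injective
  have hran : IsClosed (L.range : Set H) := by
    have := hanti.isClosed_range L.uniformContinuous
    rw [LinearMap.coe_range]
    exact this
  have htop : L.range = ⊤ := by
    have : CompleteSpace L.range := hran.completeSpace_coe
    rw [← Submodule.orthogonal_eq_bot_iff, Submodule.eq_bot_iff]
    intro z hz
    rw [Submodule.mem_orthogonal] at hz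
    -- A vector orthogonal to the range would be an eigenvector of `T` with eigenvalue `i`, which
    -- symmetry excludes.
    have h1 : (z, Complex.I • z) ∈ T.graph := by
      rw [mem_graph_iff_of_isSelfAdjoint hT]
      intro a b hab
      have h2 : ⟪b + Complex.I • a, z⟫_ℂ = 0 := hz _ ⟨⟨(a, b), hab⟩, rfl⟩
      rw [inner_add_left, inner_smul_left, Complex.conj_I] at h2
      rw [inner_smul_right]
      linear_combination h2
    have h3 := (mem_graph_iff_of_isSelfAdjoint hT _ _).1 h1 _ _ h1
    rw [inner_smul_left, inner_smul_right, Complex.conj_I] at h3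
    have h4 : Complex.I * ⟪z, z⟫_ℂ = 0 := by linear_combination (-1 / 2 : ℂ) * h3
    exact inner_self_eq_zero.1 ((mul_eq_zero.1 h4).resolve_left Complex.I_ne_zero)
  let e : T.graph ≃ₗ[ℂ] H := LinearEquiv.ofBijective (L : T.graph →ₗ[ℂ] H)
    ⟨hinj, LinearMap.range_eq_top.1 htop⟩
  have he : ∀ z, L (e.symm z) = z := fun z => e.apply_symm_apply z
  let R : H →L[ℂ] H := LinearMap.mkContinuous
    ((LinearMap.fst ℂ H H).comp (T.graph.subtype.comp (e.symm : H →ₗ[ℂ] T.graph))) 1 fun z => by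
      rw [one_mul]
      refine (le_max_left _ _ : ‖((e.symm z : T.graph) : H × H).1‖ ≤ ‖e.symm z‖).trans ?_
      have := hnorm (e.symm z)
      rwa [he] at this
  have hR : ∀ z, R z = ((e.symm z : T.graph) : H × H).1 := fun z => rfl
  refine ⟨R, fun x y => ⟨fun h => ?_, fun h => ?_⟩⟩
  · have h1 : e.symm (y + Complex.I • x) = ⟨(x, y), h⟩ := by
      rw [LinearEquiv.symm_apply_eq]; rfl
    rw [hR, h1]
  · have h1 := he (y + Complex.I • x)
    rw [hL, ← hR, h, add_left_inj] at h1
    have h2 := (e.symm (y + Complex.I • x)).2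
    rw [hR] at h
    have h3 : ((e.symm (y + Complex.I • x) : T.graph) : H × H) = (x, y) := Prod.ext h h1
    rwa [h3] at h2

section

variable {T : H →ₗ.[ℂ] H} {R : H →L[ℂ] H}
  (hR : ∀ x y : H, (x, y) ∈ T.graph ↔ R (y + Complex.I • x) = x)

include hR in
theorem resolvent_mem_graph (z : H) : (R z, z - Complex.I • R z) ∈ T.graph := by
  rw [hR, sub_add_cancel]

include hR in
theorem resolvent_injective : Function.Injective R := by
  rw [injective_iff_map_eq_zero]
  intro z hz
  have h := resolvent_mem_graph hR z
  rw [hz, smul_zero, sub_zero] at h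
  exact LinearPMap.graph_fst_eq_zero_snd T h rfl

include hR in
theorem commute_resolvent_iff (B : H →L[ℂ] H) : B * R = R * B ↔ CommutesWith B T := by
  constructor
  · intro h x y hxy
    rw [hR] at hxy ⊢
    have h1 := congrArg (fun S : H →L[ℂ] H => S (y + Complex.I • x)) h
    change B (R (y + Complex.I • x)) = R (B (y + Complex.I • x)) at h1
    rw [hxy, map_add, map_smul] at h1
    exact h1.symm
  · intro h
    ext z
    have h1 := h _ _ (resolvent_mem_graph hR z)
    rw [hR, ← map_smul B, ← map_add B, sub_add_cancel] at h1
    exact h1.symm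

include hR in
-- The adjoint of `(T + i)⁻¹` is `(T - i)⁻¹`.
theorem star_resolvent_mem_graph (hT : IsSelfAdjoint T) (w : H) :
    (star R w, w + Complex.I • star R w) ∈ T.graph := by
  rw [mem_graph_iff_of_isSelfAdjoint hT]
  intro a b hab
  have h1 : ⟪b + Complex.I • a, star R w⟫_ℂ = ⟪a, w⟫_ℂ := by
    rw [ContinuousLinearMap.star_eq_adjoint, ContinuousLinearMap.adjoint_inner_right,
      (hR a b).1 hab]
  rw [inner_add_left, inner_smul_left, Complex.conj_I] at h1
  rw [inner_add_right, inner_smul_right]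
  linear_combination h1

include hR in
theorem resolvent_identity (hT : IsSelfAdjoint T) :
    star R = R + (2 * Complex.I) • (R * star R) := by
  ext w
  have h1 := (hR _ _).1 (star_resolvent_mem_graph hR hT w)
  rw [add_assoc, ← two_smul ℂ (Complex.I • star R w), smul_smul, map_add, map_smul] at h1
  exact h1.symm

include hR in
-- Both `2i R R*` and `2i R* R` equal `R* - R`: the first by the resolvent identity, the second by
-- symmetry of `T`.
theorem isStarNormal_resolvent (hT : IsSelfAdjoint T) : IsStarNormal R := by
  have h1 := resolvent_identity hR hT
  have h2 : ∀ z w, ⟪z, R w⟫_ℂ - ⟪R z, w⟫_ℂ = -(2 * Complex.I) * ⟪R z, R w⟫_ℂ := by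
    intro z w
    have h3 := (mem_graph_iff_of_isSelfAdjoint hT _ _).1 (resolvent_mem_graph hR w) _ _
      (resolvent_mem_graph hR z)
    rw [inner_sub_left, inner_sub_right, inner_smul_left, inner_smul_right, Complex.conj_I] at h3
    linear_combination h3
  have h4 : R - star R = -(2 * Complex.I) • (star R * R) := by
    ext w
    refine ext_inner_left ℂ fun z => ?_
    change ⟪z, R w - star R w⟫_ℂ = ⟪z, -(2 * Complex.I) • (star R (R w))⟫_ℂ
    rw [inner_sub_right, inner_smul_right, ContinuousLinearMap.star_eq_adjoint,
      ContinuousLinearMap.adjoint_inner_right, ContinuousLinearMap.adjoint_inner_right]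
    exact h2 z w
  have h5 : (2 * Complex.I) • (star R * R) = (2 * Complex.I) • (R * star R) := by
    rw [neg_smul] at h4
    rw [← neg_eq_iff_eq_neg.2 h4, neg_sub]
    nth_rewrite 1 [h1]
    rw [add_sub_cancel_left]
  refine ⟨?_⟩
  have h6 : (2 * Complex.I : ℂ) ≠ 0 := by simp
  exact smul_right_injective _ h6 h5

include hR in
theorem denseRange_resolvent (hT : IsSelfAdjoint T) : DenseRange R := by
  refine hT.dense_domain.mono fun x hx => ?_
  exact ⟨T ⟨x, hx⟩ + Complex.I • x, (hR _ _).1 (LinearPMap.mem_graph T ⟨x, hx⟩)⟩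

end

/-! ### Bounded functions of a self-adjoint operator -/

/-- The function `z ↦ z f(Re (1 / z))`, which takes the value `f(x) / (x + i)` at `1 / (x + i)`. -/
def resolventSymbol (f : ℝ →ᵇ ℂ) (z : ℂ) : ℂ := z * f (z⁻¹).re

theorem continuous_resolventSymbol (f : ℝ →ᵇ ℂ) : Continuous (resolventSymbol f) := by
  rw [continuous_iff_continuousAt]
  intro z
  by_cases hz : z = 0
  · subst hz
    have h0 : resolventSymbol f 0 = 0 := zero_mul _
    rw [ContinuousAt, h0, tendsto_zero_iff_norm_tendsto_zero]
    have h1 : Tendsto (fun z : ℂ => ‖z‖ * ‖f‖) (𝓝 0) (𝓝 0) := by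
      have : Continuous fun z : ℂ => ‖z‖ * ‖f‖ := by fun_prop
      simpa using this.tendsto 0
    refine squeeze_zero (fun _ => norm_nonneg _) (fun z => ?_) h1
    rw [resolventSymbol, norm_mul]
    gcongr
    exact f.norm_coe_le_norm _
  · refine continuousAt_id.mul (f.continuous.continuousAt.comp ?_)
    exact Complex.continuous_re.continuousAt.comp (continuousAt_inv₀ hz)

theorem resolventSymbol_mul (f g : ℝ →ᵇ ℂ) (z : ℂ) :
    resolventSymbol f z * resolventSymbol g z = z * resolventSymbol (f * g) z := by
  simp only [resolventSymbol, BoundedContinuousFunction.mul_apply]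
  ring

/-- If `Θ` is a functional calculus of `T`, then operators which together with their adjoints
commute with `T` commute with all bounded functions of `T`. -/
theorem IsFunctionalCalculus.commute {T : H →ₗ.[ℂ] H} {Θ : (ℝ →ᵇ ℂ) →⋆ₐ[ℂ] (H →L[ℂ] H)}
    (hΘ : IsFunctionalCalculus T Θ) {B : H →L[ℂ] H} (h1 : CommutesWith B T)
    (h2 : CommutesWith (star B) T) (f : ℝ →ᵇ ℂ) : B * Θ f = Θ f * B := by
  have e : cfc (resolventSymbol f) resolventFun = resolventFun * f := by
    ext x
    let ev : (ℝ →ᵇ ℂ) →⋆ₐ[ℂ] ℂ :=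
      { toFun := fun k => k x
        map_one' := rfl
        map_mul' := fun _ _ => rfl
        map_zero' := rfl
        map_add' := fun _ _ => rfl
        commutes' := fun _ => rfl
        map_star' := fun _ => rfl }
    have hev : Continuous ev := (BoundedContinuousFunction.lipschitz_eval_const x).continuous
    have h3 := ev.map_cfc (resolventSymbol f) resolventFun
      (continuous_resolventSymbol f).continuousOn hev
    change ev _ = resolventFun x * f x
    rw [h3]
    have h4 := cfc_algebraMap (A := ℂ) (p := IsStarNormal) (ev resolventFun) (resolventSymbol f)
    simp only [Algebra.algebraMap_self, RingHom.id_apply] at h4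
    rw [h4]
    change ((x : ℂ) + Complex.I)⁻¹ * f ((((x : ℂ) + Complex.I)⁻¹)⁻¹).re = _
    rw [inv_inv]
    simp [resolventFun]
  have hcont : Continuous Θ := by
    refine AddMonoidHomClass.continuous_of_bound Θ 1 fun k => ?_
    rw [one_mul]
    exact NonUnitalStarAlgHom.norm_apply_le Θ k
  -- Although `f(T)` need not be a continuous function of the resolvent `R`, the product `R f(T)` is
  -- one. Commutation with `B` is obtained for the product, and injectivity of `R` then cancels the
  -- factor.
  have e2 : Θ resolventFun * Θ f = cfc (resolventSymbol f) (Θ resolventFun) := by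
    rw [← map_mul, ← e]
    exact Θ.map_cfc (resolventSymbol f) resolventFun
      (continuous_resolventSymbol f).continuousOn hcont
  have c1 : Commute (Θ resolventFun) B := ((commute_resolvent_iff hΘ B).2 h1).symm
  have c2 : Commute (star (Θ resolventFun)) B := by
    have := congrArg star ((commute_resolvent_iff hΘ (star B)).2 h2)
    rw [star_mul, star_mul, star_star] at this
    exact this
  have c3 : Commute (Θ resolventFun * Θ f) B := by
    rw [e2]; exact c1.cfc c2 _
  have c4 : Θ resolventFun * (B * Θ f) = Θ resolventFun * (Θ f * B) := by
    rw [← mul_assoc, c1.eq, mul_assoc, ← c3.eq, mul_assoc]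
  ext v
  exact resolvent_injective hΘ (congrArg (fun S : H →L[ℂ] H => S v) c4)

end FunctionalCalculus

/-! ### Construction of the bounded functional calculus and properties of `funCalc`. -/

section ExistenceOfCalculus

variable {H : Type*} [NormedAddCommGroup H] [InnerProductSpace ℂ H] [CompleteSpace H]

section

variable {R : H →L[ℂ] H} [IsStarNormal R] (hd : DenseRange R)

theorem cfc_resolventSymbol_mul (f g : ℝ →ᵇ ℂ) :
    cfc (resolventSymbol f) R * cfc (resolventSymbol g) R =
      R * cfc (resolventSymbol (f * g)) R := by
  rw [← cfc_mul _ _ R (continuous_resolventSymbol f).continuousOn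
    (continuous_resolventSymbol g).continuousOn]
  conv_rhs =>
    rw [← cfc_id' ℂ R]
    rw [cfc_id' ℂ R]
  nth_rewrite 2 [← cfc_id' ℂ R]
  rw [← cfc_mul (fun z : ℂ => z) (resolventSymbol (f * g)) R (by fun_prop)
    (continuous_resolventSymbol _).continuousOn]
  exact cfc_congr fun z _ => resolventSymbol_mul f g z

/-- The pointwise bound `|z f(Re (1 / z))| ≤ ‖f‖ |z|`, read through the calculus. It makes `R v ↦
cfc (resolventSymbol f) R v` well defined and bounded, hence extendable from the dense range of `R`.
-/
theorem norm_cfc_resolventSymbol_le (f : ℝ →ᵇ ℂ) (v : H) :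
    ‖cfc (resolventSymbol f) R v‖ ≤ ‖f‖ * ‖R v‖ := by
  have hc := continuous_resolventSymbol f
  have h0 : 0 ≤ cfc (fun z : ℂ => (‖f‖ ^ 2 : ℂ) * (star z * z) -
      star (resolventSymbol f z) * resolventSymbol f z) R := by
    refine cfc_nonneg fun z _ => ?_
    have h1 : (‖f‖ ^ 2 : ℂ) * (star z * z) - star (resolventSymbol f z) * resolventSymbol f z =
        ((‖f‖ ^ 2 * ‖z‖ ^ 2 - ‖resolventSymbol f z‖ ^ 2 : ℝ) : ℂ) := by
      have h2 : ∀ w : ℂ, star w * w = ((‖w‖ ^ 2 : ℝ) : ℂ) := fun w => by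
        rw [Complex.star_def, mul_comm, Complex.mul_conj, Complex.normSq_eq_norm_sq]
      rw [h2, h2]
      push_cast
      ring
    rw [h1, Complex.zero_le_real, sub_nonneg, ← mul_pow, resolventSymbol, norm_mul, mul_comm]
    gcongr
    exact f.norm_coe_le_norm _
  have e : cfc (fun z : ℂ => (‖f‖ ^ 2 : ℂ) * (star z * z) -
      star (resolventSymbol f z) * resolventSymbol f z) R = (‖f‖ ^ 2 : ℂ) • (star R * R) -
      star (cfc (resolventSymbol f) R) * cfc (resolventSymbol f) R := by
    rw [cfc_sub (fun z : ℂ => (‖f‖ ^ 2 : ℂ) * (star z * z))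
      (fun z => star (resolventSymbol f z) * resolventSymbol f z) R (by fun_prop)
      (by fun_prop), cfc_const_mul (‖f‖ ^ 2 : ℂ) (fun z : ℂ => star z * z) R (by fun_prop),
      cfc_mul (fun z : ℂ => star z) (fun z : ℂ => z) R (by fun_prop) (by fun_prop),
      cfc_mul (fun z : ℂ => star (resolventSymbol f z)) (resolventSymbol f) R (by fun_prop)
        (by fun_prop), cfc_star (fun z : ℂ => z) R, cfc_star (resolventSymbol f) R, cfc_id' ℂ R]
  rw [e] at h0
  have h1 := ((ContinuousLinearMap.nonneg_iff_isPositive _).1 h0).re_inner_nonneg_right v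
  have h2 : ∀ X : H →L[ℂ] H, ⟪v, star X (X v)⟫_ℂ = ((‖X v‖ ^ 2 : ℝ) : ℂ) := fun X => by
    rw [ContinuousLinearMap.star_eq_adjoint, ContinuousLinearMap.adjoint_inner_right,
      inner_self_eq_norm_sq_to_K]
    push_cast
    rfl
  change 0 ≤ RCLike.re ⟪v, (‖f‖ ^ 2 : ℂ) • (star R (R v)) -
    star (cfc (resolventSymbol f) R) (cfc (resolventSymbol f) R v)⟫_ℂ at h1
  rw [inner_sub_right, inner_smul_right, h2, h2] at h1
  have h3 : (‖f‖ ^ 2 : ℂ) * ((‖R v‖ ^ 2 : ℝ) : ℂ) - ((‖cfc (resolventSymbol f) R v‖ ^ 2 : ℝ) : ℂ) =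
      ((‖f‖ ^ 2 * ‖R v‖ ^ 2 - ‖cfc (resolventSymbol f) R v‖ ^ 2 : ℝ) : ℂ) := by push_cast; ring
  rw [h3] at h1
  have h4 : 0 ≤ ‖f‖ ^ 2 * ‖R v‖ ^ 2 - ‖cfc (resolventSymbol f) R v‖ ^ 2 := h1
  refine le_of_sq_le_sq ?_ (by positivity)
  rw [mul_pow]
  linarith

/-- The operator `f(T)`, where `R = (T + i)⁻¹`. -/
def boundedFun (R : H →L[ℂ] H) (f : ℝ →ᵇ ℂ) : H →L[ℂ] H :=
  ((cfc (resolventSymbol f) R : H →L[ℂ] H) : H →ₗ[ℂ] H).extendOfNorm (R : H →ₗ[ℂ] H)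

include hd in
theorem boundedFun_mul_resolvent (f : ℝ →ᵇ ℂ) :
    boundedFun R f * R = cfc (resolventSymbol f) R := by
  ext v
  exact LinearMap.extendOfNorm_eq hd ⟨‖f‖, fun v => norm_cfc_resolventSymbol_le f v⟩ v

include hd in
theorem eq_of_mul_resolvent_eq {A B : H →L[ℂ] H} (h : A * R = B * R) : A = B := by
  have h1 : (A : H → H) = B := hd.equalizer A.continuous B.continuous
    (funext fun v => congrArg (fun S : H →L[ℂ] H => S v) h)
  exact DFunLike.coe_injective h1

include hd in
theorem boundedFun_eq_iff {A : H →L[ℂ] H} {f : ℝ →ᵇ ℂ} :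
    boundedFun R f = A ↔ cfc (resolventSymbol f) R = A * R := by
  rw [← boundedFun_mul_resolvent hd]
  exact ⟨fun h => by rw [h], fun h => eq_of_mul_resolvent_eq hd h⟩

theorem commute_cfc_resolventSymbol (f : ℝ →ᵇ ℂ) :
    cfc (resolventSymbol f) R * R = R * cfc (resolventSymbol f) R :=
  ((Commute.refl R).cfc (star_comm_self' R) _).eq

/-- The functional calculus of the self-adjoint operator with resolvent `R`. -/
def resolventCalculus (hd : DenseRange R) : (ℝ →ᵇ ℂ) →⋆ₐ[ℂ] (H →L[ℂ] H) where
  toFun := boundedFun R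
  map_one' := by
    rw [boundedFun_eq_iff hd, one_mul]
    conv_rhs => rw [← cfc_id' ℂ R]
    exact cfc_congr fun z _ => by simp [resolventSymbol]
  map_mul' f g := by
    -- Two factors of `R`, one for each function, turn both sides into continuous functions of `R`;
    -- density of the range then cancels them.
    have h1 : boundedFun R f * boundedFun R g * R * R = boundedFun R (f * g) * R * R := by
      rw [mul_assoc (boundedFun R f), boundedFun_mul_resolvent hd, mul_assoc,
        commute_cfc_resolventSymbol, ← mul_assoc, boundedFun_mul_resolvent hd,
        boundedFun_mul_resolvent hd, cfc_resolventSymbol_mul, commute_cfc_resolventSymbol]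
    exact (eq_of_mul_resolvent_eq hd (eq_of_mul_resolvent_eq hd h1)).symm
  map_zero' := by
    rw [boundedFun_eq_iff hd, zero_mul, ← cfc_zero ℂ R]
    exact cfc_congr fun z _ => by simp [resolventSymbol]
  map_add' f g := by
    rw [boundedFun_eq_iff hd, add_mul, boundedFun_mul_resolvent hd, boundedFun_mul_resolvent hd,
      ← cfc_add R _ _ (continuous_resolventSymbol f).continuousOn
        (continuous_resolventSymbol g).continuousOn]
    exact cfc_congr fun z _ => by simp [resolventSymbol, mul_add]
  commutes' c := by
    rw [boundedFun_eq_iff hd, Algebra.algebraMap_eq_smul_one (A := H →L[ℂ] H), smul_mul_assoc, one_mul]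
    conv_rhs => rw [← cfc_id' ℂ R]
    rw [← cfc_smul c (fun z : ℂ => z) R]
    refine cfc_congr fun z _ => ?_
    change z * c = c * z
    rw [mul_comm]
  map_star' f := by
    -- A factor `R` on the right handles `boundedFun R (star f)`, and `star R` on the left handles
    -- the adjoint; the left factor is cancelled after taking adjoints.
    have h1 : star R * boundedFun R (star f) * R = star R * star (boundedFun R f) * R := by
      rw [mul_assoc, boundedFun_mul_resolvent hd, ← star_mul, boundedFun_mul_resolvent hd,
        ← cfc_star]
      nth_rewrite 1 [← cfc_id' ℂ R]
      nth_rewrite 4 [← cfc_id' ℂ R]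
      have hc := continuous_resolventSymbol f
      rw [← cfc_star, ← cfc_mul (fun z : ℂ => star z) (resolventSymbol (star f)) R (by fun_prop)
          (continuous_resolventSymbol _).continuousOn,
        ← cfc_mul (fun z : ℂ => star (resolventSymbol f z)) (fun z : ℂ => z) R (by fun_prop)
          (by fun_prop)]
      refine cfc_congr fun z _ => ?_
      change star z * (z * star (f (z⁻¹).re)) = star (z * f (z⁻¹).re) * z
      rw [star_mul]
      ring
    have h2 := congrArg star (eq_of_mul_resolvent_eq hd h1)
    rw [star_mul, star_mul, star_star, star_star] at h2
    have h3 := congrArg star (eq_of_mul_resolvent_eq hd h2)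
    rwa [star_star] at h3

end

/-- By the resolvent identity the spectrum of `R` lies on the curve `z̄ = z + 2i |z|²`, where `1 /
z` has imaginary part 1 for `z ≠ 0`. There `1 / (Re (1 / z) + i) = z`, and at 0 the prefactor of the
symbol removes the question. -/
theorem isFunctionalCalculus_resolventCalculus {T : H →ₗ.[ℂ] H} (hT : IsSelfAdjoint T)
    {R : H →L[ℂ] H} [IsStarNormal R] (hR : ∀ x y : H, (x, y) ∈ T.graph ↔ R (y + Complex.I • x) = x) :
    IsFunctionalCalculus T (resolventCalculus (denseRange_resolvent hR hT)) := by
  have hspec : Set.EqOn (fun z : ℂ => star z) (fun z => z + (2 * Complex.I) * (z * star z))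
      (spectrum ℂ R) := by
    refine (cfc_eq_cfc_iff_eqOn (A := H →L[ℂ] H) (p := IsStarNormal) (a := R)).1 ?_
    rw [cfc_add R (fun z : ℂ => z) (fun z => (2 * Complex.I) * (z * star z)) (by fun_prop)
      (by fun_prop), cfc_const_mul (2 * Complex.I) (fun z : ℂ => z * star z) R (by fun_prop),
      cfc_mul (fun z : ℂ => z) (fun z : ℂ => star z) R (by fun_prop) (by fun_prop),
      cfc_star (fun z : ℂ => z) R, cfc_id' ℂ R]
    exact resolvent_identity hR hT
  have h : resolventCalculus (denseRange_resolvent hR hT) resolventFun = R := by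
    refine (boundedFun_eq_iff (denseRange_resolvent hR hT)).2 ?_
    conv_rhs => rw [← cfc_id' ℂ R, ← cfc_mul (fun z : ℂ => z) (fun z : ℂ => z) R]
    refine cfc_congr fun z hz => ?_
    change z * (((z⁻¹).re : ℂ) + Complex.I)⁻¹ = z * z
    by_cases h0 : z = 0
    · simp [h0]
    have h1 := hspec hz
    simp only at h1
    have h0' : star z ≠ 0 := star_ne_zero.2 h0
    have h2 : z⁻¹ = star (z⁻¹) + 2 * Complex.I := by
      rw [star_inv₀]
      field_simp
      linear_combination h1
    have h3 : ((z⁻¹).re : ℂ) + Complex.I = z⁻¹ := by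
      have him : (z⁻¹).im = 1 := by
        have := congrArg Complex.im h2
        simp only [Complex.star_def, Complex.add_im, Complex.conj_im, Complex.mul_im,
          Complex.re_ofNat, Complex.im_ofNat, Complex.I_re, Complex.I_im] at this
        linarith
      apply Complex.ext <;> simp [him, - Complex.inv_re, - Complex.inv_im]
    rw [h3, inv_inv]
  intro x y
  rw [h]
  exact hR x y

theorem exists_isFunctionalCalculus {T : H →ₗ.[ℂ] H} (hT : IsSelfAdjoint T) :
    ∃ Θ, IsFunctionalCalculus T Θ := by
  obtain ⟨R, hR⟩ := exists_resolvent hT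
  have := isStarNormal_resolvent hR hT
  exact ⟨_, isFunctionalCalculus_resolventCalculus hT hR⟩

/-! ### Properties of `funCalc` -/

/-- Self-adjointness of `T` is not needed, because the default value 0 commutes with everything.
This covers closures of differences. -/
theorem funCalc_commute {T : H →ₗ.[ℂ] H} {B : H →L[ℂ] H} (h1 : CommutesWith B T)
    (h2 : CommutesWith (star B) T) (f : ℝ →ᵇ ℝ) : B * funCalc T f = funCalc T f * B := by
  unfold funCalc
  split_ifs with h
  · exact h.choose_spec.commute h1 h2 _
  · rw [mul_zero, zero_mul]

theorem norm_funCalc_le (T : H →ₗ.[ℂ] H) (f : ℝ →ᵇ ℝ) : ‖funCalc T f‖ ≤ ‖f‖ := by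
  unfold funCalc
  split_ifs with h
  · refine (NonUnitalStarAlgHom.norm_apply_le h.choose _).trans ?_
    refine (BoundedContinuousFunction.norm_le (norm_nonneg _)).2 fun x => ?_
    simpa [toComplex] using f.norm_coe_le_norm x
  · simp

theorem star_funCalc (T : H →ₗ.[ℂ] H) (f : ℝ →ᵇ ℝ) : star (funCalc T f) = funCalc T f := by
  unfold funCalc
  split_ifs with h
  · rw [← map_star]
    congr 1
    ext x
    simp [toComplex]
  · simp

/-- The real part of a bounded continuous function. -/
def reFun (g : ℝ →ᵇ ℂ) : ℝ →ᵇ ℝ :=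
  BoundedContinuousFunction.ofNormedAddCommGroup (fun x => (g x).re)
    (Complex.continuous_re.comp g.continuous) ‖g‖
    fun x => (Complex.abs_re_le_norm _).trans (g.norm_coe_le_norm x)

theorem commutesWith_of_funCalc {T : H →ₗ.[ℂ] H} (hT : IsSelfAdjoint T) {B : H →L[ℂ] H}
    (h : ∀ f, B * funCalc T f = funCalc T f * B) : CommutesWith B T := by
  have hex := exists_isFunctionalCalculus hT
  have hf : ∀ f, B * hex.choose (toComplex f) = hex.choose (toComplex f) * B := by
    intro f
    have := h f
    unfold funCalc at this
    rwa [dif_pos hex] at this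
  rw [← commute_resolvent_iff hex.choose_spec]
  -- `funCalc` accepts only real functions, so the resolvent is split into its real and imaginary
  -- parts.
  have e : resolventFun = toComplex (reFun resolventFun) +
      Complex.I • toComplex (reFun (-Complex.I • resolventFun)) := by
    ext x
    apply Complex.ext <;> simp [toComplex, reFun]
  rw [e, map_add, map_smul, mul_add, add_mul, hf, mul_smul_comm, hf, smul_mul_assoc]

end ExistenceOfCalculus

/-! ### Jordan decomposition of hermitian functionals on a C*-algebra. -/

section Jordan

variable {A : Type*} [CStarAlgebra A] [PartialOrder A] [StarOrderedRing A]

theorem norm_le_of_neg_algebraMap_le {a : A} (ha : IsSelfAdjoint a) {c : ℝ} (hc : 0 ≤ c)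
    (h1 : -algebraMap ℝ A c ≤ a) (h2 : a ≤ algebraMap ℝ A c) : ‖a‖ ≤ c := by
  rw [← map_neg] at h1
  conv_lhs => rw [← cfc_id' ℝ a]
  refine norm_cfc_le hc fun x hx => ?_
  rw [Real.norm_eq_abs, abs_le]
  exact ⟨(algebraMap_le_cfc_iff (fun x : ℝ => x) (-c) a).1 (by rwa [cfc_id' ℝ a]) x hx,
    (cfc_le_algebraMap_iff (fun x : ℝ => x) c a).1 (by rwa [cfc_id' ℝ a]) x hx⟩

/-- The cone of pairs of elements with positive real parts. -/
def positivePairs (A : Type*) [CStarAlgebra A] [PartialOrder A] [StarOrderedRing A] :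
    PointedCone ℝ (A × A) where
  carrier := {p | 0 ≤ p.1 + star p.1 ∧ 0 ≤ p.2 + star p.2}
  zero_mem' := by simp
  add_mem' := by
    rintro p q ⟨h1, h2⟩ ⟨h3, h4⟩
    refine ⟨?_, ?_⟩
    · have := add_nonneg h1 h3
      rw [add_add_add_comm, ← star_add] at this
      exact this
    · have := add_nonneg h2 h4
      rw [add_add_add_comm, ← star_add] at this
      exact this
  smul_mem' := by
    rintro ⟨c, hc⟩ p ⟨h1, h2⟩
    have e : ∀ a : A, c • a + star (c • a) = c • (a + star a) := fun a => by
      rw [star_smul, star_trivial, smul_add]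
    refine ⟨?_, ?_⟩
    · change 0 ≤ c • p.1 + star (c • p.1)
      rw [e]; exact smul_nonneg hc h1
    · change 0 ≤ c • p.2 + star (c • p.2)
      rw [e]; exact smul_nonneg hc h2

/-- The unit is an order unit; this supplies the cofinality hypothesis of the M. Riesz extension
theorem. -/
theorem add_star_smul_one_nonneg (a : A) {c : ℝ} (hc : ‖a‖ ≤ c) :
    0 ≤ (c • (1 : A) + a) + star (c • (1 : A) + a) := by
  have hsa : IsSelfAdjoint (a + star a) := .add_star_self a
  have h1 : ‖a + star a‖ ≤ 2 * c := by
    have := norm_add_le a (star a)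
    rw [norm_star] at this
    linarith
  have h2 := (algebraMap_mono A h1).trans' (neg_le.1 hsa.neg_algebraMap_norm_le_self)
  have h3 : (c • (1 : A) + a) + star (c • (1 : A) + a) =
      algebraMap ℝ A (2 * c) - -(a + star a) := by
    rw [Algebra.algebraMap_eq_smul_one, mul_smul, two_smul, star_add, star_smul, star_trivial c,
      star_one]
    abel
  rw [h3, sub_nonneg]
  exact h2

/-- The Jordan decomposition of a bounded hermitian functional, in terms of its real part. -/
theorem exists_jordan_decomposition (ρ : A →ₗ[ℂ] ℂ) (hρ : ρ 1 = 1) (r : A →ₗ[ℝ] ℝ) {C : ℝ}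
    (hC : ∀ a, |r a| ≤ C * ‖a‖) (hstar : ∀ a, r (star a) = r a) :
    ∃ g₁ g₂ : A →ₗ[ℝ] ℝ, (∀ a, r a = g₁ a - g₂ a) ∧
      (∀ a, 0 ≤ a + star a → 0 ≤ g₁ a) ∧ ∀ a, 0 ≤ a + star a → 0 ≤ g₂ a := by
  have hnt : Nontrivial A := by
    refine ⟨1, 0, fun h => ?_⟩
    rw [h, map_zero] at hρ
    exact zero_ne_one hρ
  have hC0 : 0 ≤ C := by
    have := (abs_nonneg _).trans (hC 1)
    rwa [norm_one, mul_one] at this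
  -- The extension theorem is applied on pairs with scalar sum. There `f₀` does not depend on the
  -- choice of `ρ`; at `(a, -a)` it equals `r a`, so a positive extension `g` splits as `g₁ a = g
  -- (a, 0)` and `g₂ a = g (0, a)`.
  let D : Submodule ℝ (A × A) :=
    { carrier := {p | ∃ t : ℝ, p.1 + p.2 = t • (1 : A)}
      zero_mem' := ⟨0, by simp⟩
      add_mem' := by
        rintro p q ⟨s, hs⟩ ⟨t, ht⟩
        refine ⟨s + t, ?_⟩
        rw [add_smul, ← hs, ← ht, Prod.fst_add, Prod.snd_add, add_add_add_comm]
      smul_mem' := by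
        rintro c p ⟨s, hs⟩
        refine ⟨c * s, ?_⟩
        rw [mul_smul, ← hs, smul_add]; rfl }
  let f₀ : A × A →ₗ[ℝ] ℝ :=
    (1 / 2 : ℝ) • (r ∘ₗ (LinearMap.fst ℝ A A - LinearMap.snd ℝ A A) +
      C • (Complex.reLm ∘ₗ ρ.restrictScalars ℝ ∘ₗ (LinearMap.fst ℝ A A + LinearMap.snd ℝ A A)))
  have hf₀ : ∀ x y, f₀ (x, y) = 1 / 2 * (r (x - y) + C * (ρ (x + y)).re) := fun x y => rfl
  have hsmul : ∀ t : ℝ, (ρ (t • (1 : A))).re = t := fun t => by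
    rw [← Complex.coe_smul, map_smul, hρ]; simp
  obtain ⟨g, hg, hpos⟩ := riesz_extension (positivePairs A) (f₀.toPMap D) (by
    rintro ⟨⟨x, y⟩, t, ht⟩ ⟨hx, hy⟩
    change 0 ≤ f₀ (x, y)
    simp only at ht hx hy
    rw [hf₀, ht, hsmul]
    -- If `x` and `y` have positive real parts and sum to `t`, then `(x - y) + star (x - y)` lies
    -- between `-2t` and `2t`, so the bound on `r` gives `|r (x - y)| ≤ C t`.
    have e1 : (x - y) + star (x - y) = (x + star x) + (x + star x) - (2 * t) • (1 : A) := by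
      have hy' : y = t • (1 : A) - x := by rw [← ht]; abel
      rw [hy', mul_smul, two_smul, star_sub, star_sub, star_smul, star_trivial t, star_one]
      abel
    have e2 : (x - y) + star (x - y) = (2 * t) • (1 : A) - ((y + star y) + (y + star y)) := by
      have hx' : x = t • (1 : A) - y := by rw [← ht]; abel
      rw [hx', mul_smul, two_smul, star_sub, star_sub, star_smul, star_trivial t, star_one]
      abel
    have hsa : IsSelfAdjoint ((x - y) + star (x - y)) := .add_star_self _
    have l1 : -algebraMap ℝ A (2 * t) ≤ (x - y) + star (x - y) := by
      rw [Algebra.algebraMap_eq_smul_one, e1, neg_le_sub_iff_le_add]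
      exact le_add_of_nonneg_left (add_nonneg hx hx)
    have l2 : (x - y) + star (x - y) ≤ algebraMap ℝ A (2 * t) := by
      rw [Algebra.algebraMap_eq_smul_one, e2]
      exact sub_le_self _ (add_nonneg hy hy)
    have ht0 : 0 ≤ 2 * t := by
      by_contra! hneg
      have h3 : 0 ≤ algebraMap ℝ A (2 * t) := by
        have := add_nonneg (add_nonneg hx hx) (add_nonneg hy hy)
        have e3 : x + star x + (x + star x) + (y + star y + (y + star y)) =
            (2 : ℝ) • algebraMap ℝ A (2 * t) := by
          rw [Algebra.algebraMap_eq_smul_one, mul_smul, two_smul, two_smul, ← ht]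
          have h4 : star x + star y = x + y := by
            rw [← star_add, ht, star_smul, star_trivial t, star_one]
          have h5 : star x = x + y - star y := by rw [← h4]; abel
          rw [h5]; abel
        rw [e3] at this
        have h6 := smul_nonneg (show (0 : ℝ) ≤ 1 / 2 by norm_num) this
        rwa [smul_smul, show (1 / 2 * 2 : ℝ) = 1 by norm_num, one_smul] at h6
      have h4 := spectrum_nonneg_of_nonneg h3 (x := 2 * t) (by
        rw [spectrum.scalar_eq]; exact Set.mem_singleton _)
      linarith
    have l3 : ‖(x - y) + star (x - y)‖ ≤ 2 * t := norm_le_of_neg_algebraMap_le hsa ht0 l1 l2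
    have l4 := hC ((x - y) + star (x - y))
    rw [map_add, hstar, abs_le] at l4
    have l5 : C * ‖(x - y) + star (x - y)‖ ≤ C * (2 * t) := by gcongr
    linarith [l4.1]) (by
    rintro ⟨x, y⟩
    let c : ℝ := ‖x‖ + ‖y‖
    refine ⟨⟨(c • (1 : A), c • (1 : A)), c + c, (add_smul c c (1 : A)).symm⟩, ?_, ?_⟩
    · exact add_star_smul_one_nonneg x (le_add_of_nonneg_right (norm_nonneg y))
    · exact add_star_smul_one_nonneg y (le_add_of_nonneg_left (norm_nonneg x)))
  refine ⟨g ∘ₗ LinearMap.inl ℝ A A, g ∘ₗ LinearMap.inr ℝ A A, fun a => ?_, fun a ha => ?_,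
    fun a ha => ?_⟩
  · have h1 := hg ⟨(a, -a), 0, by simp⟩
    change g (a, -a) = f₀ (a, -a) at h1
    rw [hf₀, add_neg_cancel, map_zero, Complex.zero_re, mul_zero, add_zero, sub_neg_eq_add,
      map_add] at h1
    change r a = g (a, 0) - g (0, a)
    rw [← map_sub, Prod.mk_sub_mk, sub_zero, zero_sub, h1]
    ring
  · exact hpos (a, 0) ⟨ha, by simp⟩
  · exact hpos (0, a) ⟨by simp, ha⟩

/-- For positive `a`, both `i a` and `-i a` have zero real part, so `g (i a) = 0` and the imaginary
part of the extension vanishes. -/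
theorem extendRCLike_nonneg {g : A →ₗ[ℝ] ℝ} (hg : ∀ a, 0 ≤ a + star a → 0 ≤ g a) (a : A)
    (ha : 0 ≤ a) : (Module.Dual.extendRCLike g : A →ₗ[ℂ] ℂ) a = g a ∧ 0 ≤ g a := by
  have hsa : star a = a := IsSelfAdjoint.of_nonneg ha
  have h1 : g (Complex.I • a) = 0 := by
    refine le_antisymm ?_ (hg _ ?_)
    · have := hg (-(Complex.I • a)) (by rw [star_neg, star_smul, hsa]; simp)
      rw [map_neg] at this
      linarith
    · rw [star_smul, hsa]; simp
  refine ⟨?_, hg a (by rw [hsa]; exact add_nonneg ha ha)⟩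
  rw [Module.Dual.extendRCLike_apply]
  have h2 : g ((RCLike.I : ℂ) • a) = 0 := h1
  rw [h2]
  simp

/-- Adding `ρ` keeps the normalizing constant positive even if `g = 0`; the added term cancels in
differences. -/
theorem exists_state_of_nonneg (ρ : StateSpace A) {g : A →ₗ[ℝ] ℝ}
    (hg : ∀ a, 0 ≤ a + star a → 0 ≤ g a) : 0 < g 1 + 1 ∧ ∃ σ : StateSpace A, ∀ a,
      ((g 1 + 1 : ℝ) : ℂ) * σ.1 a = (Module.Dual.extendRCLike g : A →ₗ[ℂ] ℂ) a + ρ.1 a := by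
  have e1 := extendRCLike_nonneg hg 1 zero_le_one
  have hc : 0 < g 1 + 1 := by linarith [e1.2]
  have hcC : ((g 1 + 1 : ℝ) : ℂ) ≠ 0 := Complex.ofReal_ne_zero.2 hc.ne'
  refine ⟨hc, ⟨((g 1 + 1 : ℝ) : ℂ)⁻¹ • ((Module.Dual.extendRCLike g : A →ₗ[ℂ] ℂ) + ρ.1),
    fun X => ?_, ?_⟩, fun a => ?_⟩
  · have e2 := extendRCLike_nonneg hg _ (star_mul_self_nonneg X)
    rw [LinearMap.smul_apply, LinearMap.add_apply, e2.1, smul_eq_mul, ← Complex.ofReal_inv]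
    refine mul_nonneg (Complex.zero_le_real.2 (by positivity)) (add_nonneg ?_ (ρ.2.1 X))
    exact Complex.zero_le_real.2 e2.2
  · rw [LinearMap.smul_apply, LinearMap.add_apply, e1.1, ρ.2.2, smul_eq_mul]
    have e3 : ((g 1 : ℝ) : ℂ) + 1 = ((g 1 + 1 : ℝ) : ℂ) := by push_cast; rfl
    rw [← e3] at hcC ⊢
    exact inv_mul_cancel₀ hcC
  · rw [LinearMap.smul_apply, LinearMap.add_apply, smul_eq_mul, mul_inv_cancel_left₀ hcC]

/-- A bounded hermitian functional which vanishes at an element that all states map to `1` is a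
multiple of a difference of states. -/
theorem exists_states_sub (ρ : StateSpace A) (r : A →ₗ[ℝ] ℝ) {C : ℝ}
    (hC : ∀ a, |r a| ≤ C * ‖a‖) (hstar : ∀ a, r (star a) = r a) {e : A}
    (he : ∀ σ : StateSpace A, σ.1 e = 1) (h1 : r e = 0) :
    ∃ c : ℝ, c ≠ 0 ∧ ∃ σ₁ σ₂ : StateSpace A, ∀ a,
      (c : ℂ) * (σ₁.1 a - σ₂.1 a) = r a - Complex.I * r (Complex.I • a) := by
  obtain ⟨g₁, g₂, hr, hg₁, hg₂⟩ := exists_jordan_decomposition ρ.1 ρ.2.2 r hC hstar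
  obtain ⟨hc₁, σ₁, hσ₁⟩ := exists_state_of_nonneg ρ hg₁
  obtain ⟨hc₂, σ₂, hσ₂⟩ := exists_state_of_nonneg ρ hg₂
  have key : ∀ (g : A →ₗ[ℝ] ℝ) (σ : StateSpace A), (∀ a, ((g 1 + 1 : ℝ) : ℂ) * σ.1 a =
      (Module.Dual.extendRCLike g : A →ₗ[ℂ] ℂ) a + ρ.1 a) → g e = g 1 := by
    intro g σ h
    have h2 := congrArg Complex.re (h e)
    rw [he, he, Module.Dual.extendRCLike_apply] at h2
    simpa using h2.symm
  -- Vanishing of `r` at `e` forces the two parts to have equal mass, so one constant normalizes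
  -- both.
  have hc : g₂ 1 + 1 = g₁ 1 + 1 := by
    have h2 := hr e
    rw [key g₁ σ₁ hσ₁, key g₂ σ₂ hσ₂, h1] at h2
    linarith
  rw [hc] at hσ₂
  refine ⟨g₁ 1 + 1, hc₁.ne', σ₁, σ₂, fun a => ?_⟩
  rw [mul_sub, hσ₁, hσ₂, add_sub_add_right_eq_sub,
    Module.Dual.extendRCLike_apply, Module.Dual.extendRCLike_apply, hr a, hr (Complex.I • a)]
  simp only [RCLike.I_to_complex, Complex.coe_algebraMap]
  push_cast
  ring

end Jordan

/-! ### Commutation with unbounded operators, and products of functions of them. -/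

section Generated

variable {H : Type*} [NormedAddCommGroup H] [InnerProductSpace ℂ H] [CompleteSpace H]

theorem mem_vnGenerated_iff {𝒯 : Set (H →ₗ.[ℂ] H)} {x : H →L[ℂ] H} :
    x ∈ vnGenerated 𝒯 ↔ ∀ B : H →L[ℂ] H,
      (∀ T ∈ 𝒯, CommutesWith B T ∧ CommutesWith (star B) T) → B * x = x * B := by
  refine mem_vnCommutant_iff fun B hB T hT => ?_
  rw [star_star]
  exact (hB T hT).symm

theorem CommutesWith.sub {B : H →L[ℂ] H} {S T : H →ₗ.[ℂ] H} (hS : CommutesWith B S)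
    (hT : CommutesWith B T) : CommutesWith B (S - T) := by
  intro x y hxy
  rw [LinearPMap.mem_graph_iff] at hxy
  obtain ⟨z, hz, hzy⟩ := hxy
  simp only at hz hzy
  subst hz
  have h1 : ((z : H), S ⟨z, z.2.1⟩) ∈ S.graph := LinearPMap.mem_graph S ⟨z, z.2.1⟩
  have h2 : ((z : H), T ⟨z, z.2.2⟩) ∈ T.graph := LinearPMap.mem_graph T ⟨z, z.2.2⟩
  have h3 := hS _ _ h1
  have h4 := hT _ _ h2
  rw [LinearPMap.mem_graph_iff] at h3 h4
  obtain ⟨a, ha, ha'⟩ := h3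
  obtain ⟨b, hb, hb'⟩ := h4
  simp only at ha ha' hb hb'
  rw [LinearPMap.mem_graph_iff]
  refine ⟨⟨B z, ⟨ha ▸ a.2, hb ▸ b.2⟩⟩, rfl, ?_⟩
  have e1 : S ⟨B z, ha ▸ a.2⟩ = S a := congrArg S (Subtype.ext ha.symm)
  have e2 : T ⟨B z, hb ▸ b.2⟩ = T b := congrArg T (Subtype.ext hb.symm)
  have e3 : (S - T) ⟨B z, ⟨ha ▸ a.2, hb ▸ b.2⟩⟩ = S ⟨B z, ha ▸ a.2⟩ - T ⟨B z, hb ▸ b.2⟩ := rfl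
  have e4 : (S - T) z = S ⟨z, z.2.1⟩ - T ⟨z, z.2.2⟩ := rfl
  rw [e3, e1, e2, ha', hb', ← map_sub, ← e4, hzy]

theorem CommutesWith.closure {B : H →L[ℂ] H} {T : H →ₗ.[ℂ] H} (hT : CommutesWith B T) :
    CommutesWith B T.closure := by
  by_cases h : T.IsClosable
  · intro x y hxy
    rw [← h.graph_closure_eq_closure_graph] at hxy ⊢
    have hcont : Continuous fun p : H × H => (B p.1, B p.2) := by fun_prop
    exact map_mem_closure (f := fun p : H × H => (B p.1, B p.2)) (x := (x, y)) hcont hxy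
      fun (p : H × H) hp => hT p.1 p.2 hp
  -- A non-closable operator is its own closure by convention.
  · rwa [LinearPMap.closure_def' h]

theorem CommutesWith.zero (B : H →L[ℂ] H) : CommutesWith B (0 : H →ₗ.[ℂ] H) := by
  intro x y hxy
  rw [LinearPMap.mem_graph_iff] at hxy ⊢
  obtain ⟨z, hz, hzy⟩ := hxy
  have h0 : (0 : H →ₗ.[ℂ] H) z = 0 := rfl
  refine ⟨⟨B x, trivial⟩, rfl, ?_⟩
  change (0 : H) = B y
  have : y = 0 := hzy.symm.trans h0
  rw [this, map_zero]

theorem funCalcProd_mem {N : VonNeumannAlgebra H} {m : ℕ} {T : Fin m → H →ₗ.[ℂ] H}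
    {f : Fin m → ℝ →ᵇ ℝ} (h : ∀ i, funCalc (T i) (f i) ∈ N) : funCalcProd T f ∈ N := by
  refine list_prod_mem fun x hx => ?_
  rw [List.mem_ofFn] at hx
  obtain ⟨i, rfl⟩ := hx
  exact h i

/-- The bound is uniform in the operators, hence in the time from which increments are taken. -/
theorem norm_funCalcProd_le {m : ℕ} (f : Fin m → ℝ →ᵇ ℝ) :
    ∃ C : ℝ, ∀ T : Fin m → H →ₗ.[ℂ] H, ‖funCalcProd T f‖ ≤ C := by
  induction m with
  | zero =>
    refine ⟨‖(1 : H →L[ℂ] H)‖, fun T => ?_⟩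
    simp [funCalcProd]
  | succ m ih =>
    obtain ⟨C, hC⟩ := ih fun i => f i.succ
    refine ⟨‖f 0‖ * C, fun T => ?_⟩
    have h := hC fun i => T i.succ
    unfold funCalcProd at h ⊢
    rw [List.ofFn_succ, List.prod_cons]
    exact (norm_mul_le _ _).trans
      (mul_le_mul (norm_funCalc_le _ _) h (norm_nonneg _) (norm_nonneg _))

theorem funCalcProd_cons {m : ℕ} (T : Fin m → H →ₗ.[ℂ] H) (f : Fin m → ℝ →ᵇ ℝ) (T₀ : H →ₗ.[ℂ] H)
    (f₀ : ℝ →ᵇ ℝ) : funCalcProd (Fin.cons T₀ T) (Fin.cons f₀ f : Fin (m + 1) → ℝ →ᵇ ℝ) =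
      funCalc T₀ f₀ * funCalcProd T f := by
  simp [funCalcProd, List.ofFn_succ]

end Generated

/-! ### Observation algebras, and the law of the observations as determined by `fellerSet`. -/

namespace Model

variable {A : Type*} [CStarAlgebra A] [PartialOrder A] [StarOrderedRing A]
  {H : Type*} [NormedAddCommGroup H] [InnerProductSpace ℂ H] [CompleteSpace H] {n : ℕ}
  (𝔉 : Model A H n)

theorem mem_Yt_iff {t : ℝ≥0} {x : H →L[ℂ] H} : x ∈ 𝔉.Yt t ↔ ∀ B : H →L[ℂ] H,
    (∀ s ≤ t, ∀ k, CommutesWith B (𝔉.Y s k) ∧ CommutesWith (star B) (𝔉.Y s k)) →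
      B * x = x * B := by
  unfold Yt obsAlg
  rw [mem_vnGenerated_iff]
  refine forall_congr' fun B => imp_congr_left ?_
  constructor
  · intro h s hs k
    exact h _ ⟨s, hs, k, rfl⟩
  · rintro h _ ⟨s, hs, k, rfl⟩
    exact h s hs k

theorem Yt_mono : Monotone 𝔉.Yt := by
  intro s t hst x hx
  rw [mem_Yt_iff] at hx ⊢
  exact fun B hB => hx B fun r hr k => hB r (hr.trans hst) k

theorem Yt_le_Mt (t : ℝ≥0) : 𝔉.Yt t ≤ 𝔉.Mt t := by
  intro x hx
  rw [mem_iff_commute]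
  rw [mem_Yt_iff] at hx
  refine fun B hB => hx B fun s hs k => ?_
  have h : ∀ C ∈ (𝔉.Mt t).commutant, CommutesWith C (𝔉.Y s k) := by
    intro C hC
    refine 𝔉.Y_affiliated s k C ?_
    rw [VonNeumannAlgebra.mem_commutant_iff] at hC ⊢
    exact fun g hg => hC g (𝔉.Mt_mono hs hg)
  exact ⟨h B hB, h _ (star_mem hB)⟩

theorem Yt_le_M (t : ℝ≥0) : 𝔉.Yt t ≤ 𝔉.M := (𝔉.Yt_le_Mt t).trans (𝔉.Mt_le t)

theorem mem_Yinf_iff {x : H →L[ℂ] H} : x ∈ 𝔉.Yinf ↔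
    ∀ y, (∀ t, ∀ g ∈ 𝔉.Yt t, g * y = y * g) → y * x = x * y := by
  unfold Yinf vnBicommutant
  rw [VonNeumannAlgebra.mem_commutant_iff]
  refine forall_congr' fun y => imp_congr_left ?_
  rw [mem_vnCommutant_iff]
  · simp only [Set.mem_iUnion, SetLike.mem_coe, forall_exists_index]
    exact ⟨fun h t g hg => h g t hg, fun h g t hg => h t g hg⟩
  · rintro y hy
    simp only [Set.mem_iUnion, SetLike.mem_coe] at hy ⊢
    obtain ⟨t, ht⟩ := hy
    exact ⟨t, star_mem ht⟩

theorem Yt_le_Yinf (t : ℝ≥0) : 𝔉.Yt t ≤ 𝔉.Yinf := by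
  intro x hx
  rw [mem_Yinf_iff]
  exact fun y hy => (hy t x hx).symm

theorem Yinf_le_M : 𝔉.Yinf ≤ 𝔉.M := by
  intro x hx
  rw [mem_iff_commute]
  intro B hB
  rw [mem_Yinf_iff] at hx
  rw [VonNeumannAlgebra.mem_commutant_iff] at hB
  exact hx B fun t g hg => hB g (𝔉.Yt_le_M t hg)

theorem Yinf_commutative : ∀ B ∈ 𝔉.Yinf, ∀ C ∈ 𝔉.Yinf, B * C = C * B := by
  intro B hB C hC
  rw [mem_Yinf_iff] at hB hC
  refine (hB C fun t g hg => ?_).symm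
  refine hC g fun s h hh => ?_
  exact 𝔉.selfNondemolition (max s t) h (𝔉.Yt_mono (le_max_left s t) hh) g
    (𝔉.Yt_mono (le_max_right s t) hg)

theorem funCalc_Y_mem (t : ℝ≥0) (k : Fin n) (f : ℝ →ᵇ ℝ) : funCalc (𝔉.Y t k) f ∈ 𝔉.Yt t := by
  rw [mem_Yt_iff]
  intro B hB
  exact funCalc_commute (hB t le_rfl k).1 (hB t le_rfl k).2 f

theorem funCalc_increment_mem (s t : ℝ≥0) (k : Fin n) (f : ℝ →ᵇ ℝ) :
    funCalc (𝔉.Y (s + t) k - 𝔉.Y s k).closure f ∈ 𝔉.Yt (s + t) := by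
  rw [mem_Yt_iff]
  intro B hB
  have h1 := hB (s + t) le_rfl k
  have h2 := hB s le_self_add k
  exact funCalc_commute (h1.1.sub h2.1).closure (h1.2.sub h2.2).closure f

/-! ### The extended states -/

/-- A σ-weakly continuous extension of `Φ_ρ` to all bounded operators. -/
theorem exists_extension (ρ : StateSpace A) : ∃ u v : Amp ℕ H,
    (∀ X : Elem 𝔉.M, 𝔉.Φ ρ X = vecFunctional u v X) ∧ IsStateOn 𝔉.M (vecFunctional u v) := by
  obtain ⟨u, v, h⟩ := (𝔉.Φ_normal ρ).exists_vecFunctional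
  refine ⟨u, v, h, fun X hX => ?_, ?_⟩
  · have := (𝔉.Φ_state ρ).1 ⟨X, hX⟩
    rwa [h] at this
  · have := (𝔉.Φ_state ρ).2
    rwa [h] at this

theorem condExpEq_apply {ρ : StateSpace A} {φ : (H →L[ℂ] H) →ₗ[ℂ] ℂ}
    (hφ : ∀ X : Elem 𝔉.M, 𝔉.Φ ρ X = φ X) (hs : IsStateOn 𝔉.M φ) {s : ℝ≥0} {W V : Elem 𝔉.M}
    (h : CondExpEq 𝔉.M (𝔉.Mt s) (𝔉.Φ ρ) W V) {B : H →L[ℂ] H} (hB : B ∈ 𝔉.Mt s) :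
    φ (B * W) = φ (B * V) := by
  obtain ⟨⟨E, hE⟩, h2⟩ := h
  have hind : φ (star ((E W : H →L[ℂ] H) - V) * ((E W : H →L[ℂ] H) - V)) = 0 := by
    have := h2 E hE
    unfold Indist at this
    rwa [hφ] at this
  let B' : Elem 𝔉.M := ⟨B, 𝔉.Mt_le s hB⟩
  have h3 := hE.state (B' * W)
  have h4 := hE.module B' W 1 hB (one_mem (𝔉.Mt s))
  rw [mul_one, mul_one] at h4
  rw [h4, hφ, hφ] at h3
  change φ (B * (E W : H →L[ℂ] H)) = φ (B * (W : H →L[ℂ] H)) at h3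
  have h5 := hs.eq_zero_of_star_mul_self (sub_mem (E W).2 V.2) (𝔉.Mt_le s hB) hind
  rw [mul_sub, map_sub, sub_eq_zero] at h5
  rw [← h3, h5]

/-- The elements of the initial algebra which represent conditional expectations of functions of
the future increments. -/
def fellerSet : Set A :=
  {Z | ∃ (m : ℕ) (t : Fin m → ℝ≥0) (k : Fin m → Fin n) (f : Fin m → ℝ →ᵇ ℝ), (∀ i, 0 < t i) ∧
    ∀ ρ, (∀ W : Elem 𝔉.M, (W : H →L[ℂ] H) = funCalcProd (fun i => 𝔉.Y (t i) (k i)) f →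
        CondExpEq 𝔉.M (𝔉.Mt 0) (𝔉.Φ ρ) W (𝔉.j 0 Z)) ∧
      ∀ s, ∀ W : Elem 𝔉.M,
        (W : H →L[ℂ] H) = funCalcProd (fun i => (𝔉.Y (s + t i) (k i) - 𝔉.Y s (k i)).closure) f →
        CondExpEq 𝔉.M (𝔉.Mt s) (𝔉.Φ ρ) W (𝔉.j s Z)}

/-- The products of functions of the observations at positive times. -/
def obsProducts : Set (H →L[ℂ] H) :=
  {x | ∃ (m : ℕ) (t : Fin m → ℝ≥0) (k : Fin m → Fin n) (f : Fin m → ℝ →ᵇ ℝ), (∀ i, 0 < t i) ∧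
    x = funCalcProd (fun i => 𝔉.Y (t i) (k i)) f}

theorem exists_fellerSet_apply {x : H →L[ℂ] H} (hx : x ∈ 𝔉.obsProducts) : ∃ Z ∈ 𝔉.fellerSet,
    ∃ hx : x ∈ 𝔉.M, ∀ ρ : StateSpace A, 𝔉.Φ ρ ⟨x, hx⟩ = ρ.1 Z := by
  obtain ⟨m, t, k, f, ht, rfl⟩ := hx
  obtain ⟨Z, hZ⟩ := 𝔉.feller m t k f ht
  have hmem : funCalcProd (fun i => 𝔉.Y (t i) (k i)) f ∈ 𝔉.M :=
    funCalcProd_mem fun i => 𝔉.Yt_le_M _ (𝔉.funCalc_Y_mem (t i) (k i) (f i))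
  refine ⟨Z, ⟨m, t, k, f, ht, hZ⟩, hmem, fun ρ => ?_⟩
  obtain ⟨u, v, hφ, hs⟩ := 𝔉.exists_extension ρ
  have := 𝔉.condExpEq_apply hφ hs ((hZ ρ).1 ⟨_, hmem⟩ rfl) (one_mem _)
  rw [one_mul, one_mul] at this
  rw [hφ, this, ← hφ, 𝔉.initial]

theorem mul_mem_obsProducts {t : ℝ≥0} (ht : 0 < t) (k : Fin n) (f : ℝ →ᵇ ℝ) {x : H →L[ℂ] H}
    (hx : x ∈ 𝔉.obsProducts) : funCalc (𝔉.Y t k) f * x ∈ 𝔉.obsProducts := by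
  obtain ⟨m, t', k', f', ht', rfl⟩ := hx
  refine ⟨m + 1, Fin.cons t t', Fin.cons k k', Fin.cons f f', ?_, ?_⟩
  · intro i
    refine Fin.cases ?_ (fun i => ?_) i
    · simpa using ht
    · simpa using ht' i
  · rw [← funCalcProd_cons]
    congr 1
    ext1 i
    refine Fin.cases ?_ (fun i => ?_) i <;> simp

/-- Positive times suffice because the observations vanish at time 0. -/
theorem commute_Yt_of_commute_funCalc {y : H →L[ℂ] H}
    (hy : ∀ t k f, 0 < t → funCalc (𝔉.Y t k) f * y = y * funCalc (𝔉.Y t k) f) (t : ℝ≥0) :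
    ∀ g ∈ 𝔉.Yt t, g * y = y * g := by
  intro g hg
  rw [mem_Yt_iff] at hg
  have key : ∀ y : H →L[ℂ] H,
      (∀ t k f, 0 < t → funCalc (𝔉.Y t k) f * y = y * funCalc (𝔉.Y t k) f) →
      ∀ s k, CommutesWith y (𝔉.Y s k) := by
    intro y hy s k
    rcases eq_zero_or_pos s with rfl | hs
    · rw [𝔉.Y_zero]; exact .zero y
    · exact commutesWith_of_funCalc (𝔉.Y_selfAdjoint s k) fun f => (hy s k f hs).symm
  refine (hg y fun s _ k => ⟨key y hy s k, key (star y) (fun t k f ht => ?_) s k⟩).symm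
  have := congrArg star (hy t k f ht)
  rw [star_mul, star_mul, star_funCalc] at this
  exact this.symm

/-- Initial states which agree on all the elements of `fellerSet` give rise to the same law of
the observations. -/
theorem obsEquiv_of_eqOn {ρ₁ ρ₂ : StateSpace A} (h : ∀ Z ∈ 𝔉.fellerSet, ρ₁.1 Z = ρ₂.1 Z) :
    𝔉.ObsEquiv ρ₁ ρ₂ := by
  intro B hB
  obtain ⟨u₁, v₁, hφ₁, -⟩ := 𝔉.exists_extension ρ₁
  obtain ⟨u₂, v₂, hφ₂, -⟩ := 𝔉.exists_extension ρ₂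
  have hspan : ∀ x ∈ Submodule.span ℂ 𝔉.obsProducts,
      vecFunctional u₁ v₁ x = vecFunctional u₂ v₂ x := by
    intro x hx
    refine LinearMap.eqOn_span (fun y hy => ?_) hx
    obtain ⟨Z, hZ, hyM, e⟩ := 𝔉.exists_fellerSet_apply hy
    have e1 := e ρ₁
    have e2 := e ρ₂
    rw [hφ₁] at e1
    rw [hφ₂, ← h Z hZ, ← e1] at e2
    exact e2.symm
  -- The span need only be invariant under left multiplication by functions of single observations.
  -- One approximating sequence serves both states.
  obtain ⟨s, hs, hlim⟩ := exists_seq_tendsto_amplify (S := Submodule.span ℂ 𝔉.obsProducts)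
    (G := {g | ∃ t k f, 0 < t ∧ g = funCalc (𝔉.Y t k) f})
    (Submodule.subset_span ⟨0, Fin.elim0, Fin.elim0, Fin.elim0, fun i => i.elim0, by
      simp [funCalcProd]⟩)
    (by rintro _ ⟨t, k, f, ht, rfl⟩; exact ⟨t, k, f, ht, star_funCalc _ _⟩)
    (by
      rintro _ ⟨t, k, f, ht, rfl⟩ s hs
      have : Submodule.span ℂ 𝔉.obsProducts ≤ (Submodule.span ℂ 𝔉.obsProducts).comap
          (LinearMap.mulLeft ℂ (funCalc (𝔉.Y t k) f)) := by
        rw [Submodule.span_le]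
        exact fun x hx => Submodule.subset_span (𝔉.mul_mem_obsProducts ht k f hx)
      exact this hs)
    (x := (B : H →L[ℂ] H))
    (fun y hy => ((𝔉.mem_Yinf_iff.1 hB) y (𝔉.commute_Yt_of_commute_funCalc
      fun t k f ht => hy _ ⟨t, k, f, ht, rfl⟩)).symm) ![v₁, v₂]
  have h1 := (tendsto_const_nhds (x := u₁)).inner (hlim 0) (𝕜 := ℂ)
  have h2 := (tendsto_const_nhds (x := u₂)).inner (hlim 1) (𝕜 := ℂ)
  simp only [Matrix.cons_val] at h1 h2
  rw [hφ₁, hφ₂]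
  refine tendsto_nhds_unique h1 (h2.congr fun k => ?_)
  exact (hspan (s k) (hs k)).symm

end Model

/-! ### Contractivity of conditional expectations, and duality between `|G|` and bounded
multipliers. -/

section TraceNorm

variable {H : Type*} [NormedAddCommGroup H] [InnerProductSpace ℂ H] [CompleteSpace H]

theorem IsCondExp.apply_nonneg {M M₀ : VonNeumannAlgebra H} {φ : Elem M →ₗ[ℂ] ℂ}
    {E : Elem M →ₗ[ℂ] Elem M} (hE : IsCondExp M M₀ φ E) {X : Elem M}
    (hX : 0 ≤ (X : H →L[ℂ] H)) : 0 ≤ (E X : H →L[ℂ] H) := by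
  obtain ⟨y, hy, hyX⟩ := exists_star_mul_self_of_nonneg (N := M) X.2 hX
  have h : X = Star.star (⟨y, hy⟩ : Elem M) * ⟨y, hy⟩ := Subtype.ext hyX.symm
  rw [h, ContinuousLinearMap.nonneg_iff_isPositive]
  exact hE.nonneg _

theorem IsCondExp.norm_apply_le {M M₀ : VonNeumannAlgebra H} {φ : Elem M →ₗ[ℂ] ℂ}
    {E : Elem M →ₗ[ℂ] Elem M} (hE : IsCondExp M M₀ φ E) {X : Elem M} (hX : IsSelfAdjoint X) :
    ‖(E X : H →L[ℂ] H)‖ ≤ ‖(X : H →L[ℂ] H)‖ := by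
  have hX' : IsSelfAdjoint (X : H →L[ℂ] H) := congrArg Subtype.val hX
  have hEX : IsSelfAdjoint (E X : H →L[ℂ] H) := by
    have h := hE.star X
    rw [hX.star_eq] at h
    exact congrArg Subtype.val h.symm
  let c : ℝ := ‖(X : H →L[ℂ] H)‖
  have e1 : ((((c : ℂ) • (1 : Elem M) : Elem M)) : H →L[ℂ] H) = algebraMap ℝ (H →L[ℂ] H) c := by
    rw [Algebra.algebraMap_eq_smul_one, ← Complex.coe_smul]; rfl
  have e2 : E ((c : ℂ) • 1) = (c : ℂ) • 1 := by rw [map_smul, hE.one]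
  refine norm_le_of_neg_algebraMap_le hEX (norm_nonneg _) ?_ ?_
  · have h := hE.apply_nonneg (X := (c : ℂ) • 1 + X) (by
      change 0 ≤ ((((c : ℂ) • (1 : Elem M) : Elem M)) : H →L[ℂ] H) + X
      rw [e1, ← neg_le_iff_add_nonneg']
      exact hX'.neg_algebraMap_norm_le_self)
    rw [map_add, e2] at h
    change 0 ≤ ((((c : ℂ) • (1 : Elem M) : Elem M)) : H →L[ℂ] H) + E X at h
    rwa [e1, ← neg_le_iff_add_nonneg'] at h
  · have h := hE.apply_nonneg (X := (c : ℂ) • 1 - X) (by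
      change 0 ≤ ((((c : ℂ) • (1 : Elem M) : Elem M)) : H →L[ℂ] H) - X
      rw [e1, sub_nonneg]
      exact hX'.le_algebraMap_norm_self)
    rw [map_sub, e2] at h
    change 0 ≤ ((((c : ℂ) • (1 : Elem M) : Elem M)) : H →L[ℂ] H) - E X at h
    rwa [e1, sub_nonneg] at h

/-- The trace norm of the functional `φ(· G)` dominates `φ(|G|)`. -/
theorem IsStateOn.norm_abs_le {N : VonNeumannAlgebra H} {φ : (H →L[ℂ] H) →ₗ[ℂ] ℂ}
    (hφ : IsStateOn N φ) {G : H →L[ℂ] H} (hG : G ∈ N) {ε : ℝ}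
    (h : ∀ B ∈ N, ‖φ (B * G)‖ ≤ ε * ‖B‖) (hε : 0 ≤ ε) : ‖φ (CFC.abs G)‖ ≤ ε := by
  refine le_of_forall_pos_le_add fun δ hδ => ?_
  set a := CFC.abs G with ha
  have haN : a ∈ N := (absElem (⟨G, hG⟩ : Elem N)).2
  have ha0 : 0 ≤ a := CFC.abs_nonneg G
  have hasa : IsSelfAdjoint a := .of_nonneg ha0
  have haa : a * a = star G * G := CFC.abs_mul_abs G
  have hpos : ∀ x : ℝ, max x 0 + δ ≠ 0 := fun x => by positivity
  let f : ℝ → ℝ := fun x => (max x 0 + δ)⁻¹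
  have hf : Continuous f := by
    refine Continuous.inv₀ (by fun_prop) hpos
  have hsq : Continuous fun x : ℝ => x * x := by fun_prop
  have hfsa : IsSelfAdjoint (cfc f a) := cfc_predicate _ _
  have hmul : cfc f a * (a * a) = cfc (fun x => f x * (x * x)) a := by
    rw [cfc_mul f (fun x => x * x) a hf.continuousOn hsq.continuousOn,
      cfc_mul (fun x : ℝ => x) (fun x => x) a, cfc_id' ℝ a]
  have hspec : ∀ x ∈ spectrum ℝ a, 0 ≤ x := fun x hx => spectrum_nonneg_of_nonneg ha0 hx
  -- `B = (|G| + δ)⁻¹ G*` approximates the adjoint of the polar part of `G` inside `N`. It is a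
  -- contraction, and `B G = |G|² / (|G| + δ)` is within `δ` of `|G|`.
  let B := cfc f a * star G
  have hB : B ∈ N := mul_mem (cfc_mem_vn haN f) (star_mem hG)
  have hBB : B * star B = cfc (fun x => f x * (x * x) * f x) a := by
    rw [cfc_mul (fun x => f x * (x * x)) f a (hf.mul hsq).continuousOn hf.continuousOn, ← hmul, haa]
    simp only [B, star_mul, star_star, hfsa.star_eq, mul_assoc]
  have hBn : ‖B‖ ≤ 1 := by
    have h1 : ‖B * star B‖ ≤ 1 := by
      rw [hBB]
      refine norm_cfc_le zero_le_one fun x hx => ?_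
      have hx0 := hspec x hx
      have e : f x * (x * x) * f x = (x / (x + δ)) ^ 2 := by
        simp only [f, max_eq_left hx0]; ring
      rw [e, Real.norm_of_nonneg (by positivity)]
      refine pow_le_one₀ (by positivity) ?_
      rw [div_le_one (by positivity)]
      linarith
    rw [CStarRing.norm_self_mul_star] at h1
    nlinarith [norm_nonneg B]
  have hBG : B * G = cfc (fun x => f x * (x * x)) a := by
    rw [← hmul, haa, mul_assoc]
  have hdiff : ‖a - B * G‖ ≤ δ := by
    have e : a - B * G = cfc (fun x => x - f x * (x * x)) a := by
      rw [cfc_sub (fun x : ℝ => x) (fun x => f x * (x * x)) a continuousOn_id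
        (hf.mul hsq).continuousOn, cfc_id' ℝ a, hBG]
    rw [e]
    refine norm_cfc_le hδ.le fun x hx => ?_
    have hx0 := hspec x hx
    have e : x - f x * (x * x) = δ * (x / (x + δ)) := by
      have : x + δ ≠ 0 := by positivity
      simp only [f, max_eq_left hx0]
      field_simp
      ring
    rw [e, Real.norm_of_nonneg (by positivity)]
    refine mul_le_of_le_one_right hδ.le ?_
    rw [div_le_one (by positivity)]
    linarith
  have h2 : φ a = φ (B * G) + φ (a - B * G) := by rw [map_sub]; ring
  rw [h2]
  refine (norm_add_le _ _).trans (add_le_add ((h B hB).trans ?_) ?_)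
  · exact mul_le_of_le_one_right hε hBn
  · exact (hφ.norm_le (sub_mem haN (mul_mem hB hG))).trans hdiff

end TraceNorm

/-! ### Filters, the asymptotic kernel, and the observable space. -/

namespace Model

variable {A : Type*} [CStarAlgebra A] [PartialOrder A] [StarOrderedRing A]
  {H : Type*} [NormedAddCommGroup H] [InnerProductSpace ℂ H] [CompleteSpace H] {n : ℕ}
  (𝔉 : Model A H n)

theorem norm_j_le (t : ℝ≥0) (X : A) : ‖(𝔉.j t X : H →L[ℂ] H)‖ ≤ ‖X‖ :=
  NonUnitalStarAlgHom.norm_apply_le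
    ((𝔉.M.toStarSubalgebra.subtype : Elem 𝔉.M →⋆ₙₐ[ℂ] (H →L[ℂ] H)).comp (𝔉.j t)) X

/-- The properties of the filter at time `t` as a map into the bounded operators. -/
structure IsFilterMap (ρ : StateSpace A) (t : ℝ≥0) (p : A →ₗ[ℂ] (H →L[ℂ] H)) : Prop where
  mem : ∀ X, p X ∈ 𝔉.Yt t
  star : ∀ X, p (star X) = star (p X)
  norm_le : ∀ X, ‖p X‖ ≤ 2 * ‖X‖
  apply_mul : ∀ φ : (H →L[ℂ] H) →ₗ[ℂ] ℂ, (∀ X : Elem 𝔉.M, 𝔉.Φ ρ X = φ X) →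
    ∀ B ∈ 𝔉.Yt t, ∀ X, φ (B * p X) = φ (B * (𝔉.j t X : H →L[ℂ] H))

theorem IsFilter.exists_isFilterMap {𝔉 : Model A H n} {ρ : StateSpace A} {t : ℝ≥0}
    {π : A → Elem 𝔉.M} (h : 𝔉.IsFilter ρ t π) :
    ∃ p : A →ₗ[ℂ] (H →L[ℂ] H), (∀ X, (π X : H →L[ℂ] H) = p X) ∧ 𝔉.IsFilterMap ρ t p := by
  obtain ⟨E, hE, hπ⟩ := h
  let jN : A →ₗ[ℂ] Elem (𝔉.filterDomain t) :=
    { toFun := fun X => ⟨𝔉.j t X, 𝔉.j_mem_filterDomain t X⟩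
      map_add' := fun X Y => Subtype.ext (congrArg (Subtype.val : Elem 𝔉.M → _) (map_add (𝔉.j t) X Y) :)
      map_smul' := fun c X => Subtype.ext (congrArg (Subtype.val : Elem 𝔉.M → _) (map_smul (𝔉.j t) c X) :) }
  have hjN : ∀ X, (jN X : H →L[ℂ] H) = 𝔉.j t X := fun X => rfl
  have hjs : ∀ X, jN (star X) = star (jN X) := fun X => Subtype.ext (by
    rw [hjN, map_star]; rfl)
  let p : A →ₗ[ℂ] (H →L[ℂ] H) :=
    (𝔉.filterDomain t).toStarSubalgebra.subtype.toAlgHom.toLinearMap ∘ₗ E ∘ₗ jN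
  have hp : ∀ X, p X = E (jN X) := fun X => rfl
  have hsa : ∀ X : selfAdjoint A, ‖p X‖ ≤ ‖X‖ := fun X => by
    refine (hE.norm_apply_le (X := jN X) ?_).trans (𝔉.norm_j_le t X)
    rw [isSelfAdjoint_iff, ← hjs, X.2.star_eq]
  refine ⟨p, hπ, fun X => hE.mem _, fun X => ?_, fun X => ?_, fun φ hφ B hB X => ?_⟩
  · rw [hp, hp, hjs, hE.star]; rfl
  -- Contractivity is available on self-adjoint elements only, so the two parts of `X` cost a factor
  -- 2.
  · have h1 := hsa (realPart X)
    have h2 := hsa (imaginaryPart X)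
    have h3 := realPart.norm_le X
    have h4 := imaginaryPart.norm_le X
    conv_lhs => rw [← realPart_add_I_smul_imaginaryPart X]
    rw [map_add, map_smul]
    refine (norm_add_le _ _).trans ?_
    rw [norm_smul, Complex.norm_I, one_mul]
    linarith
  · let B' : Elem (𝔉.filterDomain t) := ⟨B, hE.le hB⟩
    have h1 := hE.module B' (jN X) 1 hB (one_mem (𝔉.Yt t))
    rw [mul_one, mul_one] at h1
    have h2 := hE.state (B' * jN X)
    rw [h1] at h2
    exact (hφ _).symm.trans (h2.trans (hφ _))

/-- The elements at which the maps `d t` vanish asymptotically, in trace norm. -/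
def asymptoticKernel (φ : (H →L[ℂ] H) →ₗ[ℂ] ℂ) (d : ℝ≥0 → A →ₗ[ℂ] (H →L[ℂ] H)) :
    Submodule ℂ A where
  carrier := {X | ∀ ε > 0, ∃ T, ∀ t ≥ T, ∀ B ∈ 𝔉.Yt t, ‖φ (B * d t X)‖ ≤ ε * ‖B‖}
  zero_mem' := fun ε hε => ⟨0, fun t _ B _ => by
    rw [map_zero, mul_zero, map_zero, norm_zero]; positivity⟩
  add_mem' := by
    intro X Y hX hY ε hε
    obtain ⟨S, hS⟩ := hX (ε / 2) (half_pos hε)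
    obtain ⟨T, hT⟩ := hY (ε / 2) (half_pos hε)
    refine ⟨max S T, fun t ht B hB => ?_⟩
    have h1 := hS t ((le_max_left _ _).trans ht) B hB
    have h2 := hT t ((le_max_right _ _).trans ht) B hB
    rw [map_add, mul_add, map_add]
    refine (norm_add_le _ _).trans ?_
    linarith
  smul_mem' := by
    intro c X hX ε hε
    have hc : 0 < ‖c‖ + 1 := by positivity
    obtain ⟨T, hT⟩ := hX (ε / (‖c‖ + 1)) (div_pos hε hc)
    refine ⟨T, fun t ht B hB => ?_⟩
    have h1 := hT t ht B hB
    rw [map_smul, mul_smul_comm, map_smul, norm_smul]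
    have h2 : (‖c‖ + 1) * (ε / (‖c‖ + 1) * ‖B‖) = ε * ‖B‖ := by field_simp
    rw [← h2]
    gcongr
    linarith

section AsymptoticKernel

variable {𝔉} {φ : (H →L[ℂ] H) →ₗ[ℂ] ℂ} {d : ℝ≥0 → A →ₗ[ℂ] (H →L[ℂ] H)}

/-- The maps `d t` are equicontinuous, since `C` does not depend on `t`. -/
theorem isClosed_asymptoticKernel (hφ : IsStateOn 𝔉.M φ) (hd : ∀ t X, d t X ∈ 𝔉.Yt t) {C : ℝ}
    (hC : 0 < C) (hdC : ∀ t X, ‖d t X‖ ≤ C * ‖X‖) :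
    IsClosed (𝔉.asymptoticKernel φ d : Set A) := by
  rw [← closure_subset_iff_isClosed]
  intro X hX ε hε
  obtain ⟨X', hX', hdist⟩ := Metric.mem_closure_iff.1 hX (ε / 2 / C) (by positivity)
  obtain ⟨T, hT⟩ := hX' (ε / 2) (half_pos hε)
  refine ⟨T, fun t ht B hB => ?_⟩
  have h1 := hT t ht B hB
  have e : φ (B * d t X) = φ (B * d t X') + φ (B * d t (X - X')) := by
    rw [map_sub, mul_sub, map_sub]; ring
  have h2 : ‖φ (B * d t (X - X'))‖ ≤ ε / 2 * ‖B‖ := by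
    refine (hφ.norm_le (mul_mem (𝔉.Yt_le_M t hB) (𝔉.Yt_le_M t (hd t _)))).trans ?_
    refine (norm_mul_le _ _).trans ?_
    rw [mul_comm]
    refine mul_le_mul_of_nonneg_right ?_ (norm_nonneg B)
    refine (hdC t _).trans ?_
    rw [← dist_eq_norm, ← le_div_iff₀' hC]
    exact hdist.le
  rw [e]
  refine (norm_add_le _ _).trans ?_
  linarith

theorem star_mem_asymptoticKernel (hφ : IsStateOn 𝔉.M φ) (hd : ∀ t X, d t X ∈ 𝔉.Yt t)
    (hstar : ∀ t X, d t (star X) = star (d t X)) {X : A} (hX : X ∈ 𝔉.asymptoticKernel φ d) :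
    star X ∈ 𝔉.asymptoticKernel φ d := by
  intro ε hε
  obtain ⟨T, hT⟩ := hX ε hε
  refine ⟨T, fun t ht B hB => ?_⟩
  have h1 := hT t ht (star B) (star_mem hB)
  have e : B * d t (star X) = star (star B * d t X) := by
    rw [star_mul, star_star, hstar]
    exact 𝔉.selfNondemolition t _ hB _ (star_mem (hd t X))
  rw [e, hφ.map_star (𝔉.Yt_le_M t (mul_mem (star_mem hB) (hd t X))), norm_star]
  rwa [norm_star] at h1

end AsymptoticKernel

/-- The filters merge asymptotically on the functions of the future
increments. -/
theorem mem_asymptoticKernel_of_mem_fellerSet {ρ₁ ρ₂ : StateSpace A} (hac : 𝔉.ObsAbsCont ρ₁ ρ₂)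
    {p₁ p₂ : ℝ≥0 → A →ₗ[ℂ] (H →L[ℂ] H)} (hp₁ : ∀ t, 𝔉.IsFilterMap ρ₁ t (p₁ t))
    (hp₂ : ∀ t, 𝔉.IsFilterMap ρ₂ t (p₂ t)) {u₁ v₁ u₂ v₂ : Amp ℕ H}
    (hφ₁ : ∀ X : Elem 𝔉.M, 𝔉.Φ ρ₁ X = vecFunctional u₁ v₁ X)
    (hs₁ : IsStateOn 𝔉.M (vecFunctional u₁ v₁))
    (hφ₂ : ∀ X : Elem 𝔉.M, 𝔉.Φ ρ₂ X = vecFunctional u₂ v₂ X)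
    (hs₂ : IsStateOn 𝔉.M (vecFunctional u₂ v₂)) {Z : A} (hZ : Z ∈ 𝔉.fellerSet) :
    Z ∈ 𝔉.asymptoticKernel (vecFunctional u₁ v₁) (fun t => p₁ t - p₂ t) := by
  intro ε hε
  obtain ⟨m, τ, k, f, -, hZ⟩ := hZ
  obtain ⟨C, hC⟩ := norm_funCalcProd_le (H := H) f
  have hC0 : 0 ≤ C := (norm_nonneg _).trans (hC fun _ => 0)
  have hK : 0 < C + 2 * ‖Z‖ + 1 := by positivity
  -- The density belongs to a finite time `T`. From then on it can be absorbed into the test element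
  -- `B` of `Yt t`, which makes the estimate uniform in `t` and `B`.
  obtain ⟨T, D, hD, hdens⟩ := exists_density (N := 𝔉.Yinf) (F := 𝔉.Yt) 𝔉.Yinf_commutative
    𝔉.Yt_mono 𝔉.Yt_le_Yinf
    (fun x hx y hy => (𝔉.mem_Yinf_iff.1 hx y hy).symm)
    (hs₁.mono 𝔉.Yinf_le_M) (hs₂.mono 𝔉.Yinf_le_M)
    (fun q hq hqp hq2 => by
      have := hac ⟨q, 𝔉.Yinf_le_M hq⟩ hq
        ⟨Subtype.ext hqp.1, Subtype.ext hqp.2⟩ (by rw [hφ₂]; exact hq2)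
      rwa [hφ₁] at this)
    (div_pos hε hK)
  refine ⟨T, fun t ht B hB => ?_⟩
  let W : H →L[ℂ] H := funCalcProd (fun i => (𝔉.Y (t + τ i) (k i) - 𝔉.Y t (k i)).closure) f
  have hW : W ∈ 𝔉.Yinf := funCalcProd_mem fun i =>
    𝔉.Yt_le_Yinf _ (𝔉.funCalc_increment_mem t (τ i) (k i) (f i))
  have hWn : ‖W‖ ≤ C := hC _
  have hDt : D ∈ 𝔉.Yt t := 𝔉.Yt_mono ht hD
  have h1 : vecFunctional u₁ v₁ (B * p₁ t Z) = vecFunctional u₁ v₁ (B * W) := by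
    rw [(hp₁ t).apply_mul _ hφ₁ B hB]
    exact (𝔉.condExpEq_apply hφ₁ hs₁ ((hZ ρ₁).2 t ⟨W, 𝔉.Yinf_le_M hW⟩ rfl)
      (𝔉.Yt_le_Mt t hB)).symm
  have h2 : vecFunctional u₂ v₂ (D * (B * p₂ t Z)) = vecFunctional u₂ v₂ (D * (B * W)) := by
    rw [← mul_assoc, ← mul_assoc, (hp₂ t).apply_mul _ hφ₂ (D * B) (mul_mem hDt hB)]
    exact (𝔉.condExpEq_apply hφ₂ hs₂ ((hZ ρ₂).2 t ⟨W, 𝔉.Yinf_le_M hW⟩ rfl)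
      (𝔉.Yt_le_Mt t (mul_mem hDt hB))).symm
  have h3 := hdens (B * W) (mul_mem (𝔉.Yt_le_Yinf t hB) hW)
  have h4 := hdens (B * p₂ t Z) (𝔉.Yt_le_Yinf t (mul_mem hB ((hp₂ t).mem Z)))
  -- The terms in `φ₂` cancel by `h2`, leaving two density errors, at `B * W` and at `B * p₂ t Z`.
  have e : vecFunctional u₁ v₁ (B * (p₁ t - p₂ t) Z) =
      (vecFunctional u₁ v₁ (B * W) - vecFunctional u₂ v₂ (D * (B * W))) -
        (vecFunctional u₁ v₁ (B * p₂ t Z) - vecFunctional u₂ v₂ (D * (B * p₂ t Z))) := by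
    rw [h2, LinearMap.sub_apply, mul_sub, map_sub, h1]
    ring
  have h5 : ‖B * W‖ ≤ ‖B‖ * C := (norm_mul_le _ _).trans (by gcongr)
  have h6 : ‖B * p₂ t Z‖ ≤ ‖B‖ * (2 * ‖Z‖) :=
    (norm_mul_le _ _).trans (mul_le_mul_of_nonneg_left ((hp₂ t).norm_le Z) (norm_nonneg B))
  have hη : 0 < ε / (C + 2 * ‖Z‖ + 1) := div_pos hε hK
  show ‖vecFunctional u₁ v₁ (B * (p₁ t - p₂ t) Z)‖ ≤ ε * ‖B‖
  rw [e]
  calc _ ≤ ε / (C + 2 * ‖Z‖ + 1) * ‖B * W‖ + ε / (C + 2 * ‖Z‖ + 1) * ‖B * p₂ t Z‖ :=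
        (norm_sub_le _ _).trans (add_le_add h3 h4)
    _ ≤ ε / (C + 2 * ‖Z‖ + 1) * (‖B‖ * C) + ε / (C + 2 * ‖Z‖ + 1) * (‖B‖ * (2 * ‖Z‖)) := by
        gcongr
    _ = ε / (C + 2 * ‖Z‖ + 1) * (‖B‖ * (C + 2 * ‖Z‖)) := by ring
    _ ≤ ε / (C + 2 * ‖Z‖ + 1) * (‖B‖ * (C + 2 * ‖Z‖ + 1)) := by
        refine mul_le_mul_of_nonneg_left ?_ hη.le
        exact mul_le_mul_of_nonneg_left (by linarith) (norm_nonneg B)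
    _ = ε * ‖B‖ := by field_simp

theorem exists_mem_fellerSet_apply_eq_one :
    ∃ e ∈ 𝔉.fellerSet, ∀ σ : StateSpace A, σ.1 e = 1 := by
  obtain ⟨e, he, h1, h⟩ := 𝔉.exists_fellerSet_apply (x := 1)
    ⟨0, Fin.elim0, Fin.elim0, Fin.elim0, fun i => i.elim0, by simp [funCalcProd]⟩
  exact ⟨e, he, fun σ => (h σ).symm.trans (𝔉.Φ_state σ).2⟩

/-- The observable space lies in every closed, star-invariant subspace that contains the
elements representing functions of the future increments. -/
theorem observableSpace_le (ρ : StateSpace A) {V : Submodule ℂ A} (hV : IsClosed (V : Set A))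
    (hstar : ∀ X ∈ V, star X ∈ V) (hF : 𝔉.fellerSet ⊆ V) : 𝔉.observableSpace ≤ V := by
  have key : ∀ ψ : A →L[ℂ] ℂ, (∀ v ∈ V, ψ v = 0) → ∀ X ∈ 𝔉.observableSpace,
      (ψ (X + star X)).re = 0 := by
    intro ψ hψ X hX
    let r : A →ₗ[ℝ] ℝ :=
      { toFun := fun a => (ψ (a + star a)).re
        map_add' := fun a b => by
          rw [star_add, add_add_add_comm, map_add, Complex.add_re]
        map_smul' := fun c a => by
          rw [star_smul, star_trivial, ← smul_add, ← Complex.coe_smul, map_smul, smul_eq_mul,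
            Complex.re_ofReal_mul]
          rfl }
    have hr : ∀ a, r a = (ψ (a + star a)).re := fun a => rfl
    have hrV : ∀ v ∈ V, r v = 0 := fun v hv => by
      rw [hr, hψ _ (V.add_mem hv (hstar v hv)), Complex.zero_re]
    obtain ⟨e, heF, he⟩ := 𝔉.exists_mem_fellerSet_apply_eq_one
    obtain ⟨c, hc, σ₁, σ₂, hσ⟩ := exists_states_sub ρ r (C := ‖ψ‖ * 2) (fun a => by
        refine (Complex.abs_re_le_norm _).trans ((ψ.le_opNorm _).trans ?_)
        rw [mul_assoc]
        refine mul_le_mul_of_nonneg_left ?_ (norm_nonneg ψ)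
        refine (norm_add_le _ _).trans ?_
        rw [norm_star]
        linarith) (fun a => by rw [hr, hr, star_star, add_comm]) he (hrV e (hF heF))
    have hcC : (c : ℂ) ≠ 0 := Complex.ofReal_ne_zero.2 hc
    -- Agreement needs `r` to vanish at both `Z` and `i Z`; this is where complex linearity of `V`
    -- enters.
    have hagree : ∀ Z ∈ 𝔉.fellerSet, σ₁.1 Z = σ₂.1 Z := fun Z hZ => by
      have := hσ Z
      rw [hrV Z (hF hZ), hrV _ (V.smul_mem _ (hF hZ)), Complex.ofReal_zero, mul_zero, sub_zero,
        mul_eq_zero] at this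
      exact sub_eq_zero.1 (this.resolve_left hcC)
    have h1 := hσ X
    rw [hX σ₁ σ₂ (𝔉.obsEquiv_of_eqOn hagree), sub_self, mul_zero] at h1
    have h2 := congrArg Complex.re h1
    rw [← hr]
    simpa using h2.symm
  intro X hX
  by_contra hXV
  obtain ⟨ψ, u, hu, huV⟩ := RCLike.geometric_hahn_banach_point_closed (𝕜 := ℂ)
    (V.restrictScalars ℝ).convex hV hXV
  simp only [RCLike.re_to_complex] at hu huV
  have hu0 : u < 0 := by
    have := huV 0 V.zero_mem
    rwa [map_zero] at this
  have hψV : ∀ v ∈ V, ψ v = 0 := by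
    intro v hv
    by_contra hne
    have := huV _ (V.smul_mem (((u - 1 : ℝ) : ℂ) / ψ v) hv)
    rw [map_smul, smul_eq_mul, div_mul_cancel₀ _ hne, Complex.ofReal_re] at this
    linarith
  -- `key` controls only a hermitian part of `ψ`. Applying it to `(ψ, X)` and to `(-i ψ, i X)` gives
  -- `Re (ψ X ± ψ X*) = 0`, hence `Re (ψ X) = 0`, against the separation `Re (ψ X) < u < 0`.
  have h1 := key ψ hψV X hX
  have h2 := key ((-Complex.I) • ψ) (fun v hv => by
    rw [smul_apply, hψV v hv, smul_zero]) (Complex.I • X)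
    (Submodule.smul_mem _ _ hX)
  have e : ((-Complex.I) • ψ) (Complex.I • X + star (Complex.I • X)) = ψ X - ψ (star X) := by
    rw [smul_apply, star_smul, Complex.star_def, Complex.conj_I, map_add,
      map_smul, map_smul, smul_eq_mul, smul_eq_mul, smul_eq_mul]
    linear_combination (ψ (star X) - ψ X) * Complex.I_mul_I
  rw [e, Complex.sub_re] at h2
  rw [map_add, Complex.add_re] at h1
  linarith

end Model

end QFilter

end

theorem mainTheorem2 {A : Type*} [CStarAlgebra A] [PartialOrder A] [StarOrderedRing A]
    {H : Type*} [NormedAddCommGroup H] [InnerProductSpace ℂ H] [CompleteSpace H] {n : ℕ}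
    (𝔉 : QFilter.Model A H n) (ρ₁ ρ₂ : QFilter.StateSpace A)
    (hac : 𝔉.ObsAbsCont ρ₁ ρ₂)
    (π₁ π₂ : NNReal → A → QFilter.Elem 𝔉.M)
    (hπ₁ : ∀ t, 𝔉.IsFilter ρ₁ t (π₁ t)) (hπ₂ : ∀ t, 𝔉.IsFilter ρ₂ t (π₂ t)) :
    ∀ X ∈ 𝔉.observableSpace,
      Filter.Tendsto (fun t => 𝔉.Φ ρ₁ (QFilter.absElem (π₁ t X - π₂ t X)))
        Filter.atTop (nhds 0) := by
  intro X hX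
  choose p₁ hp₁ hf₁ using fun t => (hπ₁ t).exists_isFilterMap
  choose p₂ hp₂ hf₂ using fun t => (hπ₂ t).exists_isFilterMap
  obtain ⟨u₁, v₁, hφ₁, hs₁⟩ := 𝔉.exists_extension ρ₁
  obtain ⟨u₂, v₂, hφ₂, hs₂⟩ := 𝔉.exists_extension ρ₂
  have hmem : ∀ t X, (p₁ t - p₂ t) X ∈ 𝔉.Yt t := fun t X => sub_mem ((hf₁ t).mem X) ((hf₂ t).mem X)
  have hXker := 𝔉.observableSpace_le ρ₁
    (QFilter.Model.isClosed_asymptoticKernel (d := fun t => p₁ t - p₂ t) hs₁ hmem four_pos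
      (fun t X => (norm_sub_le _ _).trans (by
        have h1 := (hf₁ t).norm_le X
        have h2 := (hf₂ t).norm_le X
        linarith)))
    (fun X hX => QFilter.Model.star_mem_asymptoticKernel hs₁ hmem
      (fun t X => by rw [LinearMap.sub_apply, LinearMap.sub_apply, (hf₁ t).star, (hf₂ t).star,
        star_sub]) hX)
    (fun Z hZ => 𝔉.mem_asymptoticKernel_of_mem_fellerSet hac hf₁ hf₂ hφ₁ hs₁ hφ₂ hs₂ hZ) hX
  rw [Metric.tendsto_atTop]
  intro ε hε
  obtain ⟨T, hT⟩ := hXker (ε / 2) (half_pos hε)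
  refine ⟨T, fun t ht => ?_⟩
  -- The duality estimate is applied inside `Yt t`, the algebra over which the asymptotic kernel
  -- tests `d t X`.
  have h1 := (hs₁.mono (𝔉.Yt_le_M t)).norm_abs_le (hmem t X) (hT t ht) (half_pos hε).le
  have e : ((QFilter.absElem (π₁ t X - π₂ t X) : QFilter.Elem 𝔉.M) : H →L[ℂ] H) =
      CFC.abs ((p₁ t - p₂ t) X) := by
    change CFC.abs ((π₁ t X : H →L[ℂ] H) - π₂ t X) = _
    rw [hp₁, hp₂, LinearMap.sub_apply]
  rw [dist_zero_right, hφ₁, e]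
  exact h1.trans_lt (half_lt_self hε)
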